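/- All Banach lattices are real. For $1\le q\le\infty$ and elements $x_1,\dots,x_n$ of a Banach lattice, $\left(\sum_{i=1}^n|x_i|^q\right)^{1/q}$ is defined by Krivine's functional calculus and means $\bigvee_i|x_i|$ when $q=\infty$; $\ell_p$-sums of numbers are read similarly. Let $1\le p,q\le\infty$. A bounded linear operator $T:E\to X$ from a Banach space to a Banach lattice is $(p,q)$-convex if there is $K\ge 1$ with $\left\|\left(\sum_{i=1}^n|Tx_i|^q\right)^{1/q}\right\|\le K\left(\sum_{i=1}^n\|x_i\|^p\right)^{1/p}$ for all $n$ and $x_1,\dots,x_n\in E$. A bounded linear operator $T:X\to E$ is $(p,q)$-concave if there is $K\ge 1$ with $\left(\sum_{i=1}^n\|Tx_i\|^p\right)^{1/p}\le K\left\|\left(\sum_{i=1}^n|x_i|^q\right)^{1/q}\right\|$ for all $n$ and $x_1,\dots,x_n\in X$. A Banach lattice is $(p,q)$-convex (resp. $(p,q)$-concave) if its identity operator is. A linear map $T:X\to Y$ between Banach lattices is of Class $\mathcal C$ if it is an injective lattice homomorphism, is interval preserving ($T[0,x]=[0,Tx]$ for all $x\ge0$), and $T(B_X)$ is closed in $Y$,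 where $B_X$ is the closed unit ball; it is of Class $\mathcal D$ if it is a lattice homomorphism with dense range (such maps are automatically bounded). **Theorem.** Let $X,Y$ be Banach lattices, let $1\le p,q\le\infty$ and $q_2\in\{q,1\}$, and let $T:X\to Y$ be a bounded linear operator that is both $(p,\infty)$-convex and $(q,q_2)$-concave. Let $0<\theta<1$ and define $q_\theta,p_\theta\in[1,\infty]$ by $$q_\theta=\frac q\theta,\qquad \frac1{p_\theta}=\frac{1-\theta}{p}+\theta .$$ Set $\overline{q_2}=q_\theta$ if $q_2=q$, and $\overline{q_2}=1$ if $q_2=1$ (if $q=q_2=1$, the statement holds for both choices of $\overline{q_2}$). Then there exist a $(q_\theta,\overline{q_2})$-concave Banach lattice $\mathcal Z_\theta$, a $(p_\theta,\infty)$-convex Banach lattice $W_\theta$, a Class $\mathcal C$ operator $\Phi:W_\theta\to Y$, a Class $\mathcal D$ operator $\Psi:X\to\mathcal Z_\theta$, and a bounded linear operator $T_\theta:\mathcal Z_\theta\to W_\theta$ such that $T=\Phi\,T_\theta\,\Psi$. -/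

import Mathlib

open scoped ENNReal

universe u v

/-- A (real) Banach lattice: a complete normed vector lattice over `ℝ` whose norm is a lattice norm,
i.e. `|x| ≤ |y|` implies `‖x‖ ≤ ‖y‖`. -/
class BanachLattice (X : Type*) extends NormedAddCommGroup X, NormedSpace ℝ X, Lattice X,
  IsOrderedAddMonoid X, PosSMulMono ℝ X, HasSolidNorm X, CompleteSpace X

/-- The continuous, positively homogeneous functions on `ℝⁿ`. -/
def homFun (n : ℕ) : Submodule ℝ ((Fin n → ℝ) → ℝ) where
  carrier := {h | Continuous h ∧ ∀ c : ℝ, 0 ≤ c → ∀ t, h (c • t) = c * h t}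
  add_mem' := by
    rintro f g ⟨hf, hf'⟩ ⟨hg, hg'⟩
    exact ⟨hf.add hg, fun c hc t => by simp [hf' c hc, hg' c hc, mul_add]⟩
  zero_mem' := ⟨continuous_const, fun c _ t => by simp⟩
  smul_mem' := by
    rintro a f ⟨hf, hf'⟩
    exact ⟨hf.const_smul a, fun c hc t => by simp [hf' c hc, mul_left_comm]⟩

theorem coord_mem_homFun (n : ℕ) (i : Fin n) : (fun t : Fin n → ℝ => t i) ∈ homFun n :=
  ⟨continuous_apply i, fun c _ t => by simp⟩

/-- `Φ` is a functional calculus at `x = (x₁, …, xₙ)`: a linear lattice homomorphism from the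
continuous positively homogeneous functions on `ℝⁿ` to `X` sending the `i`-th coordinate
function to `xᵢ`. It exists and is unique, see below. -/
structure IsKrivineCalculus {X : Type*} [BanachLattice X] {n : ℕ} (x : Fin n → X)
    (Φ : homFun n →ₗ[ℝ] X) : Prop where
  map_coord : ∀ i, Φ ⟨fun t => t i, coord_mem_homFun n i⟩ = x i
  map_sup : ∀ f g s : homFun n, (∀ t, s.1 t = max (f.1 t) (g.1 t)) → Φ s = Φ f ⊔ Φ g

namespace Krivine

variable {X : Type*} [BanachLattice X] {n : ℕ}

/-- The pair of a linear form on `ℝⁿ` and its value at `x`. -/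
def lin (x : Fin n → X) (a : Fin n → ℝ) : ((Fin n → ℝ) → ℝ) × X :=
  (fun t => ∑ i, a i * t i, ∑ i, a i • x i)

/-- The lattice-linear functions paired with their values at `x`. -/
def graph (x : Fin n → X) : Set (((Fin n → ℝ) → ℝ) × X) := latticeClosure (Set.range (lin x))

theorem lin_mem (x : Fin n → X) (a) : lin x a ∈ graph x := subset_latticeClosure ⟨a, rfl⟩

theorem graph_sub (x : Fin n → X) {S : Set (((Fin n → ℝ) → ℝ) × X)} (h : ∀ a, lin x a ∈ S)
    (hs : ∀ z ∈ S, ∀ w ∈ S, z ⊔ w ∈ S) (hi : ∀ z ∈ S, ∀ w ∈ S, z ⊓ w ∈ S) : graph x ⊆ S :=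
  latticeClosure_min (by rintro _ ⟨a, rfl⟩; exact h a) ⟨fun z hz w hw => hs z hz w hw,
    fun z hz w hw => hi z hz w hw⟩

theorem sup_mem (x : Fin n → X) {z w} (hz : z ∈ graph x) (hw : w ∈ graph x) : z ⊔ w ∈ graph x :=
  isSublattice_latticeClosure.1 hz hw

theorem inf_mem (x : Fin n → X) {z w} (hz : z ∈ graph x) (hw : w ∈ graph x) : z ⊓ w ∈ graph x :=
  isSublattice_latticeClosure.2 hz hw

theorem lin_neg (x : Fin n → X) (a) : lin x (-a) = -lin x a := by
  ext <;> simp [lin]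

theorem lin_add (x : Fin n → X) (a b) : lin x (a + b) = lin x a + lin x b := by
  ext <;> simp [lin, add_mul, add_smul, Finset.sum_add_distrib]

theorem lin_smul (x : Fin n → X) (c : ℝ) (a) : lin x (c • a) = c • lin x a := by
  ext <;> simp [lin, mul_smul, Finset.smul_sum, Finset.mul_sum, mul_assoc]

theorem neg_mem (x : Fin n → X) {z} (hz : z ∈ graph x) : -z ∈ graph x := by
  refine graph_sub x (S := {z | -z ∈ graph x}) ?_ ?_ ?_ hz
  · intro a; simpa [lin_neg] using lin_mem x (-a)
  · intro z hz w hw; simpa [neg_sup] using inf_mem x hz hw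
  · intro z hz w hw; simpa [neg_inf] using sup_mem x hz hw

theorem add_mem (x : Fin n → X) {z w} (hz : z ∈ graph x) (hw : w ∈ graph x) :
    z + w ∈ graph x := by
  have h1 : ∀ w ∈ graph x, ∀ a, lin x a + w ∈ graph x := fun w hw a => by
    refine graph_sub x (S := {w | lin x a + w ∈ graph x}) ?_ ?_ ?_ hw
    · intro b; simpa [lin_add] using lin_mem x (a + b)
    · intro z hz w hw; simpa [add_sup] using sup_mem x hz hw
    · intro z hz w hw; simpa [add_inf] using inf_mem x hz hw
  refine graph_sub x (S := {z | z + w ∈ graph x}) (h1 w hw) ?_ ?_ hz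
  · intro z hz w hw; simpa [sup_add] using sup_mem x hz hw
  · intro z hz w hw; simpa [inf_add] using inf_mem x hz hw

theorem smul_mem (x : Fin n → X) (c : ℝ) {z} (hz : z ∈ graph x) : c • z ∈ graph x := by
  have pos : ∀ c : ℝ, 0 < c → c • z ∈ graph x := fun c hc => by
    refine graph_sub x (S := {z | c • z ∈ graph x}) ?_ ?_ ?_ hz
    · intro a; simpa [lin_smul] using lin_mem x (c • a)
    · intro z hz w hw
      have := (OrderIso.smulRight (β := ((Fin n → ℝ) → ℝ) × X) hc).map_sup z w
      simp only [OrderIso.smulRight_apply] at this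
      simpa [this] using sup_mem x hz hw
    · intro z hz w hw
      have := (OrderIso.smulRight (β := ((Fin n → ℝ) → ℝ) × X) hc).map_inf z w
      simp only [OrderIso.smulRight_apply] at this
      simpa [this] using inf_mem x hz hw
  rcases lt_trichotomy c 0 with hc | rfl | hc
  · simpa using neg_mem x (pos (-c) (by linarith))
  · have : lin x 0 = (0 : ℝ) • z := by ext <;> simp [lin]
    exact this ▸ lin_mem x 0
  · exact pos c hc

/-- A finite meet of linear forms which is nonpositive on `ℝⁿ` is nonpositive at `x`. -/
theorem inf_nonpos (x : Fin n → X) (s : Finset (((Fin n → ℝ) → ℝ) × X)) (hs : s.Nonempty)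
    (hsub : (s : Set _) ⊆ Set.range (lin x)) (h : (s.inf' hs id).1 ≤ 0) :
    (s.inf' hs id).2 ≤ 0 := by
  classical
  have hsub' : ∀ v, ∃ b, v ∈ s → lin x b = v := fun v => by
    by_cases hv : v ∈ s
    · obtain ⟨b, hb⟩ := hsub hv; exact ⟨b, fun _ => hb⟩
    · exact ⟨0, fun h => (hv h).elim⟩
  choose a ha using hsub'
  by_cases h0 : (0 : Fin n → ℝ) ∈ convexHull ℝ ((s.image a : Finset _) : Set (Fin n → ℝ))
  · obtain ⟨ι, _, w, z, hw0, hw1, hz, hsum⟩ := mem_convexHull_iff_exists_fintype.1 h0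
    have hz' : ∀ i, ∃ v ∈ s, a v = z i := fun i => by simpa using hz i
    choose v hv hvz using hz'
    let L : (Fin n → ℝ) →ₗ[ℝ] ((Fin n → ℝ) → ℝ) × X :=
      { toFun := lin x, map_add' := lin_add x, map_smul' := lin_smul x }
    have e : ∑ i, w i • v i = 0 := by
      have : ∀ i, v i = L (z i) := fun i => by rw [← hvz]; exact (ha _ (hv i)).symm
      simp_rw [this, ← map_smul, ← map_sum, hsum, map_zero]
    calc (s.inf' hs id).2 = ∑ i, w i • (s.inf' hs id).2 := by rw [← Finset.sum_smul, hw1, one_smul]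
      _ ≤ ∑ i, w i • (v i).2 := Finset.sum_le_sum fun i _ =>
          smul_le_smul_of_nonneg_left (Finset.inf'_le (f := id) (h := hv i)).2 (hw0 i)
      _ = (∑ i, w i • v i).2 := by simp [Prod.snd_sum]
      _ ≤ 0 := by rw [e]; rfl
  · exfalso
    obtain ⟨f, u, h1, h2⟩ := geometric_hahn_banach_point_closed (convex_convexHull ℝ _)
      ((s.image a).finite_toSet.isCompact_convexHull ℝ).isClosed h0
    rw [map_zero] at h1
    set t : Fin n → ℝ := fun i => f (Pi.single i 1)
    have hf : ∀ b, f b = ∑ i, b i * t i := fun b => by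
      conv_lhs => rw [pi_eq_sum_univ' b]
      simp [t]
    have key : (Function.update (s.inf' hs id).1 t u, (s.inf' hs id).2) ≤ s.inf' hs id := by
      refine Finset.le_inf' _ _ fun v hv => ?_
      have hle : s.inf' hs id ≤ v := Finset.inf'_le id hv
      refine ⟨update_le_iff.2 ⟨?_, fun y _ => hle.1 y⟩, hle.2⟩
      have := h2 (a v) (subset_convexHull ℝ _ (Finset.mem_coe.2 (Finset.mem_image_of_mem a hv)))
      rw [hf] at this
      have e : v.1 t = ∑ i, a v i * t i := (congrArg (fun w => w.1 t) (ha v hv)).symm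
      simpa [e] using this.le
    have h3 := key.1 t
    have h4 := h t
    simp only [Function.update_self] at h3
    simp only [Pi.zero_apply] at h4
    linarith

theorem nonpos (x : Fin n → X) {z} (hz : z ∈ graph x) (h : z.1 ≤ 0) : z.2 ≤ 0 := by
  let _ : DistribLattice X := AddCommGroup.toDistribLattice X
  have hz' : z ∈ supClosure (infClosure (Set.range (lin x))) := by
    rw [supClosure_infClosure]; exact hz
  obtain ⟨t, ht, hsub, rfl⟩ := hz'
  have : t.sup' ht id ≤ ((t.sup' ht id).1, 0) := by
    refine Finset.sup'_le _ _ fun w hw => ⟨(Finset.le_sup' id hw).1, ?_⟩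
    obtain ⟨s, hs, hs', e⟩ := hsub hw
    have hw1 : w.1 ≤ 0 := (Finset.le_sup' id hw).1.trans h
    subst e
    exact inf_nonpos x s hs hs' hw1
  exact this.2

/-- The `ℓ₁`-norm on `ℝⁿ`. -/
def nrm (n : ℕ) (t : Fin n → ℝ) : ℝ := ∑ i, |t i|

theorem nrm_mem (x : Fin n → X) : (nrm n, ∑ i, |x i|) ∈ graph x := by
  have : ∀ s : Finset (Fin n), ((fun t => ∑ i ∈ s, |t i|), ∑ i ∈ s, |x i|) ∈ graph x := by
    classical
    intro s
    induction s using Finset.induction_on with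
    | empty =>
      have := lin_mem x 0
      convert this using 1
      ext <;> simp [lin]
    | insert i s hi ih =>
      have h1 := lin_mem x (Pi.single i 1)
      have h2 := add_mem x (sup_mem x h1 (neg_mem x h1)) ih
      convert h2 using 1
      ext <;> simp [lin, Finset.sum_insert hi, abs, Pi.single_apply, ite_smul]
  exact this _

theorem abs_le (x : Fin n → X) {z w} (hz : z ∈ graph x) (hw : w ∈ graph x) {ε : ℝ}
    (h : ∀ t, |z.1 t - w.1 t| ≤ ε * nrm n t) : |z.2 - w.2| ≤ ε • ∑ i, |x i| := by
  have key : ∀ z ∈ graph x, ∀ w ∈ graph x, (∀ t, |z.1 t - w.1 t| ≤ ε * nrm n t) →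
      z.2 - w.2 ≤ ε • ∑ i, |x i| := fun z hz w hw h => by
    have h1 := add_mem x (add_mem x hz (neg_mem x hw)) (neg_mem x (smul_mem x ε (nrm_mem x)))
    have := nonpos x h1 (fun t => by
      have := (le_abs_self _).trans (h t)
      simp; linarith)
    simp only [← sub_eq_add_neg] at this
    exact sub_nonpos.1 this
  refine sup_le (key z hz w hw h) ?_
  rw [neg_sub]
  exact key w hw z hz fun t => by rw [abs_sub_comm]; exact h t

theorem graph_hom (x : Fin n → X) {z} (hz : z ∈ graph x) : z.1 ∈ homFun n := by
  refine graph_sub x (S := {z | z.1 ∈ homFun n}) ?_ ?_ ?_ hz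
  · intro a
    refine ⟨by simp only [lin]; fun_prop, fun c _ t => ?_⟩
    simp [lin, Finset.mul_sum, mul_left_comm]
  · rintro z ⟨hz, hz'⟩ w ⟨hw, hw'⟩
    exact ⟨hz.sup hw, fun c hc t => by simp [hz' c hc, hw' c hc, mul_max_of_nonneg _ _ hc]⟩
  · rintro z ⟨hz, hz'⟩ w ⟨hw, hw'⟩
    exact ⟨hz.inf hw, fun c hc t => by simp [hz' c hc, hw' c hc, mul_min_of_nonneg _ _ hc]⟩

/-- Lattice-linear functions are dense in the continuous positively homogeneous functions. -/
theorem dense (x : Fin n → X) {h} (hh : h ∈ homFun n) {ε : ℝ} (hε : 0 < ε) :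
    ∃ z ∈ graph x, ∀ t, |h t - z.1 t| ≤ ε * nrm n t := by
  let K : Set (Fin n → ℝ) := {t | nrm n t = 1}
  have hcont : Continuous (nrm n) := by unfold nrm; fun_prop
  have hK : IsCompact K := by
    refine Metric.isCompact_of_isClosed_isBounded (isClosed_eq hcont continuous_const) ?_
    refine (Metric.isBounded_closedBall (x := (0 : Fin n → ℝ)) (r := 1)).subset fun t ht => ?_
    rw [mem_closedBall_zero_iff, pi_norm_le_iff_of_nonneg zero_le_one]
    intro i
    have ht : nrm n t = 1 := ht
    rw [← ht]
    exact Finset.single_le_sum (f := fun i => |t i|) (fun i _ => abs_nonneg _) (Finset.mem_univ i)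
  have : CompactSpace K := isCompact_iff_compactSpace.1 hK
  let L : Set C(K, ℝ) := {f | ∃ z ∈ graph x, ∀ t : K, f t = z.1 t}
  have hL : closure L = ⊤ := by
    refine ContinuousMap.sublattice_closure_eq_top L ⟨0, lin x 0, lin_mem x 0, by simp [lin]⟩ ?_ ?_ ?_
    · rintro f ⟨z, hz, hf⟩ g ⟨w, hw, hg⟩
      exact ⟨z ⊓ w, inf_mem x hz hw, fun t => by simp [hf, hg]⟩
    · rintro f ⟨z, hz, hf⟩ g ⟨w, hw, hg⟩
      exact ⟨z ⊔ w, sup_mem x hz hw, fun t => by simp [hf, hg]⟩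
    · intro v s t
      have mk : ∀ z ∈ graph x, ∃ f ∈ L, ∀ t : K, f t = z.1 t := fun z hz =>
        ⟨⟨fun t => z.1 t, (graph_hom x hz).1.comp continuous_subtype_val⟩,
          ⟨z, hz, fun _ => rfl⟩, fun _ => rfl⟩
      by_cases hst : s = t
      · subst hst
        obtain ⟨f, hf, hf'⟩ := mk _ (smul_mem x (v s) (nrm_mem x))
        refine ⟨f, hf, ?_, ?_⟩ <;> · rw [hf']; simp [show nrm n s = 1 from s.2]
      · obtain ⟨i, hi⟩ : ∃ i, s.1 i ≠ t.1 i := by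
          by_contra! hc
          exact hst (Subtype.ext (funext hc))
        have hi' := sub_ne_zero.2 hi
        set b := (v s - v t) / (s.1 i - t.1 i) with hb
        obtain ⟨f, hf, hf'⟩ := mk _ (add_mem x (smul_mem x b (lin_mem x (Pi.single i 1)))
          (smul_mem x (v s - b * s.1 i) (nrm_mem x)))
        refine ⟨f, hf, ?_, ?_⟩
        · rw [hf']; simp [lin, Pi.single_apply, show nrm n s = 1 from s.2]
        · rw [hf']; simp [lin, Pi.single_apply, show nrm n t = 1 from t.2]
          rw [hb]; field_simp; ring
  let hK' : C(K, ℝ) := ⟨fun t => h t, hh.1.comp continuous_subtype_val⟩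
  have hmem : hK' ∈ closure L := by rw [hL]; trivial
  obtain ⟨f, ⟨z, hz, hf⟩, hd⟩ := Metric.mem_closure_iff.1 hmem ε hε
  refine ⟨z, hz, fun t => ?_⟩
  have h0 : 0 ≤ nrm n t := Finset.sum_nonneg fun i _ => abs_nonneg _
  have hzh := graph_hom x hz
  rcases h0.eq_or_lt with h0 | h0
  · have ht : t = 0 := funext fun i => by
      simpa using (Finset.sum_eq_zero_iff_of_nonneg fun i _ => abs_nonneg (t i)).1 h0.symm i
        (Finset.mem_univ i)
    have e1 := hh.2 0 le_rfl 0
    have e2 := hzh.2 0 le_rfl 0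
    simp only [smul_zero, zero_mul] at e1 e2
    simp [ht, e1, e2, nrm]
  · have hr : nrm n ((nrm n t)⁻¹ • t) = 1 := by
      have : nrm n ((nrm n t)⁻¹ • t) = (nrm n t)⁻¹ * nrm n t := by
        have e : |(nrm n t)⁻¹| = (nrm n t)⁻¹ := abs_of_nonneg (inv_nonneg.2 h0.le)
        conv_lhs => rw [nrm]
        simp only [Pi.smul_apply, smul_eq_mul, abs_mul, e, ← Finset.mul_sum]
        rfl
      rw [this, inv_mul_cancel₀ h0.ne']
    have h1 := (ContinuousMap.dist_apply_le_dist (f := hK') (g := f) ⟨_, hr⟩).trans hd.le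
    rw [hf, Real.dist_eq] at h1
    change |h ((nrm n t)⁻¹ • t) - z.1 ((nrm n t)⁻¹ • t)| ≤ ε at h1
    rw [hh.2 _ (inv_nonneg.2 h0.le), hzh.2 _ (inv_nonneg.2 h0.le), ← mul_sub, abs_mul,
      abs_of_nonneg (inv_nonneg.2 h0.le), inv_mul_le_iff₀ h0] at h1
    linarith

/-- `y` is the value at `x` of the function `h`. -/
def Val (x : Fin n → X) (h : (Fin n → ℝ) → ℝ) (y : X) : Prop :=
  ∀ ε > 0, ∃ z ∈ graph x, (∀ t, |h t - z.1 t| ≤ ε * nrm n t) ∧ ‖y - z.2‖ ≤ ε * ‖∑ i, |x i|‖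

theorem norm_le (x : Fin n → X) {z w} (hz : z ∈ graph x) (hw : w ∈ graph x) {ε : ℝ} (hε : 0 ≤ ε)
    (h : ∀ t, |z.1 t - w.1 t| ≤ ε * nrm n t) : ‖z.2 - w.2‖ ≤ ε * ‖∑ i, |x i|‖ := by
  have h1 := (abs_le x hz hw h).trans (le_abs_self _)
  have h2 := HasSolidNorm.solid h1
  rwa [norm_smul, Real.norm_of_nonneg hε] at h2

theorem Val.unique {x : Fin n → X} {h y y'} (hy : Val x h y) (hy' : Val x h y') : y = y' := by
  have key : ∀ ε > 0, ‖y - y'‖ ≤ ε * (4 * ‖∑ i, |x i|‖) := fun ε hε => by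
    obtain ⟨z, hz, h1, h2⟩ := hy ε hε
    obtain ⟨w, hw, h3, h4⟩ := hy' ε hε
    have h5 := norm_le x hz hw (ε := 2 * ε) (by linarith) fun t => by
      have := abs_sub_le (z.1 t) (h t) (w.1 t)
      have h5 := h1 t
      rw [abs_sub_comm] at h5
      linarith [h3 t]
    have h6 : y - y' = (y - z.2) + (z.2 - w.2) - (y' - w.2) := by abel
    have := norm_sub_le ((y - z.2) + (z.2 - w.2)) (y' - w.2)
    have := norm_add_le (y - z.2) (z.2 - w.2)
    rw [h6]; linarith
  refine sub_eq_zero.1 (norm_le_zero_iff.1 (le_of_forall_pos_le_add fun δ hδ => ?_))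
  have hc : 0 ≤ 4 * ‖∑ i, |x i|‖ := by positivity
  have := key (δ / (4 * ‖∑ i, |x i|‖ + 1)) (by positivity)
  refine this.trans ?_
  rw [zero_add, div_mul_eq_mul_div, div_le_iff₀ (by positivity)]
  nlinarith

theorem Val.exists (x : Fin n → X) {h} (hh : h ∈ homFun n) : ∃ y, Val x h y := by
  choose z hz hzh using fun k : ℕ => dense x hh (ε := (1 / 2 : ℝ) ^ k) (by positivity)
  have hd : ∀ k m : ℕ, k ≤ m → ‖(z k).2 - (z m).2‖ ≤ 2 * (1 / 2 : ℝ) ^ k * ‖∑ i, |x i|‖ := by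
    intro k m hkm
    refine norm_le x (hz k) (hz m) (by positivity) fun t => ?_
    have h0 : 0 ≤ nrm n t := Finset.sum_nonneg fun i _ => abs_nonneg _
    have h1 := abs_sub_le ((z k).1 t) (h t) ((z m).1 t)
    have h2 := hzh k t
    rw [abs_sub_comm] at h2
    have h3 := hzh m t
    have h4 := mul_le_mul_of_nonneg_right
      (pow_le_pow_of_le_one (by norm_num : (0 : ℝ) ≤ 1 / 2) (by norm_num) hkm) h0
    linarith
  have hlim : Filter.Tendsto (fun k : ℕ => 2 * (1 / 2 : ℝ) ^ k * ‖∑ i, |x i|‖) Filter.atTop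
      (nhds 0) := by
    have := ((tendsto_pow_atTop_nhds_zero_of_lt_one (by norm_num : (0 : ℝ) ≤ 1 / 2)
      (by norm_num)).const_mul 2).mul_const ‖∑ i, |x i|‖
    simpa using this
  have hC : CauchySeq fun k => (z k).2 := cauchySeq_of_le_tendsto_0' _ (fun k m hkm => by
    rw [dist_eq_norm]; exact hd k m hkm) hlim
  obtain ⟨y, hy⟩ := cauchySeq_tendsto_of_complete hC
  have hyk : ∀ k, ‖(z k).2 - y‖ ≤ 2 * (1 / 2 : ℝ) ^ k * ‖∑ i, |x i|‖ := fun k =>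
    le_of_tendsto (tendsto_const_nhds.sub hy).norm
      (Filter.eventually_atTop.2 ⟨k, fun m hm => hd k m hm⟩)
  refine ⟨y, fun ε hε => ?_⟩
  obtain ⟨k, hk⟩ := exists_pow_lt_of_lt_one (half_pos hε) (by norm_num : (1 / 2 : ℝ) < 1)
  refine ⟨z k, hz k, fun t => (hzh k t).trans ?_, ?_⟩
  · have h0 : 0 ≤ nrm n t := Finset.sum_nonneg fun i _ => abs_nonneg _
    exact mul_le_mul_of_nonneg_right (by linarith) h0
  · rw [norm_sub_rev]
    exact (hyk k).trans (mul_le_mul_of_nonneg_right (by linarith) (norm_nonneg _))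

theorem Val.of_graph {x : Fin n → X} {z} (hz : z ∈ graph x) : Val x z.1 z.2 := fun ε hε =>
  ⟨z, hz, fun t => by
    have h0 : 0 ≤ nrm n t := Finset.sum_nonneg fun i _ => abs_nonneg _
    simpa using by positivity, by simpa using by positivity⟩

theorem Val.add {x : Fin n → X} {f g y w} (hf : Val x f y) (hg : Val x g w) :
    Val x (f + g) (y + w) := fun ε hε => by
  obtain ⟨a, ha, h1, h2⟩ := hf (ε / 2) (by positivity)
  obtain ⟨b, hb, h3, h4⟩ := hg (ε / 2) (by positivity)
  refine ⟨a + b, add_mem x ha hb, fun t => ?_, ?_⟩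
  · have e : (f + g) t - (a + b).1 t = (f t - a.1 t) + (g t - b.1 t) := by simp; ring
    rw [e]
    have := abs_add_le (f t - a.1 t) (g t - b.1 t)
    linarith [h1 t, h3 t]
  · have e : y + w - (a + b).2 = (y - a.2) + (w - b.2) := by simp; abel
    rw [e]
    have := norm_add_le (y - a.2) (w - b.2)
    linarith

theorem Val.smul {x : Fin n → X} {f y} (c : ℝ) (hf : Val x f y) : Val x (c • f) (c • y) :=
    fun ε hε => by
  obtain ⟨a, ha, h1, h2⟩ := hf (ε / (|c| + 1)) (by positivity)
  have hc : |c| * (ε / (|c| + 1)) ≤ ε := by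
    rw [mul_div_assoc', div_le_iff₀ (by positivity)]; nlinarith [abs_nonneg c]
  refine ⟨c • a, smul_mem x c ha, fun t => ?_, ?_⟩
  · have h0 : 0 ≤ nrm n t := Finset.sum_nonneg fun i _ => abs_nonneg _
    have e : (c • f) t - (c • a).1 t = c * (f t - a.1 t) := by simp; ring
    rw [e, abs_mul]
    calc _ ≤ |c| * (ε / (|c| + 1) * nrm n t) := by gcongr; exact h1 t
      _ ≤ _ := by rw [← mul_assoc]; gcongr
  · have e : c • y - (c • a).2 = c • (y - a.2) := by simp [smul_sub]
    rw [e, norm_smul, Real.norm_eq_abs]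
    calc _ ≤ |c| * (ε / (|c| + 1) * ‖∑ i, |x i|‖) := by gcongr
      _ ≤ _ := by rw [← mul_assoc]; gcongr

theorem Val.sup {x : Fin n → X} {f g y w} (hf : Val x f y) (hg : Val x g w) :
    Val x (f ⊔ g) (y ⊔ w) := fun ε hε => by
  obtain ⟨a, ha, h1, h2⟩ := hf (ε / 2) (by positivity)
  obtain ⟨b, hb, h3, h4⟩ := hg (ε / 2) (by positivity)
  refine ⟨a ⊔ b, sup_mem x ha hb, fun t => ?_, ?_⟩
  · have := norm_sup_sub_sup_le_add_norm (f t) (g t) (a.1 t) (b.1 t)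
    simp only [Real.norm_eq_abs] at this
    simp only [Pi.sup_apply, Prod.fst_sup]
    linarith [h1 t, h3 t]
  · have := norm_sup_sub_sup_le_add_norm y w a.2 b.2
    simp only [Prod.snd_sup]
    linarith

end Krivine

/-- Existence of the functional calculus. -/
theorem exists_krivineCalculus {X : Type*} [BanachLattice X] {n : ℕ} (x : Fin n → X) :
    ∃ Φ, IsKrivineCalculus x Φ := by
  choose F hF using fun f : homFun n => Krivine.Val.exists x f.2
  refine ⟨{ toFun := F
            map_add' := fun f g => (hF (f + g)).unique ((hF f).add (hF g))
            map_smul' := fun c f => (hF (c • f)).unique ((hF f).smul c) }, ⟨fun i => ?_, ?_⟩⟩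
  · refine (hF _).unique ?_
    have := Krivine.Val.of_graph (Krivine.lin_mem x (Pi.single i 1))
    convert this using 1
    · ext t; simp [Krivine.lin, Pi.single_apply]
    · simp [Krivine.lin, Pi.single_apply]
  · intro f g s hs
    have e : s.1 = f.1 ⊔ g.1 := funext hs
    refine (hF s).unique ?_
    rw [e]
    exact (hF f).sup (hF g)

/-- Uniqueness of the functional calculus. -/
theorem IsKrivineCalculus.unique {X : Type*} [BanachLattice X] {n : ℕ} {x : Fin n → X}
    {Φ Ψ : homFun n →ₗ[ℝ] X} (hΦ : IsKrivineCalculus x Φ) (hΨ : IsKrivineCalculus x Ψ) :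
    Φ = Ψ := by
  have key : ∀ Φ : homFun n →ₗ[ℝ] X, IsKrivineCalculus x Φ → ∀ f, Krivine.Val x f.1 (Φ f) := by
    intro Φ hΦ
    have mono : ∀ f g : homFun n, f.1 ≤ g.1 → Φ f ≤ Φ g := fun f g h => by
      rw [hΦ.map_sup f g g fun t => (max_eq_right (h t)).symm]; exact le_sup_left
    have hgr : ∀ z ∈ Krivine.graph x, ∃ hz : z.1 ∈ homFun n, Φ ⟨z.1, hz⟩ = z.2 := by
      intro z hz
      refine Krivine.graph_sub x (S := {z | ∃ hz : z.1 ∈ homFun n, Φ ⟨z.1, hz⟩ = z.2})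
        ?_ ?_ ?_ hz
      · intro a
        refine ⟨Krivine.graph_hom x (Krivine.lin_mem x a), ?_⟩
        have e : (⟨_, Krivine.graph_hom x (Krivine.lin_mem x a)⟩ : homFun n) =
            ∑ i, a i • ⟨fun t => t i, coord_mem_homFun n i⟩ := by
          ext t; simp [Krivine.lin]
        rw [e, map_sum]
        simp_rw [map_smul, hΦ.map_coord]; rfl
      · rintro z ⟨hz, ez⟩ w ⟨hw, ew⟩
        have hm : (z ⊔ w).1 ∈ homFun n := ⟨hz.1.sup hw.1, fun c hc t => by
          simp [hz.2 c hc, hw.2 c hc, mul_max_of_nonneg _ _ hc]⟩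
        refine ⟨hm, ?_⟩
        rw [hΦ.map_sup ⟨_, hz⟩ ⟨_, hw⟩ ⟨_, hm⟩ fun t => rfl, ez, ew]; rfl
      · rintro z ⟨hz, ez⟩ w ⟨hw, ew⟩
        have hm : (z ⊓ w).1 ∈ homFun n := ⟨hz.1.inf hw.1, fun c hc t => by
          simp [hz.2 c hc, hw.2 c hc, mul_min_of_nonneg _ _ hc]⟩
        refine ⟨hm, ?_⟩
        have := hΦ.map_sup (-⟨_, hz⟩) (-⟨_, hw⟩) (-⟨_, hm⟩) fun t => by simp [max_neg_neg]
        rw [map_neg, map_neg, map_neg, ez, ew, ← neg_inf] at this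
        exact neg_injective this
    intro f ε hε
    obtain ⟨z, hz, h⟩ := Krivine.dense x f.2 hε
    obtain ⟨hz', ez⟩ := hgr z hz
    obtain ⟨hn, en⟩ := hgr _ (Krivine.nrm_mem x)
    refine ⟨z, hz, h, ?_⟩
    have h1 := mono (f - ⟨_, hz'⟩) (ε • ⟨_, hn⟩) fun t => (le_abs_self _).trans (h t)
    have h2 := mono (⟨_, hz'⟩ - f) (ε • ⟨_, hn⟩) fun t => by
      have := h t
      rw [abs_sub_comm] at this
      exact (le_abs_self _).trans this
    rw [map_sub, map_smul, ez, en] at h1 h2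
    have h3 : |Φ f - z.2| ≤ ε • ∑ i, |x i| := sup_le h1 (by rwa [neg_sub])
    have h4 := HasSolidNorm.solid (h3.trans (le_abs_self _))
    rwa [norm_smul, Real.norm_of_nonneg hε.le] at h4
  exact LinearMap.ext fun f => (key Φ hΦ f).unique (key Ψ hΨ f)


/-- Krivine's functional calculus: `krivine x h` is the element `h(x₁, …, xₙ)` of `X`. -/
noncomputable def krivine {X : Type*} [BanachLattice X] {n : ℕ} (x : Fin n → X) :
    homFun n →ₗ[ℝ] X :=
  Classical.choose (exists_krivineCalculus x)

theorem krivine_spec {X : Type*} [BanachLattice X] {n : ℕ} (x : Fin n → X) :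
    IsKrivineCalculus x (krivine x) :=
  Classical.choose_spec (exists_krivineCalculus x)

theorem lpNorm_mem_homFun {q : ENNReal} (hq : 1 ≤ q) (n : ℕ) :
    (fun t : Fin n → ℝ => ‖WithLp.toLp q t‖) ∈ homFun n := by
  have : Fact (1 ≤ q) := ⟨hq⟩
  refine ⟨(PiLp.continuous_toLp q _).norm, fun c hc t => ?_⟩
  simp only
  rw [WithLp.toLp_smul, norm_smul, Real.norm_of_nonneg hc]

/-- The element `(∑ᵢ |xᵢ|^q)^{1/q}` of a Banach lattice, for `1 ≤ q ≤ ∞`: the functional calculus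
applied to the `ℓ_q`-norm on `ℝⁿ` (the value for `q < 1` is a convention that is never used). -/
noncomputable def latticeLpSum {X : Type*} [BanachLattice X] (q : ENNReal) {n : ℕ}
    (x : Fin n → X) : X :=
  open Classical in
  if hq : 1 ≤ q then krivine x ⟨_, lpNorm_mem_homFun hq n⟩ else 0

/-- `T : E → X` is `(p,q)`-convex. -/
def IsConvexOperator {E X : Type*} [NormedAddCommGroup E] [NormedSpace ℝ E] [BanachLattice X]
    (p q : ℝ≥0∞) (T : E →L[ℝ] X) : Prop :=
  ∃ K : ℝ, 1 ≤ K ∧ ∀ (n : ℕ) (x : Fin n → E),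
    ‖latticeLpSum q (fun i => T (x i))‖ ≤ K * ‖WithLp.toLp p (fun i => ‖x i‖)‖

/-- `T : X → E` is `(p,q)`-concave. -/
def IsConcaveOperator {X E : Type*} [BanachLattice X] [NormedAddCommGroup E] [NormedSpace ℝ E]
    (p q : ℝ≥0∞) (T : X →L[ℝ] E) : Prop :=
  ∃ K : ℝ, 1 ≤ K ∧ ∀ (n : ℕ) (x : Fin n → X),
    ‖WithLp.toLp p (fun i => ‖T (x i)‖)‖ ≤ K * ‖latticeLpSum q x‖

/-- The Banach lattice `X` is `(p,q)`-convex. -/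
def IsConvexLattice (p q : ℝ≥0∞) (X : Type*) [BanachLattice X] : Prop :=
  IsConvexOperator p q (ContinuousLinearMap.id ℝ X)

/-- The Banach lattice `X` is `(p,q)`-concave. -/
def IsConcaveLattice (p q : ℝ≥0∞) (X : Type*) [BanachLattice X] : Prop :=
  IsConcaveOperator p q (ContinuousLinearMap.id ℝ X)

/-- Linear lattice homomorphisms. -/
def IsLatticeHom {X Y : Type*} [BanachLattice X] [BanachLattice Y] (T : X →L[ℝ] Y) : Prop :=
  ∀ x y, T (x ⊔ y) = T x ⊔ T y ∧ T (x ⊓ y) = T x ⊓ T y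

/-- `T` is interval preserving: `T` is positive and `T[0,x] = [0,Tx]` for every `x ≥ 0`. -/
def IsIntervalPreserving {X Y : Type*} [BanachLattice X] [BanachLattice Y] (T : X →L[ℝ] Y) :
    Prop :=
  (∀ x, 0 ≤ x → 0 ≤ T x) ∧ ∀ x, 0 ≤ x → T '' Set.Icc 0 x = Set.Icc 0 (T x)

/-- Class `𝒞`: injective interval preserving lattice homomorphisms mapping the closed unit ball
to a closed set. -/
structure IsClassC {X Y : Type*} [BanachLattice X] [BanachLattice Y] (T : X →L[ℝ] Y) : Prop where
  injective : Function.Injective T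
  intervalPreserving : IsIntervalPreserving T
  latticeHom : IsLatticeHom T
  isClosed_image_ball : IsClosed (T '' Metric.closedBall 0 1)

/-- Class `𝒟`: lattice homomorphisms with dense range. -/
structure IsClassD {X Y : Type*} [BanachLattice X] [BanachLattice Y] (T : X →L[ℝ] Y) : Prop where
  latticeHom : IsLatticeHom T
  denseRange : DenseRange T

/-! The proof interpolates on both sides of `T`, by a different method on each.

Target side. The `(p,∞)`-convexity of `T` bounds in norm the suprema `⋁ uᵢ^{1/p} |T zᵢ|` with `∑ uᵢ
≤ 1` and `‖zᵢ‖ ≤ 1` (`norm_supAtoms_le`). Up to domination, these elements and their convex hull are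
stable under suprema with weights `sₖ^{1/p}`, `∑ sₖ ≤ 1` (`exists_hull_ge`). The unit ball of `W_θ`
consists of the `y` with `|y| ≤ t^θ w + t^{θ-1} v` for every `t > 0`, where `w` lies in the hull and
`v` in the unit ball of `Y` up to `ε`: a real interpolation space with parameters `(θ,∞)`. Given
elements of norms `aᵢ` with `∑ aᵢ^{p_θ} ≤ 1`, the choice of parameter `t aᵢ^β` for the `i`-th one
makes its two weights proportional to `(aᵢ^{p_θ})^{1/p}` and `aᵢ^{p_θ}`. The hull absorbs the first
parts and the triangle inequality in `Y` the second ones (`kc_mem_interpBall`). The ball is closed,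
convex, solid and bounded, so the ideal it generates, normed by its gauge, includes into `Y` by a
map of class `𝒞`.

Domain side, `q < ∞`. Let `ρ b` be the supremum of `(∑ ‖T xᵢ‖^q)^{1/q}` over tuples whose
`ℓ_{q₂}`-sum is below `|b|`. Concavity of `T` gives `ρ ≤ K ‖·‖`, a Riesz decomposition gives
subadditivity on the positive cone, and concatenation of tuples shows that `ρ` is `(q,q₂)`-concave
there with constant one (`lpNorm_concaveGauge_le`). `Z_θ` is the completion of `X` for the Calderón
product seminorm of `‖·‖` and `ρ`: the infimum of the `c` with `|x| ≤ a^{1-θ} b^θ`, `‖a‖ ≤ c`, `ρ b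
≤ c`. If the tuple `x` has `ℓ_{q̄₂}`-sum below `a^{1-θ} b^θ`, then formally `yᵢ = a^{1-1/θ}
|xᵢ|^{1/θ}` has `ℓ_{q₂}`-sum below `b` while `|xᵢ| = a^{1-θ} yᵢ^θ`. Concavity of `ρ` thus becomes
`(q/θ, q̄₂)`-concavity of the product (`exists_geomBound_tuple`, `lpNorm_geomSeminorm_le`).

The two sides meet through Young's inequality: `|x| ≤ a^{1-θ} b^θ` means `|x| ≤ (1-θ) t^θ a + θ
t^{θ-1} b` for all `t`. Riesz decomposition splits `x` accordingly, and since `‖T z‖ ≤ ρ z` the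
image of the unit ball of `Z_θ` falls into that of `W_θ` (`map_mem_interpBall_of_geomBound`,
`exists_factor`). When `q = ∞`, `Z_θ = X` suffices.

Products and powers of lattice elements are handled by Krivine's calculus. The key tool is `kc_le`:
inequalities between functions need checking only on a cone `spec x`, where all order relations
among the given elements hold as relations between numbers. -/

set_option linter.unusedSectionVars false

/-! ### Krivine's calculus over finite index types and its spectrum. -/

section Calculus

variable {X : Type*} [BanachLattice X] {ι κ : Type*} [Fintype ι] [Fintype κ]

/-- Continuous positively homogeneous functions on `ℝ^ι`. -/
def IsHom (f : (ι → ℝ) → ℝ) : Prop :=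
  Continuous f ∧ ∀ c : ℝ, 0 ≤ c → ∀ t, f (c • t) = c * f t

namespace IsHom

variable {f g : (ι → ℝ) → ℝ}

theorem coord (i : ι) : IsHom (fun t : ι → ℝ => t i) :=
  ⟨continuous_apply i, fun c _ t => by simp⟩

theorem add (hf : IsHom f) (hg : IsHom g) : IsHom (fun t => f t + g t) :=
  ⟨hf.1.add hg.1, fun c hc t => by simp [hf.2 c hc, hg.2 c hc, mul_add]⟩

theorem sup (hf : IsHom f) (hg : IsHom g) : IsHom (fun t => f t ⊔ g t) :=
  ⟨hf.1.sup hg.1, fun c hc t => by simp [hf.2 c hc, hg.2 c hc, mul_max_of_nonneg _ _ hc]⟩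

theorem const_mul (a : ℝ) (hf : IsHom f) : IsHom (fun t => a * f t) :=
  ⟨continuous_const.mul hf.1, fun c hc t => by simp [hf.2 c hc, mul_left_comm]⟩

theorem neg (hf : IsHom f) : IsHom (fun t => -f t) := by
  simpa using hf.const_mul (-1)

theorem sub (hf : IsHom f) (hg : IsHom g) : IsHom (fun t => f t - g t) := by
  simpa [sub_eq_add_neg] using hf.add hg.neg

theorem abs (hf : IsHom f) : IsHom (fun t => |f t|) := hf.sup hf.neg

theorem zero : IsHom (fun _ : ι → ℝ => 0) := ⟨continuous_const, fun c _ t => by simp⟩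

theorem sum {α : Type*} (s : Finset α) {f : α → (ι → ℝ) → ℝ} (hf : ∀ i ∈ s, IsHom (f i)) :
    IsHom (fun t => ∑ i ∈ s, f i t) :=
  ⟨continuous_finsetSum _ fun i hi => (hf i hi).1, fun c hc t => by
    rw [Finset.mul_sum]; exact Finset.sum_congr rfl fun i hi => (hf i hi).2 c hc t⟩

theorem comp {f : (κ → ℝ) → ℝ} (hf : IsHom f) {h : κ → (ι → ℝ) → ℝ} (hh : ∀ j, IsHom (h j)) :
    IsHom (fun t => f (fun j => h j t)) := by
  refine ⟨hf.1.comp (continuous_pi fun j => (hh j).1), fun c hc t => ?_⟩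
  rw [← hf.2 c hc]
  exact congrArg f (funext fun j => (hh j).2 c hc t)

theorem map_zero (hf : IsHom f) : f 0 = 0 := by simpa using hf.2 0 le_rfl 0

theorem lpNorm {q : ℝ≥0∞} (hq : 1 ≤ q) : IsHom (fun t : ι → ℝ => ‖WithLp.toLp q t‖) := by
  have : Fact (1 ≤ q) := ⟨hq⟩
  refine ⟨(PiLp.continuous_toLp q _).norm, fun c hc t => ?_⟩
  simp only
  rw [WithLp.toLp_smul, norm_smul, Real.norm_of_nonneg hc]

/-- A homogeneous function dominated by a multiple of `m` is continuous as soon as it is so where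
`m` does not vanish. -/
theorem of_bound {m : (ι → ℝ) → ℝ} (hm : Continuous m) {C : ℝ} (hfm : ∀ t, |f t| ≤ C * m t)
    (hf : ContinuousOn f {t | m t ≠ 0}) (hom : ∀ c : ℝ, 0 < c → ∀ t, f (c • t) = c * f t)
    (h0 : m 0 = 0) : IsHom f := by
  refine ⟨continuous_iff_continuousAt.2 fun t => ?_, fun c hc t => ?_⟩
  · by_cases ht : m t = 0
    · have hft : f t = 0 := by simpa [ht] using hfm t
      rw [ContinuousAt, hft]
      refine squeeze_zero_norm (a := fun t => C * m t) (fun s => hfm s) ?_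
      have : Continuous fun t => C * m t := continuous_const.mul hm
      simpa [ht] using this.tendsto t
    · exact hf.continuousAt ((isOpen_ne_fun hm continuous_const).mem_nhds ht)
  · rcases hc.eq_or_lt with rfl | hc
    · simpa [h0] using hfm 0
    · exact hom c hc t

end IsHom

open Classical in
/-- Functional calculus for tuples indexed by an arbitrary finite type. -/
noncomputable def kc (x : ι → X) (f : (ι → ℝ) → ℝ) : X :=
  if hf : IsHom f then
    krivine (x ∘ (Fintype.equivFin ι).symm) ⟨fun t => f (fun i => t (Fintype.equivFin ι i)),
      hf.comp fun i => IsHom.coord (Fintype.equivFin ι i)⟩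
  else 0

theorem kc_add (x : ι → X) {f g : (ι → ℝ) → ℝ} (hf : IsHom f) (hg : IsHom g) :
    kc x (fun t => f t + g t) = kc x f + kc x g := by
  rw [kc, kc, kc, dif_pos hf, dif_pos hg, dif_pos (hf.add hg), ← map_add]
  rfl

theorem kc_const_mul (x : ι → X) {f : (ι → ℝ) → ℝ} (c : ℝ) (hf : IsHom f) :
    kc x (fun t => c * f t) = c • kc x f := by
  rw [kc, kc, dif_pos hf, dif_pos (hf.const_mul c), ← map_smul]
  rfl

theorem kc_sup (x : ι → X) {f g : (ι → ℝ) → ℝ} (hf : IsHom f) (hg : IsHom g) :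
    kc x (fun t => f t ⊔ g t) = kc x f ⊔ kc x g := by
  rw [kc, kc, kc, dif_pos hf, dif_pos hg, dif_pos (hf.sup hg)]
  exact (krivine_spec _).map_sup _ _ _ fun t => rfl

theorem kc_coord (x : ι → X) (i : ι) : kc x (fun t => t i) = x i := by
  rw [kc, dif_pos (IsHom.coord i)]
  simpa using (krivine_spec (x ∘ (Fintype.equivFin ι).symm)).map_coord (Fintype.equivFin ι i)

/-- Relabelling the indices reduces this to uniqueness of the Krivine calculus. Compatibility of
`kc` with composition, reindexing and lattice homomorphisms then follows by recognising a second
calculus at the same tuple. -/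
theorem kc_unique (x : ι → X) (Φ : ((ι → ℝ) → ℝ) → X)
    (hadd : ∀ f g, IsHom f → IsHom g → Φ (fun t => f t + g t) = Φ f + Φ g)
    (hsmul : ∀ (c : ℝ) f, IsHom f → Φ (fun t => c * f t) = c • Φ f)
    (hsup : ∀ f g, IsHom f → IsHom g → Φ (fun t => f t ⊔ g t) = Φ f ⊔ Φ g)
    (hcoord : ∀ i, Φ (fun t => t i) = x i) {f : (ι → ℝ) → ℝ} (hf : IsHom f) : Φ f = kc x f := by
  let e := Fintype.equivFin ι
  have he : ∀ f : homFun (Fintype.card ι), IsHom (fun t : ι → ℝ => f.1 (fun j => t (e.symm j))) :=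
    fun f => IsHom.comp (f := f.1) f.2 fun j => IsHom.coord (e.symm j)
  let Ψ : homFun (Fintype.card ι) →ₗ[ℝ] X :=
    { toFun := fun f => Φ (fun t => f.1 (fun j => t (e.symm j)))
      map_add' := fun f g => hadd _ _ (he f) (he g)
      map_smul' := fun c f => hsmul c _ (he f) }
  have hΨ : IsKrivineCalculus (x ∘ e.symm) Ψ := by
    refine ⟨fun i => hcoord (e.symm i), fun f g s hs => ?_⟩
    change Φ _ = Φ _ ⊔ Φ _
    rw [← hsup _ _ (he f) (he g)]
    congr 1
    ext t
    exact hs _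
  rw [kc, dif_pos hf, (krivine_spec _).unique hΨ]
  change Φ f = Φ _
  congr 1
  ext t
  simp [e]

theorem krivine_eq_kc {n : ℕ} (x : Fin n → X) (f : homFun n) : krivine x f = kc x f.1 := by
  classical
  have := kc_unique x (fun f => if hf : IsHom f then krivine x ⟨f, hf⟩ else 0)
    (fun f g hf hg => ?_) (fun c f hf => ?_) (fun f g hf hg => ?_) (fun i => ?_) (f := f.1) f.2
  · rw [← this, dif_pos (show IsHom f.1 from f.2)]
  · rw [dif_pos hf, dif_pos hg, dif_pos (hf.add hg), ← map_add]; rfl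
  · rw [dif_pos hf, dif_pos (hf.const_mul c), ← map_smul]; rfl
  · rw [dif_pos hf, dif_pos hg, dif_pos (hf.sup hg)]
    exact (krivine_spec _).map_sup _ _ _ fun t => rfl
  · rw [dif_pos (IsHom.coord i)]
    exact (krivine_spec _).map_coord i

theorem latticeLpSum_eq_kc {q : ℝ≥0∞} (hq : 1 ≤ q) {n : ℕ} (x : Fin n → X) :
    latticeLpSum q x = kc x (fun t => ‖WithLp.toLp q t‖) := by
  rw [latticeLpSum, dif_pos hq, krivine_eq_kc]

theorem kc_comp (x : ι → X) {h : κ → (ι → ℝ) → ℝ} (hh : ∀ j, IsHom (h j)) {f : (κ → ℝ) → ℝ}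
    (hf : IsHom f) : kc (fun j => kc x (h j)) f = kc x (fun t => f (fun j => h j t)) := by
  refine (kc_unique (fun j => kc x (h j)) (fun f => kc x (fun t => f (fun j => h j t)))
    (fun f g hf hg => ?_) (fun c f hf => ?_) (fun f g hf hg => ?_) (fun i => rfl) hf).symm
  · exact kc_add x (hf.comp hh) (hg.comp hh)
  · exact kc_const_mul x c (hf.comp hh)
  · exact kc_sup x (hf.comp hh) (hg.comp hh)

theorem kc_reindex (x : ι → X) (σ : κ → ι) {f : (κ → ℝ) → ℝ} (hf : IsHom f) :
    kc (fun j => x (σ j)) f = kc x (fun t => f (fun j => t (σ j))) := by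
  rw [← kc_comp x (fun j => IsHom.coord (σ j)) hf]
  simp_rw [kc_coord]

theorem kc_map {Y : Type*} [BanachLattice Y] {S : X →L[ℝ] Y} (hS : IsLatticeHom S) (x : ι → X)
    {f : (ι → ℝ) → ℝ} (hf : IsHom f) : S (kc x f) = kc (fun i => S (x i)) f := by
  refine kc_unique (fun i => S (x i)) (fun f => S (kc x f))
    (fun f g hf hg => ?_) (fun c f hf => ?_) (fun f g hf hg => ?_) (fun i => ?_) hf
  · rw [kc_add x hf hg, map_add]
  · rw [kc_const_mul x c hf, map_smul]
  · rw [kc_sup x hf hg, (hS _ _).1]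
  · rw [kc_coord]

theorem kc_zero (x : ι → X) : kc x (fun _ => 0) = 0 := by
  simpa using kc_const_mul x 0 (IsHom.zero (ι := ι))

theorem kc_neg (x : ι → X) {f : (ι → ℝ) → ℝ} (hf : IsHom f) :
    kc x (fun t => -f t) = -kc x f := by
  simpa using kc_const_mul x (-1) hf

theorem kc_sub (x : ι → X) {f g : (ι → ℝ) → ℝ} (hf : IsHom f) (hg : IsHom g) :
    kc x (fun t => f t - g t) = kc x f - kc x g := by
  simp_rw [sub_eq_add_neg, kc_add x hf hg.neg, kc_neg x hg]

theorem kc_abs (x : ι → X) {f : (ι → ℝ) → ℝ} (hf : IsHom f) :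
    kc x (fun t => |f t|) = |kc x f| := by
  have := kc_sup x hf hf.neg
  rwa [kc_neg x hf] at this

theorem kc_mono (x : ι → X) {f g : (ι → ℝ) → ℝ} (hf : IsHom f) (hg : IsHom g)
    (h : ∀ t, f t ≤ g t) : kc x f ≤ kc x g := by
  have e : (fun t => f t ⊔ g t) = g := funext fun t => sup_eq_right.2 (h t)
  rw [← e, kc_sup x hf hg]
  exact le_sup_left

/-- The closed cone in `ℝ^ι` on which the functional calculus at `x` lives. -/
def spec (x : ι → X) : Set (ι → ℝ) := {t | ∀ h, IsHom h → kc x h ≤ 0 → h t ≤ 0}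

theorem le_on_spec {x : ι → X} {f g : (ι → ℝ) → ℝ} (hf : IsHom f) (hg : IsHom g)
    (h : kc x f ≤ kc x g) {t : ι → ℝ} (ht : t ∈ spec x) : f t ≤ g t :=
  sub_nonpos.1 (ht _ (hf.sub hg) (by rw [kc_sub x hf hg]; exact sub_nonpos.2 h))

/-- Compactness of the `ℓ₁`-sphere. Near a point of `spec x` the error `ε` suffices; near any other
point a large multiple of the positive part of a function witnessing exclusion from `spec x` does. A
finite sum of such functions works on the whole sphere, and homogeneity extends the bound to `ℝ^ι`.
-/
theorem exists_majorant (x : ι → X) {f g : (ι → ℝ) → ℝ} (hf : IsHom f) (hg : IsHom g)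
    (h : ∀ t ∈ spec x, f t ≤ g t) {ε : ℝ} (hε : 0 < ε) :
    ∃ H : (ι → ℝ) → ℝ, IsHom H ∧ kc x H ≤ 0 ∧ ∀ t, f t - g t ≤ ε * ∑ i, |t i| + H t := by
  have hn : Continuous fun t : ι → ℝ => ∑ i, |t i| := by fun_prop
  have hK : IsCompact {t : ι → ℝ | ∑ i, |t i| = 1} := by
    refine Metric.isCompact_of_isClosed_isBounded (isClosed_eq hn continuous_const) ?_
    refine (Metric.isBounded_closedBall (x := (0 : ι → ℝ)) (r := 1)).subset fun t ht => ?_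
    rw [mem_closedBall_zero_iff, pi_norm_le_iff_of_nonneg zero_le_one]
    intro i
    have ht : ∑ i, |t i| = 1 := ht
    rw [← ht]
    exact Finset.single_le_sum (f := fun i => |t i|) (fun i _ => abs_nonneg _) (Finset.mem_univ i)
  have hloc : ∀ t : ι → ℝ, ∑ i, |t i| = 1 → ∃ H : (ι → ℝ) → ℝ, IsHom H ∧ kc x H ≤ 0 ∧
      (∀ t, 0 ≤ H t) ∧ f t - g t < ε * ∑ i, |t i| + H t := by
    intro t ht
    by_cases hs : t ∈ spec x
    · refine ⟨_, IsHom.zero, (kc_zero x).le, fun _ => le_rfl, ?_⟩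
      rw [ht]
      linarith [h t hs]
    · simp only [spec, Set.mem_ofPred_eq] at hs
      push Not at hs
      obtain ⟨k, hk, hxk, hkt⟩ := hs
      -- `C` makes `C * k t` exceed `f t - g t`. Taking the supremum with zero keeps the majorants
      -- nonnegative, so that they can be added over a cover.
      obtain ⟨C, hC⟩ := exists_gt ((f t - g t) / k t ⊔ 0)
      have hC0 := (le_max_right _ _).trans hC.le
      refine ⟨_, (hk.const_mul C).sup IsHom.zero, ?_, fun _ => le_sup_right, ?_⟩
      · rw [kc_sup x (hk.const_mul C) IsHom.zero, kc_const_mul x C hk, kc_zero]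
        exact sup_le (smul_nonpos_of_nonneg_of_nonpos hC0 hxk) le_rfl
      · have h1 := (div_lt_iff₀ hkt).1 ((le_max_left _ _).trans_lt hC)
        have h2 : C * k t ≤ C * k t ⊔ 0 := le_sup_left
        rw [ht]
        linarith
  obtain ⟨H, hH, hxH, -, hle⟩ := hK.induction_on (p := fun s => ∃ H : (ι → ℝ) → ℝ, IsHom H ∧
      kc x H ≤ 0 ∧ (∀ t, 0 ≤ H t) ∧ ∀ t ∈ s, f t - g t ≤ ε * ∑ i, |t i| + H t)
    ⟨_, IsHom.zero, (kc_zero x).le, fun _ => le_rfl, by simp⟩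
    (fun s s' hs ⟨H, h1, h2, h3, h4⟩ => ⟨H, h1, h2, h3, fun t ht => h4 t (hs ht)⟩)
    (fun s s' ⟨H, h1, h2, h3, h4⟩ ⟨H', h1', h2', h3', h4'⟩ =>
      ⟨_, h1.add h1', by rw [kc_add x h1 h1']; exact add_nonpos h2 h2',
        fun t => add_nonneg (h3 t) (h3' t), fun t ht => by
          rcases ht with ht | ht
          · linarith [h4 t ht, h3' t]
          · linarith [h4' t ht, h3 t]⟩)
    (fun t ht => by
      obtain ⟨H, h1, h2, h3, h4⟩ := hloc t ht
      exact ⟨{t | f t - g t < ε * ∑ i, |t i| + H t}, mem_nhdsWithin_of_mem_nhds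
        ((isOpen_lt (hf.1.sub hg.1) ((continuous_const.mul hn).add h1.1)).mem_nhds h4),
        H, h1, h2, h3, fun t ht => le_of_lt ht⟩)
  refine ⟨H, hH, hxH, fun t => ?_⟩
  have hD : IsHom fun t => ε * ∑ i, |t i| + H t - (f t - g t) :=
    (((IsHom.sum Finset.univ fun i _ => (IsHom.coord i).abs).const_mul ε).add hH).sub (hf.sub hg)
  rcases (Finset.sum_nonneg fun i _ => abs_nonneg (t i) : 0 ≤ ∑ i, |t i|).eq_or_lt with h0 | h0
  · have ht : t = 0 := funext fun i => by
      simpa using (Finset.sum_eq_zero_iff_of_nonneg fun i _ => abs_nonneg (t i)).1 h0.symm i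
        (Finset.mem_univ i)
    have := hD.map_zero
    rw [ht]
    linarith
  · set r := ∑ i, |t i| with hr
    have h1 : ∑ i, |(r⁻¹ • t) i| = 1 := by
      simp only [Pi.smul_apply, smul_eq_mul, abs_mul, ← Finset.mul_sum, ← hr,
        abs_of_pos (inv_pos.2 h0)]
      exact inv_mul_cancel₀ h0.ne'
    have h2 := hle _ h1
    have h3 := hD.2 r⁻¹ (inv_pos.2 h0).le t
    simp only at h3
    have h4 : 0 ≤ r⁻¹ * (ε * r + H t - (f t - g t)) := by rw [hr, ← h3]; linarith
    have := (mul_nonneg_iff_of_pos_left (inv_pos.2 h0)).1 h4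
    linarith

/-- The functional calculus at `x` is order preserving on functions restricted to `spec x`. -/
theorem kc_le {x : ι → X} {f g : (ι → ℝ) → ℝ} (hf : IsHom f) (hg : IsHom g)
    (h : ∀ t ∈ spec x, f t ≤ g t) : kc x f ≤ kc x g := by
  have hN : IsHom fun t : ι → ℝ => ∑ i, |t i| := IsHom.sum Finset.univ fun i _ => (IsHom.coord i).abs
  have key : ∀ ε : ℝ, 0 < ε → kc x f - kc x g ≤ ε • kc x fun t => ∑ i, |t i| := fun ε hε => by
    obtain ⟨H, hH, hxH, hle⟩ := exists_majorant x hf hg h hε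
    have := kc_mono x (hf.sub hg) ((hN.const_mul ε).add hH) hle
    rw [kc_sub x hf hg, kc_add x (hN.const_mul ε) hH, kc_const_mul x ε hN] at this
    exact this.trans (add_le_of_nonpos_right hxH)
  have ht : Filter.Tendsto (fun ε : ℝ => ε • kc x fun t => ∑ i, |t i|) (nhdsWithin 0 (Set.Ioi 0))
      (nhds 0) := by
    have : Continuous fun ε : ℝ => ε • kc x fun t => ∑ i, |t i| := by fun_prop
    simpa using (this.tendsto 0).mono_left nhdsWithin_le_nhds
  exact sub_nonpos.1 (ge_of_tendsto ht (eventually_mem_nhdsWithin.mono fun ε hε => key ε hε))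

theorem kc_congr {x : ι → X} {f g : (ι → ℝ) → ℝ} (hf : IsHom f) (hg : IsHom g)
    (h : ∀ t ∈ spec x, f t = g t) : kc x f = kc x g :=
  (kc_le hf hg fun t ht => (h t ht).le).antisymm (kc_le hg hf fun t ht => (h t ht).ge)

theorem lpNorm_le_sum {q : ℝ≥0∞} (hq : 1 ≤ q) (t : ι → ℝ) : ‖WithLp.toLp q t‖ ≤ ∑ i, |t i| := by
  classical
  have : Fact (1 ≤ q) := ⟨hq⟩
  have e : WithLp.toLp q t = ∑ i, WithLp.toLp q (Pi.single i (t i)) := by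
    rw [← WithLp.toLp_sum, Finset.univ_sum_single]
  rw [e]
  refine (norm_sum_le _ _).trans (Finset.sum_le_sum fun i _ => ?_)
  exact (PiLp.norm_single q (fun _ : ι => ℝ) i (t i)).le

theorem abs_le_lpNorm {q : ℝ≥0∞} (hq : 1 ≤ q) (t : ι → ℝ) (i : ι) :
    |t i| ≤ ‖WithLp.toLp q t‖ := by
  have : Fact (1 ≤ q) := ⟨hq⟩
  exact PiLp.norm_apply_le (WithLp.toLp q t) i

theorem abs_le_kc_lpNorm {q : ℝ≥0∞} (hq : 1 ≤ q) (x : ι → X) (i : ι) :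
    |x i| ≤ kc x (fun t => ‖WithLp.toLp q t‖) := by
  rw [← kc_coord x i, ← kc_abs x (IsHom.coord i)]
  exact kc_mono x (IsHom.coord i).abs (IsHom.lpNorm hq) fun t => abs_le_lpNorm hq t i

theorem kc_lpNorm_nonneg {q : ℝ≥0∞} (hq : 1 ≤ q) (x : ι → X) :
    0 ≤ kc x (fun t => ‖WithLp.toLp q t‖) := by
  have : Fact (1 ≤ q) := ⟨hq⟩
  rw [← kc_zero x]
  exact kc_mono x IsHom.zero (IsHom.lpNorm hq) fun t => norm_nonneg _

theorem kc_lpNorm_le_sum {q : ℝ≥0∞} (hq : 1 ≤ q) (x : ι → X) :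
    kc x (fun t => ‖WithLp.toLp q t‖) ≤ ∑ i, |x i| := by
  have h : ∀ s : Finset ι, kc x (fun t => ∑ i ∈ s, |t i|) = ∑ i ∈ s, |x i| := by
    classical
    intro s
    induction s using Finset.induction_on with
    | empty => simpa using kc_zero x
    | insert i s hi ih =>
      simp_rw [Finset.sum_insert hi]
      rw [kc_add x (IsHom.coord i).abs (IsHom.sum s fun i _ => (IsHom.coord i).abs), ih,
        kc_abs x (IsHom.coord i), kc_coord]
  rw [← h]
  exact kc_mono x (IsHom.lpNorm hq) (IsHom.sum _ fun i _ => (IsHom.coord i).abs) (lpNorm_le_sum hq)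

/-- Once `z` is adjoined to the tuple, the hypotheses become numerical inequalities on the spectrum.
The same device of enlarging the tuple recurs below. -/
theorem kc_lpNorm_top_le (x : ι → X) {z : X} (hz : 0 ≤ z) (h : ∀ i, |x i| ≤ z) :
    kc x (fun t => ‖WithLp.toLp ∞ t‖) ≤ z := by
  let y : Option ι → X := fun o => o.elim z x
  have hN : IsHom fun t : Option ι → ℝ => ‖WithLp.toLp ∞ fun i => t (some i)‖ :=
    (IsHom.lpNorm (ι := ι) le_top).comp fun i => IsHom.coord (some i)
  have e := kc_reindex y some (IsHom.lpNorm (ι := ι) (q := ∞) le_top)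
  change kc x _ = _ at e
  rw [e, show z = y none from rfl, ← kc_coord y none]
  refine kc_le hN (IsHom.coord none) fun t ht => ?_
  rw [PiLp.norm_toLp, pi_norm_le_iff_of_nonneg]
  · refine fun i => le_on_spec (IsHom.coord (some i)).abs (IsHom.coord none) ?_ ht
    rw [kc_abs y (IsHom.coord (some i)), kc_coord, kc_coord]
    exact h i
  · exact le_on_spec IsHom.zero (IsHom.coord none) (by rw [kc_zero, kc_coord]; exact hz) ht

/-- The reverse triangle inequality in `ℓ_q`, applied pointwise to the joint tuple. It yields
continuity of `ℓ_q`-sums, which lets concavity estimates pass to a completion. -/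
theorem kc_lpNorm_sub_le {q : ℝ≥0∞} (hq : 1 ≤ q) (x y : ι → X) :
    kc x (fun t => ‖WithLp.toLp q t‖) - kc y (fun t => ‖WithLp.toLp q t‖) ≤ ∑ i, |x i - y i| := by
  have : Fact (1 ≤ q) := ⟨hq⟩
  let z : ι ⊕ ι → X := Sum.elim x y
  have hN := IsHom.lpNorm (ι := ι) hq
  have e1 := kc_reindex z Sum.inl hN
  have e2 := kc_reindex z Sum.inr hN
  have e3 : ∀ i, x i - y i = kc z (fun t => t (Sum.inl i) - t (Sum.inr i)) := fun i => by
    rw [kc_sub z (IsHom.coord _) (IsHom.coord _), kc_coord, kc_coord]; rfl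
  have hl := hN.comp fun i : ι => IsHom.coord (ι := ι ⊕ ι) (Sum.inl i)
  have hr := hN.comp fun i : ι => IsHom.coord (ι := ι ⊕ ι) (Sum.inr i)
  have hd : ∀ i : ι, IsHom fun t : ι ⊕ ι → ℝ => t (Sum.inl i) - t (Sum.inr i) := fun i =>
    (IsHom.coord _).sub (IsHom.coord _)
  refine le_trans ?_ (kc_lpNorm_le_sum hq fun i => x i - y i)
  change kc (fun i => z (Sum.inl i)) _ - kc (fun i => z (Sum.inr i)) _ ≤ _
  rw [e1, e2, ← kc_sub z hl hr]
  simp_rw [e3]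
  rw [kc_comp z hd hN]
  exact kc_mono z (hl.sub hr) (hN.comp hd) fun t => norm_sub_norm_le _ _

theorem continuous_kc_lpNorm {q : ℝ≥0∞} (hq : 1 ≤ q) :
    Continuous fun x : ι → X => kc x (fun t => ‖WithLp.toLp q t‖) := by
  refine continuous_iff_continuousAt.2 fun x => tendsto_iff_norm_sub_tendsto_zero.2 ?_
  refine squeeze_zero (g := fun y : ι → X => ‖∑ i, |y i - x i|‖) (fun y => norm_nonneg _)
    (fun y => ?_) ?_
  · refine norm_le_norm_of_abs_le_abs (le_trans ?_ (le_abs_self _))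
    refine sup_le (kc_lpNorm_sub_le hq y x) ?_
    rw [neg_sub]
    simp_rw [abs_sub_comm (y _)]
    exact kc_lpNorm_sub_le hq x y
  · have : Continuous fun y : ι → X => ‖∑ i, |y i - x i|‖ := by
      refine (continuous_finsetSum _ fun i _ => ?_).norm
      have h : Continuous fun y : ι → X => y i - x i := by fun_prop
      exact h.sup h.neg
    simpa using this.tendsto x

theorem lpNorm_mono {q : ℝ≥0∞} (hq : 1 ≤ q) {s t : ι → ℝ} (h : ∀ i, |s i| ≤ |t i|) :
    ‖WithLp.toLp q s‖ ≤ ‖WithLp.toLp q t‖ := by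
  rcases eq_or_ne q ∞ with rfl | hq'
  · rw [PiLp.norm_toLp, PiLp.norm_toLp]
    exact (pi_norm_le_iff_of_nonneg (norm_nonneg _)).2 fun i => (h i).trans (norm_le_pi_norm t i)
  · have h0 : 0 < q.toReal := ENNReal.toReal_pos (zero_lt_one.trans_le hq).ne' hq'
    rw [PiLp.norm_eq_sum h0, PiLp.norm_eq_sum h0]
    gcongr with i
    exact h i

theorem kc_lpNorm_mono {q : ℝ≥0∞} (hq : 1 ≤ q) {x y : ι → X} (h0 : ∀ i, 0 ≤ x i)
    (h : ∀ i, x i ≤ y i) :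
    kc x (fun t => ‖WithLp.toLp q t‖) ≤ kc y (fun t => ‖WithLp.toLp q t‖) := by
  let z : ι ⊕ ι → X := Sum.elim x y
  have hN := IsHom.lpNorm (ι := ι) hq
  have e1 := kc_reindex z Sum.inl hN
  have e2 := kc_reindex z Sum.inr hN
  change kc (fun i => z (Sum.inl i)) _ ≤ kc (fun i => z (Sum.inr i)) _
  rw [e1, e2]
  refine kc_le (hN.comp fun i => IsHom.coord _) (hN.comp fun i => IsHom.coord _) fun t ht =>
    lpNorm_mono hq fun i => ?_
  have p1 : 0 ≤ t (Sum.inl i) :=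
    le_on_spec IsHom.zero (IsHom.coord _) (by rw [kc_zero, kc_coord]; exact h0 i) ht
  have p2 : t (Sum.inl i) ≤ t (Sum.inr i) :=
    le_on_spec (IsHom.coord _) (IsHom.coord _) (by rw [kc_coord, kc_coord]; exact h i) ht
  rwa [abs_of_nonneg p1, abs_of_nonneg (p1.trans p2)]

end Calculus

/-! ### Completion of a vector lattice under a solid seminorm. -/

section Completion

open UniformSpace

variable {E : Type*} [SeminormedAddCommGroup E] [NormedSpace ℝ E] [Lattice E]
  [IsOrderedAddMonoid E] [PosSMulMono ℝ E]

theorem abs_sup_sub_sup_le_add (a b c d : E) : |a ⊔ b - c ⊔ d| ≤ |a - c| + |b - d| :=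
  calc
    |a ⊔ b - c ⊔ d| = |a ⊔ b - c ⊔ b + (c ⊔ b - c ⊔ d)| := by rw [sub_add_sub_cancel]
    _ ≤ |a ⊔ b - c ⊔ b| + |c ⊔ b - c ⊔ d| := abs_add_le _ _
    _ ≤ |a - c| + |b - d| := by
      gcongr ?_ + ?_
      · exact abs_sup_sub_sup_le_abs _ _ _
      · rw [sup_comm c, sup_comm c]
        exact abs_sup_sub_sup_le_abs _ _ _

theorem uniformContinuous_sup_of_solid (solid : ∀ x y : E, |x| ≤ |y| → ‖x‖ ≤ ‖y‖) :
    UniformContinuous₂ fun x y : E => x ⊔ y := by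
  refine Metric.uniformContinuous_iff.2 fun ε hε => ⟨ε / 2, by positivity, ?_⟩
  rintro ⟨a, b⟩ ⟨c, d⟩ h
  rw [Prod.dist_eq, max_lt_iff] at h
  simp only [dist_eq_norm, Function.uncurry] at h ⊢
  have h1 : ‖a ⊔ b - c ⊔ d‖ ≤ ‖|a - c| + |b - d|‖ :=
    solid _ _ ((abs_sup_sub_sup_le_add a b c d).trans (le_abs_self _))
  have h2 := norm_add_le |a - c| |b - d|
  have h3 := solid _ _ (abs_abs (a - c)).le
  have h4 := solid _ _ (abs_abs (b - d)).le
  linarith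

theorem uniformContinuous_inf_of_solid (solid : ∀ x y : E, |x| ≤ |y| → ‖x‖ ≤ ‖y‖) :
    UniformContinuous₂ fun x y : E => x ⊓ y := by
  have h : (fun x : E × E => x.1 ⊓ x.2) = fun x => -(-x.1 ⊔ -x.2) := by
    ext x; rw [← neg_inf, neg_neg]
  change UniformContinuous fun x : E × E => x.1 ⊓ x.2
  rw [h]
  have h2 : UniformContinuous fun x : E × E => x.1 ⊔ x.2 := uniformContinuous_sup_of_solid solid
  exact (h2.comp (uniformContinuous_fst.neg.prodMk uniformContinuous_snd.neg)).neg

/-- The completion of a vector lattice with a solid seminorm is a Banach lattice. -/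
@[reducible] noncomputable def completionLattice (solid : ∀ x y : E, |x| ≤ |y| → ‖x‖ ≤ ‖y‖) :
    Lattice (Completion E) :=
  letI : Max (Completion E) := ⟨Completion.map₂ (· ⊔ ·)⟩
  letI : Min (Completion E) := ⟨Completion.map₂ (· ⊓ ·)⟩
  have hs : ∀ x y : E, (x : Completion E) ⊔ y = ((x ⊔ y : E) : Completion E) :=
    fun x y => Completion.map₂_coe_coe x y _ (uniformContinuous_sup_of_solid solid)
  have hi : ∀ x y : E, (x : Completion E) ⊓ y = ((x ⊓ y : E) : Completion E) :=
    fun x y => Completion.map₂_coe_coe x y _ (uniformContinuous_inf_of_solid solid)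
  have cs : Continuous fun p : Completion E × Completion E => p.1 ⊔ p.2 :=
    Completion.continuous_map₂ continuous_fst continuous_snd
  have ci : Continuous fun p : Completion E × Completion E => p.1 ⊓ p.2 :=
    Completion.continuous_map₂ continuous_fst continuous_snd
  have : ContinuousSup (Completion E) := ⟨cs⟩
  have : ContinuousInf (Completion E) := ⟨ci⟩
  -- With the order defined through the operations, the lattice axioms are equations, hence closed
  -- conditions that can be checked on the dense image of `E`.
  Lattice.mk'
    (fun a b => Completion.induction_on₂ a b (isClosed_eq (by fun_prop) (by fun_prop))
      fun a b => by rw [hs, hs, sup_comm])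
    (fun a b c => Completion.induction_on₃ a b c (isClosed_eq (by fun_prop) (by fun_prop))
      fun a b c => by rw [hs, hs, hs, hs, sup_assoc])
    (fun a b => Completion.induction_on₂ a b (isClosed_eq (by fun_prop) (by fun_prop))
      fun a b => by rw [hi, hi, inf_comm])
    (fun a b c => Completion.induction_on₃ a b c (isClosed_eq (by fun_prop) (by fun_prop))
      fun a b c => by rw [hi, hi, hi, hi, inf_assoc])
    (fun a b => Completion.induction_on₂ a b (isClosed_eq (by fun_prop) (by fun_prop))
      fun a b => by rw [hi, hs, sup_inf_self])
    (fun a b => Completion.induction_on₂ a b (isClosed_eq (by fun_prop) (by fun_prop))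
      fun a b => by rw [hs, hi, inf_sup_self])

theorem completion_coe_sup (solid : ∀ x y : E, |x| ≤ |y| → ‖x‖ ≤ ‖y‖) (x y : E) :
    letI := completionLattice solid
    (x : Completion E) ⊔ y = ((x ⊔ y : E) : Completion E) :=
  Completion.map₂_coe_coe x y _ (uniformContinuous_sup_of_solid solid)

theorem completion_coe_inf (solid : ∀ x y : E, |x| ≤ |y| → ‖x‖ ≤ ‖y‖) (x y : E) :
    letI := completionLattice solid
    (x : Completion E) ⊓ y = ((x ⊓ y : E) : Completion E) :=
  Completion.map₂_coe_coe x y _ (uniformContinuous_inf_of_solid solid)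

theorem completion_continuousSup (solid : ∀ x y : E, |x| ≤ |y| → ‖x‖ ≤ ‖y‖) :
    letI := completionLattice solid
    ContinuousSup (Completion E) :=
  letI := completionLattice solid
  ⟨Completion.continuous_map₂ continuous_fst continuous_snd⟩

/-- The completion of a vector lattice with a solid seminorm is a Banach lattice. -/
@[reducible] noncomputable def completionBanachLattice
    (solid : ∀ x y : E, |x| ≤ |y| → ‖x‖ ≤ ‖y‖) : BanachLattice (Completion E) :=
  letI := completionLattice solid
  have hs := completion_coe_sup solid
  have := completion_continuousSup solid
  have hle : ∀ a b : Completion E, a ≤ b ↔ a ⊔ b = b := fun a b => sup_eq_right.symm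
  have hadd : ∀ a b c : Completion E, (a + c) ⊔ (b + c) = a ⊔ b + c := fun a b c =>
    Completion.induction_on₃ a b c (isClosed_eq (by fun_prop) (by fun_prop)) fun a b c => by
      rw [hs, ← Completion.coe_add, ← Completion.coe_add, hs, ← Completion.coe_add, sup_add]
  have hord : IsOrderedAddMonoid (Completion E) :=
    { add_le_add_left := fun a b h c => by rw [hle] at h ⊢; rw [hadd, h] }
  have hsmul : ∀ r : ℝ, 0 ≤ r → ∀ a b : Completion E, (r • a) ⊔ (r • b) = r • (a ⊔ b) :=
    fun r hr a b =>
    Completion.induction_on₂ a b (isClosed_eq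
      ((continuous_fst.const_smul r).sup (continuous_snd.const_smul r))
      ((continuous_fst.sup continuous_snd).const_smul r)) fun a b => by
      rw [hs, ← Completion.coe_smul, ← Completion.coe_smul, hs, ← Completion.coe_smul]
      congr 1
      rcases hr.eq_or_lt with rfl | hr
      · simp
      · have := (OrderIso.smulRight (β := E) hr).map_sup a b
        simpa only [OrderIso.smulRight_apply] using this.symm
  -- Solidity is an implication and does not pass to limits as it stands. This unconditional
  -- inequality does, and taking `|b|` for `b` recovers solidity.
  have h1 : ∀ a b : Completion E, ‖a‖ ≤ ‖(a ⊔ -a) ⊔ b‖ := fun a b =>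
    Completion.induction_on₂ a b (isClosed_le continuous_fst.norm
      ((continuous_fst.sup continuous_fst.neg).sup continuous_snd).norm) fun a b => by
      rw [← Completion.coe_neg, hs, hs, Completion.norm_coe, Completion.norm_coe]
      exact solid _ _ (le_sup_left.trans (le_abs_self _))
  have h2 : ∀ b : Completion E, ‖b ⊔ -b‖ ≤ ‖b‖ := fun b =>
    Completion.induction_on b (isClosed_le (continuous_id.sup continuous_id.neg).norm continuous_norm) fun b => by
      rw [← Completion.coe_neg, hs, Completion.norm_coe, Completion.norm_coe]
      exact solid _ _ (abs_abs b).le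
  have hsolid : HasSolidNorm (Completion E) := ⟨fun a b h => by
    have h3 := h1 a (b ⊔ -b)
    have h4 : (a ⊔ -a) ⊔ (b ⊔ -b) = b ⊔ -b := (hle _ _).1 h
    rw [h4] at h3
    exact h3.trans (h2 b)⟩
  have hpos : PosSMulMono ℝ (Completion E) := ⟨fun r hr a b h => by
    rw [hle] at h
    rw [hle, hsmul r hr, h]⟩
  { (inferInstance : NormedAddCommGroup (Completion E)),
    (inferInstance : NormedSpace ℝ (Completion E)), completionLattice solid, hord, hpos, hsolid,
    (inferInstance : CompleteSpace (Completion E)) with }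

end Completion

/-- A copy of a vector lattice, to be topologized by a seminorm. -/
def SeminormCopy {X : Type*} [BanachLattice X] (_ : Seminorm ℝ X) : Type _ := X

namespace SeminormCopy

variable {X : Type*} [BanachLattice X] (N : Seminorm ℝ X)

instance : AddCommGroup (SeminormCopy N) := inferInstanceAs (AddCommGroup X)
instance : Module ℝ (SeminormCopy N) := inferInstanceAs (Module ℝ X)
instance : Lattice (SeminormCopy N) := inferInstanceAs (Lattice X)
instance : IsOrderedAddMonoid (SeminormCopy N) := inferInstanceAs (IsOrderedAddMonoid X)
instance : PosSMulMono ℝ (SeminormCopy N) := inferInstanceAs (PosSMulMono ℝ X)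

noncomputable instance : SeminormedAddCommGroup (SeminormCopy N) :=
  AddGroupSeminorm.toSeminormedAddCommGroup (E := SeminormCopy N) N.toAddGroupSeminorm

noncomputable instance : NormedSpace ℝ (SeminormCopy N) :=
  ⟨fun r x => (map_smul_eq_mul N r x).le⟩

end SeminormCopy

/-- `N` may vanish on nonzero vectors: the completion is separated, so the quotient by the kernel is
taken at the same time. -/
theorem exists_completion {X : Type u} [BanachLattice X] (N : Seminorm ℝ X)
    (hsolid : ∀ x y, |x| ≤ |y| → N x ≤ N y) {C : ℝ} (hC : ∀ x, N x ≤ C * ‖x‖) :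
    ∃ (Z : Type u) (_ : BanachLattice Z) (Ψ : X →L[ℝ] Z), IsClassD Ψ ∧ ∀ x, ‖Ψ x‖ = N x := by
  let E := SeminormCopy N
  have solid : ∀ x y : E, |x| ≤ |y| → ‖x‖ ≤ ‖y‖ := hsolid
  let L := completionBanachLattice solid
  let Ψ₀ : X →ₗ[ℝ] UniformSpace.Completion E :=
    { toFun := fun x => ((show E from x) : UniformSpace.Completion E)
      map_add' := fun x y => UniformSpace.Completion.coe_add (α := E) x y
      map_smul' := fun c x => UniformSpace.Completion.coe_smul (X := E) c x }
  have hΨ : ∀ x, ‖Ψ₀ x‖ = N x := fun x => UniformSpace.Completion.norm_coe (E := E) x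
  refine ⟨UniformSpace.Completion E, L, Ψ₀.mkContinuous C fun x => (hΨ x).trans_le (hC x),
    ⟨fun x y => ⟨?_, ?_⟩, ?_⟩, hΨ⟩
  · exact (completion_coe_sup solid x y).symm
  · exact (completion_coe_inf solid x y).symm
  · exact UniformSpace.Completion.denseRange_coe (α := E)

/-! ### Ideals normed by the gauge of a closed solid ball. -/

/-- The sets that are closed unit balls of Banach lattices embedded as ideals. -/
structure IsSolidBall {Y : Type*} [BanachLattice Y] (B : Set Y) : Prop where
  convex : Convex ℝ B
  isClosed : IsClosed B
  solid : ∀ y ∈ B, ∀ z, |z| ≤ |y| → z ∈ B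
  zero_mem : 0 ∈ B
  bounded : ∃ M, ∀ y ∈ B, ‖y‖ ≤ M

theorem abs_smul_le_of_abs_le {Y : Type*} [BanachLattice Y] {c d : ℝ} (h : |c| ≤ d) (y : Y) :
    |c • y| ≤ d • |y| := by
  have key : ∀ c : ℝ, 0 ≤ c → ∀ y : Y, |c • y| ≤ c • |y| := fun c hc y =>
    sup_le (smul_le_smul_of_nonneg_left (le_abs_self y) hc)
      (by rw [← smul_neg]; exact smul_le_smul_of_nonneg_left (neg_le_abs y) hc)
  have h1 : |c • y| ≤ |c| • |y| := by
    rcases le_total 0 c with hc | hc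
    · rw [abs_of_nonneg hc]; exact key c hc y
    · rw [abs_of_nonpos hc, ← abs_neg (c • y), ← neg_smul]
      exact key (-c) (by linarith) y
  exact h1.trans (smul_le_smul_of_nonneg_right h (abs_nonneg y))

theorem abs_smul_of_nonneg {Y : Type*} [BanachLattice Y] {c : ℝ} (hc : 0 ≤ c) (y : Y) :
    |c • y| = c • |y| := by
  refine (abs_smul_le_of_abs_le (abs_of_nonneg hc).le y).antisymm ?_
  rcases hc.eq_or_lt with rfl | hc
  · simp
  · have h := abs_smul_le_of_abs_le (abs_of_nonneg (inv_pos.2 hc).le).le (c • y)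
    rw [inv_smul_smul₀ hc.ne'] at h
    have := smul_le_smul_of_nonneg_left h hc.le
    rwa [smul_inv_smul₀ hc.ne'] at this

namespace IsSolidBall

variable {Y : Type*} [BanachLattice Y] {B : Set Y} (hB : IsSolidBall B)
include hB

theorem smul_mem {c : ℝ} (hc : |c| ≤ 1) {y : Y} (hy : y ∈ B) : c • y ∈ B :=
  hB.solid y hy _ (by simpa using abs_smul_le_of_abs_le hc y)

theorem smul_mem_of_le {r s : ℝ} (hr : 0 < r) (hrs : r ≤ s) {y : Y} (hy : r⁻¹ • y ∈ B) :
    s⁻¹ • y ∈ B := by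
  have hs := hr.trans_le hrs
  have : s⁻¹ • y = (r / s) • r⁻¹ • y := by
    rw [smul_smul]; congr 1; field_simp
  rw [this]
  refine hB.smul_mem ?_ hy
  rw [abs_of_pos (by positivity), div_le_one hs]
  exact hrs

theorem add_mem {r s : ℝ} (hr : 0 < r) (hs : 0 < s) {y z : Y} (hy : r⁻¹ • y ∈ B)
    (hz : s⁻¹ • z ∈ B) : (r + s)⁻¹ • (y + z) ∈ B := by
  have : (r + s)⁻¹ • (y + z) = (r / (r + s)) • r⁻¹ • y + (s / (r + s)) • s⁻¹ • z := by
    rw [smul_add, smul_smul, smul_smul]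
    congr 2 <;> field_simp
  rw [this]
  exact hB.convex hy hz (by positivity) (by positivity) (by field_simp)

theorem solid_mem {r : ℝ} (hr : 0 < r) {y z : Y} (hy : r⁻¹ • y ∈ B) (h : |z| ≤ |y|) :
    r⁻¹ • z ∈ B := by
  refine hB.solid _ hy _ ?_
  rw [abs_smul_of_nonneg (inv_pos.2 hr).le, abs_smul_of_nonneg (inv_pos.2 hr).le]
  exact smul_le_smul_of_nonneg_left h (inv_pos.2 hr).le

/-- The ideal generated by a solid ball. -/
def span : Submodule ℝ Y where
  carrier := {y | ∃ r : ℝ, 0 < r ∧ r⁻¹ • y ∈ B}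
  zero_mem' := ⟨1, one_pos, by simpa using hB.zero_mem⟩
  add_mem' := by
    rintro y z ⟨r, hr, hy⟩ ⟨s, hs, hz⟩
    exact ⟨r + s, add_pos hr hs, hB.add_mem hr hs hy hz⟩
  smul_mem' := by
    rintro c y ⟨r, hr, hy⟩
    refine ⟨(|c| + 1) * r, by positivity, ?_⟩
    have : ((|c| + 1) * r)⁻¹ • c • y = (c / (|c| + 1)) • r⁻¹ • y := by
      rw [smul_smul, smul_smul]; congr 1; field_simp
    rw [this]
    refine hB.smul_mem ?_ hy
    rw [abs_div, abs_of_pos (by positivity : (0 : ℝ) < |c| + 1), div_le_one (by positivity)]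
    linarith

theorem mem_span_of_abs_le {y z : Y} (hy : y ∈ hB.span) (h : |z| ≤ |y|) : z ∈ hB.span := by
  obtain ⟨r, hr, hy⟩ := hy
  exact ⟨r, hr, hB.solid_mem hr hy h⟩

theorem abs_mem_span {y : Y} (hy : y ∈ hB.span) : |y| ∈ hB.span :=
  hB.mem_span_of_abs_le hy (abs_abs y).le

theorem sup_mem_span {y z : Y} (hy : y ∈ hB.span) (hz : z ∈ hB.span) : y ⊔ z ∈ hB.span := by
  refine hB.mem_span_of_abs_le (hB.span.add_mem (hB.abs_mem_span hy) (hB.abs_mem_span hz)) ?_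
  refine (sup_le ?_ ?_ : |y ⊔ z| ≤ |y| + |z|).trans (le_abs_self _)
  · exact sup_le ((le_abs_self y).trans (le_add_of_nonneg_right (abs_nonneg z)))
      ((le_abs_self z).trans (le_add_of_nonneg_left (abs_nonneg y)))
  · exact (neg_le_neg (le_sup_left : y ≤ y ⊔ z)).trans
      ((neg_le_abs y).trans (le_add_of_nonneg_right (abs_nonneg z)))

theorem inf_mem_span {y z : Y} (hy : y ∈ hB.span) (hz : z ∈ hB.span) : y ⊓ z ∈ hB.span := by
  have := hB.span.neg_mem (hB.sup_mem_span (hB.span.neg_mem hy) (hB.span.neg_mem hz))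
  rwa [← neg_inf, neg_neg] at this

/-- The ideal generated by a solid ball, to be normed by its gauge. -/
def Space : Type _ := hB.span

instance : AddCommGroup hB.Space := inferInstanceAs (AddCommGroup hB.span)
instance : Module ℝ hB.Space := inferInstanceAs (Module ℝ hB.span)
instance : Lattice hB.Space :=
  Subtype.lattice (fun {_ _} h h' => hB.sup_mem_span h h')
    (fun {_ _} h h' => hB.inf_mem_span h h')

/-- The inclusion of the ideal. -/
def incl : hB.Space →ₗ[ℝ] Y := hB.span.subtype

theorem incl_injective : Function.Injective hB.incl := Subtype.val_injective

theorem incl_le {w z : hB.Space} : hB.incl w ≤ hB.incl z ↔ w ≤ z := Iff.rfl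

theorem incl_sup (w z : hB.Space) : hB.incl (w ⊔ z) = hB.incl w ⊔ hB.incl z := rfl

theorem incl_inf (w z : hB.Space) : hB.incl (w ⊓ z) = hB.incl w ⊓ hB.incl z := rfl

theorem incl_abs (w : hB.Space) : hB.incl |w| = |hB.incl w| := by
  rw [abs, incl_sup, map_neg]; rfl

instance : IsOrderedAddMonoid hB.Space where
  add_le_add_left a b h c := by
    rw [← hB.incl_le, map_add, map_add]
    exact add_le_add_left (hB.incl_le.2 h) _

instance : PosSMulMono ℝ hB.Space where
  smul_le_smul_of_nonneg_left r hr a b h := by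
    have := smul_le_smul_of_nonneg_left (hB.incl_le.2 h) hr
    change r • a ≤ r • b
    rwa [← hB.incl_le, map_smul, map_smul]

theorem exists_incl_mem (w : hB.Space) : ∃ r : ℝ, 0 < r ∧ r⁻¹ • hB.incl w ∈ B := w.2

theorem exists_incl_eq {y : Y} {r : ℝ} (hr : 0 < r) (hy : r⁻¹ • y ∈ B) : ∃ w, hB.incl w = y :=
  ⟨⟨y, r, hr, hy⟩, rfl⟩

theorem absorbent : Absorbent ℝ (hB.incl ⁻¹' B) := by
  refine absorbent_iff_forall_absorbs_singleton.2 fun w => ?_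
  obtain ⟨r, hr, hw⟩ := hB.exists_incl_mem w
  refine absorbs_iff_norm.2 ⟨r, fun c hc => ?_⟩
  rw [Set.singleton_subset_iff]
  have hc0 : c ≠ 0 := by rintro rfl; simp at hc; linarith
  refine ⟨c⁻¹ • w, ?_, smul_inv_smul₀ hc0 w⟩
  rw [Set.mem_preimage, map_smul]
  have : c⁻¹ • hB.incl w = (r / c) • r⁻¹ • hB.incl w := by
    rw [smul_smul]; congr 1; field_simp
  rw [this]
  refine hB.smul_mem ?_ hw
  rw [abs_div, abs_of_pos hr, div_le_one (abs_pos.2 hc0)]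
  exact hc

/-- The gauge of a solid ball on the ideal it generates. -/
noncomputable def gaugeSpan : Seminorm ℝ hB.Space :=
  gaugeSeminorm (s := hB.incl ⁻¹' B) (balanced_iff_smul_mem.2 fun _ hc w hw => by
      rw [Set.mem_preimage, map_smul]; exact hB.smul_mem hc hw)
    (hB.convex.linear_preimage hB.incl) hB.absorbent

/-- A gauge below `s` puts the vector in `s • B`; closedness of `B` allows `s` to decrease to `r`.
So the unit ball is exactly `B`, not merely something between `B` and its closure. -/
theorem gaugeSpan_le_iff {r : ℝ} (hr : 0 < r) (w : hB.Space) :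
    hB.gaugeSpan w ≤ r ↔ r⁻¹ • hB.incl w ∈ B := by
  constructor
  · intro h
    have hlt : ∀ s, r < s → s⁻¹ • hB.incl w ∈ B := fun s hs => by
      obtain ⟨b, hb, hbs, z, hz, e⟩ := exists_lt_of_gauge_lt hB.absorbent (h.trans_lt hs)
      refine hB.smul_mem_of_le hb hbs.le ?_
      rw [← e]
      simp only [map_smul]
      rwa [inv_smul_smul₀ hb.ne']
    have ht : Filter.Tendsto (fun s : ℝ => s⁻¹ • hB.incl w) (nhdsWithin r (Set.Ioi r))
        (nhds (r⁻¹ • hB.incl w)) :=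
      ((tendsto_inv₀ hr.ne').mono_left nhdsWithin_le_nhds).smul_const _
    exact hB.isClosed.mem_of_tendsto ht (eventually_mem_nhdsWithin.mono hlt)
  · intro h
    refine gauge_le_of_mem hr.le ⟨r⁻¹ • w, ?_, smul_inv_smul₀ hr.ne' w⟩
    rwa [Set.mem_preimage, map_smul]

theorem norm_incl_le : ∃ M, 0 < M ∧ ∀ w, ‖hB.incl w‖ ≤ M * hB.gaugeSpan w := by
  obtain ⟨M, hM⟩ := hB.bounded
  refine ⟨|M| + 1, by positivity, fun w => ?_⟩
  refine le_of_forall_pos_le_add fun ε hε => ?_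
  have hr : 0 < hB.gaugeSpan w + ε / (|M| + 1) := add_pos_of_nonneg_of_pos (apply_nonneg _ w) (by positivity)
  have h := hM _ ((hB.gaugeSpan_le_iff hr w).1 (by linarith [show 0 < ε / (|M| + 1) by positivity]))
  rw [norm_smul, norm_inv, Real.norm_of_nonneg hr.le, inv_mul_le_iff₀ hr] at h
  calc _ ≤ _ := h
    _ ≤ (hB.gaugeSpan w + ε / (|M| + 1)) * (|M| + 1) := by
      gcongr; linarith [le_abs_self M]
    _ = _ := by field_simp

noncomputable instance : NormedAddCommGroup hB.Space :=
  AddGroupNorm.toNormedAddCommGroup (E := hB.Space)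
    { hB.gaugeSpan.toAddGroupSeminorm with
      eq_zero_of_map_eq_zero' := fun w hw => by
        obtain ⟨M, -, hM⟩ := hB.norm_incl_le
        have h := hM w
        have hw : hB.gaugeSpan w = 0 := hw
        rw [hw, mul_zero] at h
        exact hB.incl_injective ((norm_le_zero_iff.1 h).trans (map_zero _).symm) }

theorem norm_eq (w : hB.Space) : ‖w‖ = hB.gaugeSpan w := rfl

noncomputable instance : NormedSpace ℝ hB.Space :=
  ⟨fun r w => (map_smul_eq_mul hB.gaugeSpan r w).le⟩

theorem norm_le_iff {r : ℝ} (hr : 0 < r) (w : hB.Space) : ‖w‖ ≤ r ↔ r⁻¹ • hB.incl w ∈ B :=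
  hB.gaugeSpan_le_iff hr w

instance : HasSolidNorm hB.Space where
  solid w z h := by
    refine le_of_forall_pos_le_add fun ε hε => ?_
    have hr : 0 < ‖z‖ + ε := by positivity
    rw [hB.norm_le_iff hr]
    refine hB.solid_mem hr ((hB.norm_le_iff hr z).1 (by linarith)) ?_
    rw [← incl_abs, ← incl_abs]
    exact h

/-- The gauge dominates the norm of `Y`, so a Cauchy sequence converges in `Y`; since `B` is closed,
the Cauchy estimates survive in the limit. -/
instance : CompleteSpace hB.Space := by
  refine Metric.complete_of_cauchySeq_tendsto fun w hw => ?_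
  obtain ⟨M, hM0, hM⟩ := hB.norm_incl_le
  have hc : CauchySeq fun n => hB.incl (w n) := by
    refine Metric.cauchySeq_iff.2 fun ε hε => ?_
    obtain ⟨N, hN⟩ := Metric.cauchySeq_iff.1 hw (ε / M) (by positivity)
    refine ⟨N, fun m hm n hn => ?_⟩
    have h1 := hN m hm n hn
    rw [dist_eq_norm] at h1 ⊢
    rw [← map_sub]
    refine (hM _).trans_lt ?_
    rw [lt_div_iff₀ hM0] at h1
    rwa [mul_comm, ← norm_eq]
  obtain ⟨y, hy⟩ := cauchySeq_tendsto_of_complete hc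
  have key : ∀ ε : ℝ, ε > 0 → ∃ N, ∀ n ≥ N, ε⁻¹ • (hB.incl (w n) - y) ∈ B := fun ε hε => by
    obtain ⟨N, hN⟩ := Metric.cauchySeq_iff.1 hw ε hε
    refine ⟨N, fun n hn => ?_⟩
    have ht : Filter.Tendsto (fun m => ε⁻¹ • (hB.incl (w n) - hB.incl (w m))) Filter.atTop
        (nhds (ε⁻¹ • (hB.incl (w n) - y))) := (hy.const_sub _).const_smul _
    refine hB.isClosed.mem_of_tendsto ht (Filter.eventually_atTop.2 ⟨N, fun m hm => ?_⟩)
    have h1 := hN n hn m hm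
    rw [dist_eq_norm] at h1
    rw [← map_sub]
    exact (hB.norm_le_iff hε _).1 h1.le
  -- The estimate at scale one already shows that the limit differs from `w N` by an element of the
  -- ideal, hence belongs to it.
  obtain ⟨N, hN⟩ := key 1 one_pos
  obtain ⟨z, hz⟩ := hB.exists_incl_eq one_pos (hN N le_rfl)
  refine ⟨w N - z, Metric.tendsto_atTop.2 fun ε hε => ?_⟩
  obtain ⟨N', hN'⟩ := key (ε / 2) (by positivity)
  refine ⟨N', fun n hn => ?_⟩
  rw [dist_eq_norm]
  refine lt_of_le_of_lt ((hB.norm_le_iff (half_pos hε) _).2 ?_) (half_lt_self hε)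
  have : hB.incl (w n - (w N - z)) = hB.incl (w n) - y := by
    rw [map_sub, map_sub, hz]; abel
  rw [this]
  exact hN' n hn

noncomputable instance : BanachLattice hB.Space where

end IsSolidBall

/-- A solid ball is the image of the unit ball under an operator of class `𝒞`. -/
theorem IsSolidBall.exists_classC {Y : Type v} [BanachLattice Y] {B : Set Y}
    (hB : IsSolidBall B) :
    ∃ (W : Type v) (_ : BanachLattice W) (Φ : W →L[ℝ] Y), IsClassC Φ ∧
      (∀ r : ℝ, 0 < r → ∀ w, ‖w‖ ≤ r ↔ r⁻¹ • Φ w ∈ B) ∧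
      ∀ r : ℝ, 0 < r → ∀ y, r⁻¹ • y ∈ B → ∃ w, Φ w = y := by
  obtain ⟨M, -, hM⟩ := hB.norm_incl_le
  refine ⟨hB.Space, inferInstance, hB.incl.mkContinuous M hM, ⟨hB.incl_injective, ⟨?_, ?_⟩,
    fun w z => ⟨hB.incl_sup w z, hB.incl_inf w z⟩, ?_⟩, fun r hr w => hB.norm_le_iff hr w,
    fun r hr y hy => hB.exists_incl_eq hr hy⟩
  · exact fun w hw => hB.incl_le.2 hw
  · intro w hw
    refine Set.Subset.antisymm ?_ ?_
    · rintro _ ⟨z, ⟨h0, h1⟩, rfl⟩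
      exact ⟨hB.incl_le.2 h0, hB.incl_le.2 h1⟩
    · rintro y ⟨h0, h1⟩
      obtain ⟨r, hr, hy⟩ := hB.exists_incl_mem w
      obtain ⟨z, rfl⟩ := hB.exists_incl_eq (y := y) hr (hB.solid_mem hr hy (by
        rw [abs_of_nonneg h0]; exact (show y ≤ hB.incl w from h1).trans (le_abs_self _)))
      exact ⟨z, ⟨hB.incl_le.1 h0, hB.incl_le.1 h1⟩, rfl⟩
  · convert hB.isClosed using 1
    ext y
    simp only [Set.mem_image, mem_closedBall_zero_iff]
    constructor
    · rintro ⟨w, hw, rfl⟩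
      simpa using (hB.norm_le_iff one_pos w).1 hw
    · intro hy
      obtain ⟨w, rfl⟩ := hB.exists_incl_eq one_pos (y := y) (by simpa using hy)
      exact ⟨w, (hB.norm_le_iff one_pos w).2 (by simpa using hy), rfl⟩

/-! ### The `(p_θ,∞)`-convex real interpolation space. -/

theorem kc_smul_tuple {X : Type*} [BanachLattice X] {ι : Type*} [Fintype ι] {c : ℝ} (hc : 0 ≤ c)
    (x : ι → X) {f : (ι → ℝ) → ℝ} (hf : IsHom f) : kc (fun i => c • x i) f = c • kc x f := by
  have h : ∀ i : ι, IsHom fun t : ι → ℝ => c * t i := fun i => (IsHom.coord i).const_mul c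
  have e : ∀ i, c • x i = kc x (fun t => c * t i) := fun i => by
    rw [kc_const_mul x c (IsHom.coord i), kc_coord]
  simp_rw [e]
  rw [kc_comp x h hf, ← kc_const_mul x c hf]
  congr 1
  ext t
  exact hf.2 c hc t

theorem lpNorm_comp_equiv {ι κ : Type*} [Fintype ι] [Fintype κ] {q : ℝ≥0∞} (hq : 1 ≤ q)
    (e : κ ≃ ι) (t : ι → ℝ) : ‖WithLp.toLp q fun j => t (e j)‖ = ‖WithLp.toLp q t‖ := by
  rcases eq_or_ne q ∞ with rfl | hq'
  · rw [PiLp.norm_toLp, PiLp.norm_toLp]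
    refine le_antisymm ((pi_norm_le_iff_of_nonneg (norm_nonneg _)).2 fun i => norm_le_pi_norm t _)
      ((pi_norm_le_iff_of_nonneg (norm_nonneg _)).2 fun i => ?_)
    simpa using norm_le_pi_norm (fun j => t (e j)) (e.symm i)
  · have h0 : 0 < q.toReal := ENNReal.toReal_pos (zero_lt_one.trans_le hq).ne' hq'
    rw [PiLp.norm_eq_sum h0, PiLp.norm_eq_sum h0]
    congr 1
    exact e.sum_comp fun i => ‖t i‖ ^ q.toReal

theorem lpNorm_rpow_le_one {ι : Type*} [Fintype ι] {p : ℝ≥0∞} (hp : 1 ≤ p) {u : ι → ℝ}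
    (hu : ∀ i, 0 ≤ u i) (hsum : ∑ i, u i ≤ 1) :
    ‖WithLp.toLp p (fun i => u i ^ p⁻¹.toReal)‖ ≤ 1 := by
  rcases eq_or_ne p ∞ with rfl | hp'
  -- Here the exponent is zero and every `u i ^ 0` is one, also when `u i = 0`; the bound on the sum
  -- plays no role.
  · rw [PiLp.norm_toLp]
    simp only [ENNReal.inv_top, ENNReal.toReal_zero, Real.rpow_zero]
    exact (pi_norm_le_iff_of_nonneg zero_le_one).2 fun i => by simp
  · have h0 : 0 < p.toReal := ENNReal.toReal_pos (zero_lt_one.trans_le hp).ne' hp'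
    rw [PiLp.norm_eq_sum h0]
    refine Real.rpow_le_one (Finset.sum_nonneg fun i _ => by positivity) ?_ (by positivity)
    refine le_trans (le_of_eq (Finset.sum_congr rfl fun i _ => ?_)) hsum
    rw [Real.norm_of_nonneg (Real.rpow_nonneg (hu i) _), ← Real.rpow_mul (hu i),
      ENNReal.toReal_inv, inv_mul_cancel₀ h0.ne', Real.rpow_one]

section Atoms

variable {E : Type u} {Y : Type v} [NormedAddCommGroup E] [NormedSpace ℝ E] [BanachLattice Y]

/-- The suprema `⋁ᵢ uᵢ^γ |T zᵢ|` with `∑ uᵢ ≤ 1` and `‖zᵢ‖ ≤ 1`. -/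
def supAtoms (γ : ℝ) (T : E →L[ℝ] Y) : Set Y :=
  {w | ∃ (ι : Type) (_ : Fintype ι) (u : ι → ℝ) (z : ι → E), (∀ i, 0 ≤ u i) ∧ ∑ i, u i ≤ 1 ∧
    (∀ i, ‖z i‖ ≤ 1) ∧ w = kc (fun i => u i ^ γ • T (z i)) (fun t => ‖WithLp.toLp ∞ t‖)}

variable {γ : ℝ} {T : E →L[ℝ] Y}

theorem supAtoms_nonneg {w : Y} (hw : w ∈ supAtoms γ T) : 0 ≤ w := by
  obtain ⟨ι, _, u, z, -, -, -, rfl⟩ := hw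
  exact kc_lpNorm_nonneg le_top _

/-- The vectors `uᵢ^{1/p} zᵢ` have `ℓ_p`-norm at most one. This is the point at which convexity of
`T` enters. -/
theorem norm_supAtoms_le {p : ℝ≥0∞} (hp : 1 ≤ p) {K : ℝ} (hK : 0 ≤ K)
    (h : ∀ (n : ℕ) (x : Fin n → E),
      ‖latticeLpSum ∞ (fun i => T (x i))‖ ≤ K * ‖WithLp.toLp p (fun i => ‖x i‖)‖)
    {w : Y} (hw : w ∈ supAtoms p⁻¹.toReal T) : ‖w‖ ≤ K := by
  obtain ⟨ι, _, u, z, hu, hsum, hz, rfl⟩ := hw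
  let e := (Fintype.equivFin ι).symm
  have hN := IsHom.lpNorm (ι := Fin (Fintype.card ι)) (q := ∞) le_top
  have h1 := h _ fun i => u (e i) ^ p⁻¹.toReal • z (e i)
  rw [latticeLpSum_eq_kc le_top] at h1
  simp only [map_smul] at h1
  rw [kc_reindex (fun i => u i ^ p⁻¹.toReal • T (z i)) e hN] at h1
  have e1 : (fun t : ι → ℝ => ‖WithLp.toLp ∞ fun j => t (e j)‖) =
      fun t => ‖WithLp.toLp ∞ t‖ := funext fun t => lpNorm_comp_equiv le_top e t
  rw [e1] at h1
  refine h1.trans (mul_le_of_le_one_right hK ?_)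
  refine le_trans (lpNorm_mono hp fun i => ?_)
    (lpNorm_rpow_le_one hp (u := fun i => u (e i)) (fun i => hu _) ?_)
  · have := Real.rpow_nonneg (hu (e i)) p⁻¹.toReal
    rw [abs_of_nonneg (norm_nonneg _), abs_of_nonneg this, norm_smul, Real.norm_of_nonneg this]
    exact mul_le_of_le_one_right this (hz _)
  · rwa [e.sum_comp u]

/-- Concatenate the families with the product weights `sₖ uₖᵢ`, whose total is still at most one,
and use `(s u)^γ = s^γ u^γ`. -/
theorem exists_supAtoms_ge {κ : Type} [Fintype κ] {s : κ → ℝ} (hs : ∀ k, 0 ≤ s k)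
    (hsum : ∑ k, s k ≤ 1) {w : κ → Y} (hw : ∀ k, w k ∈ supAtoms γ T) :
    ∃ w' ∈ supAtoms γ T, ∀ k, s k ^ γ • w k ≤ w' := by
  choose ι hι u z hu hu1 hz hw using hw
  refine ⟨_, ⟨Σ k, ι k, inferInstance, fun a => s a.1 * u a.1 a.2, fun a => z a.1 a.2,
    fun a => mul_nonneg (hs _) (hu _ _), ?_, fun a => hz _ _, rfl⟩, fun k => ?_⟩
  · rw [Fintype.sum_sigma]
    refine le_trans (Finset.sum_le_sum fun k _ => ?_) hsum
    change ∑ i, s k * u k i ≤ s k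
    rw [← Finset.mul_sum]
    exact mul_le_of_le_one_right (hs k) (hu1 k)
  · rw [hw k, ← kc_smul_tuple (Real.rpow_nonneg (hs k) γ) _ (IsHom.lpNorm le_top)]
    refine kc_lpNorm_top_le _ (kc_lpNorm_nonneg le_top _) fun i => ?_
    refine le_trans (le_of_eq ?_) (abs_le_kc_lpNorm le_top _ (⟨k, i⟩ : Σ k, ι k))
    rw [smul_smul, Real.mul_rpow (hs k) (hu k i)]

theorem zero_mem_supAtoms : (0 : Y) ∈ supAtoms γ T := by
  refine ⟨Empty, inferInstance, Empty.elim, Empty.elim, fun i => i.elim, by simp,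
    fun i => i.elim, le_antisymm (kc_lpNorm_nonneg le_top _) ?_⟩
  simpa using kc_lpNorm_le_sum (X := Y) (ι := Empty) (q := ∞) le_top
    fun i => (Empty.elim i : ℝ) ^ γ • T (Empty.elim i)

theorem exists_supAtoms_abs_le {z : E} (hz : ‖z‖ ≤ 1) : ∃ w ∈ supAtoms γ T, |T z| ≤ w := by
  refine ⟨_, ⟨Unit, inferInstance, fun _ => 1, fun _ => z, fun _ => zero_le_one, by simp,
    fun _ => hz, rfl⟩, ?_⟩
  simpa using abs_le_kc_lpNorm le_top (fun _ : Unit => (1 : ℝ) ^ γ • T z) ()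

/-- The tuples `w` admitting a common majorant form a convex set containing all tuples of atoms, and
the hull of a product is the product of the hulls. -/
theorem exists_hull_ge {κ : Type} [Fintype κ] {s : κ → ℝ} (hs : ∀ k, 0 ≤ s k)
    (hsum : ∑ k, s k ≤ 1) {w : κ → Y} (hw : ∀ k, w k ∈ convexHull ℝ (supAtoms γ T)) :
    ∃ w' ∈ convexHull ℝ (supAtoms γ T), ∀ k, s k ^ γ • w k ≤ w' := by
  have h : convexHull ℝ (Set.univ.pi fun _ : κ => supAtoms γ T) ⊆
      {w | ∃ w' ∈ convexHull ℝ (supAtoms γ T), ∀ k, s k ^ γ • w k ≤ w'} := by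
    refine convexHull_min (fun w hw => ?_) ?_
    · obtain ⟨w', h1, h2⟩ := exists_supAtoms_ge hs hsum fun k => hw k (Set.mem_univ k)
      exact ⟨w', subset_convexHull ℝ _ h1, h2⟩
    · rintro w ⟨w', h1, h2⟩ z ⟨z', h3, h4⟩ a b ha hb hab
      refine ⟨a • w' + b • z', convex_convexHull ℝ _ h1 h3 ha hb hab, fun k => ?_⟩
      simp only [Pi.add_apply, Pi.smul_apply, smul_add]
      rw [smul_comm _ a, smul_comm _ b]
      exact add_le_add (smul_le_smul_of_nonneg_left (h2 k) ha)
        (smul_le_smul_of_nonneg_left (h4 k) hb)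
  rw [convexHull_pi] at h
  exact h fun k _ => hw k

theorem hull_nonneg {w : Y} (hw : w ∈ convexHull ℝ (supAtoms γ T)) : 0 ≤ w :=
  convexHull_min (fun _ h => supAtoms_nonneg h) (convex_Ici (0 : Y)) hw

/-- The unit ball of a real interpolation space between the space with unit ball the convex hull of
`supAtoms γ T` and `Y`. -/
def interpBall (θ γ : ℝ) (T : E →L[ℝ] Y) : Set Y :=
  {y | ∀ t : ℝ, 0 < t → ∀ ε : ℝ, 0 < ε → ∃ w ∈ convexHull ℝ (supAtoms γ T), ∃ v : Y,
    ‖v‖ ≤ 1 + ε ∧ |y| ≤ t ^ θ • w + t ^ (θ - 1) • v}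

variable {θ : ℝ}

theorem isSolidBall_interpBall {K : ℝ} (hK : ∀ w ∈ supAtoms γ T, ‖w‖ ≤ K) :
    IsSolidBall (interpBall θ γ T) where
  convex := by
    intro y hy z hz a b ha hb hab t ht ε hε
    obtain ⟨w, hw, v, hv, h⟩ := hy t ht ε hε
    obtain ⟨w', hw', v', hv', h'⟩ := hz t ht ε hε
    refine ⟨a • w + b • w', convex_convexHull ℝ _ hw hw' ha hb hab, a • v + b • v', ?_, ?_⟩
    · refine (norm_add_le _ _).trans ?_
      rw [norm_smul, norm_smul, Real.norm_of_nonneg ha, Real.norm_of_nonneg hb]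
      calc a * ‖v‖ + b * ‖v'‖ ≤ a * (1 + ε) + b * (1 + ε) := by gcongr
        _ = 1 + ε := by rw [← add_mul, hab, one_mul]
    · refine (abs_add_le _ _).trans ?_
      rw [abs_smul_of_nonneg ha, abs_smul_of_nonneg hb]
      refine (add_le_add (smul_le_smul_of_nonneg_left h ha)
        (smul_le_smul_of_nonneg_left h' hb)).trans (le_of_eq ?_)
      module
  isClosed := by
    refine isClosed_of_closure_subset fun y hy t ht ε hε => ?_
    -- The approximation error is moved into `v`, where division by `t ^ (θ - 1)` leaves `ε / 2`.
    -- The slack `ε` in the definition of the ball is there to absorb it.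
    obtain ⟨z, hz, hd⟩ := Metric.mem_closure_iff.1 hy (t ^ (θ - 1) * (ε / 2)) (by positivity)
    obtain ⟨w, hw, v, hv, h⟩ := hz t ht (ε / 2) (by positivity)
    have h0 : (0 : ℝ) < t ^ (θ - 1) := by positivity
    refine ⟨w, hw, v + (t ^ (θ - 1))⁻¹ • |y - z|, ?_, ?_⟩
    · refine (norm_add_le _ _).trans ?_
      rw [norm_smul, norm_abs_eq_norm, norm_inv, Real.norm_of_nonneg h0.le]
      rw [dist_eq_norm] at hd
      have : (t ^ (θ - 1))⁻¹ * ‖y - z‖ ≤ ε / 2 := (inv_mul_le_iff₀ h0).2 hd.le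
      linarith
    · rw [smul_add, smul_inv_smul₀ h0.ne', ← add_assoc]
      calc |y| = |z + (y - z)| := by rw [add_sub_cancel]
        _ ≤ |z| + |y - z| := abs_add_le _ _
        _ ≤ _ := by gcongr
  solid y hy z hz t ht ε hε := by
    obtain ⟨w, hw, v, hv, h⟩ := hy t ht ε hε
    exact ⟨w, hw, v, hv, hz.trans h⟩
  zero_mem t ht ε hε :=
    ⟨0, subset_convexHull ℝ _ zero_mem_supAtoms, 0, by simp; positivity, by simp⟩
  bounded := by
    refine ⟨K + 2, fun y hy => ?_⟩
    obtain ⟨w, hw, v, hv, h⟩ := hy 1 one_pos 1 one_pos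
    simp only [Real.one_rpow, one_smul] at h
    have h1 := norm_le_norm_of_abs_le_abs (h.trans (le_abs_self _))
    have h2 : ‖w‖ ≤ K := by
      have := convexHull_min (t := Metric.closedBall (0 : Y) K) (fun w hw => by
        simpa using hK w hw) (convex_closedBall _ _) hw
      simpa using this
    have := norm_add_le w v
    linarith

theorem map_mem_interpBall {x : E} (h : ∀ t : ℝ, 0 < t → ∃ x₁ x₂, x = x₁ + x₂ ∧
    ‖x₁‖ ≤ t ^ θ ∧ ‖T x₂‖ ≤ t ^ (θ - 1)) : T x ∈ interpBall θ γ T := by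
  intro t ht ε hε
  obtain ⟨x₁, x₂, rfl, h1, h2⟩ := h t ht
  have p1 : 0 < t ^ θ := by positivity
  have p2 : 0 < t ^ (θ - 1) := by positivity
  obtain ⟨w, hw, hle⟩ := exists_supAtoms_abs_le (γ := γ) (T := T) (z := (t ^ θ)⁻¹ • x₁) (by
    rw [norm_smul, norm_inv, Real.norm_of_nonneg p1.le, inv_mul_le_iff₀ p1, mul_one]; exact h1)
  refine ⟨w, subset_convexHull ℝ _ hw, (t ^ (θ - 1))⁻¹ • |T x₂|, ?_, ?_⟩
  · rw [norm_smul, norm_inv, Real.norm_of_nonneg p2.le, norm_abs_eq_norm]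
    have := (inv_mul_le_iff₀ p2).2 (h2.trans_eq (mul_one _).symm)
    linarith
  · rw [smul_inv_smul₀ p2.ne', map_add]
    refine (abs_add_le _ _).trans (add_le_add_left ?_ _)
    rw [map_smul, abs_smul_of_nonneg (inv_pos.2 p1).le] at hle
    have := smul_le_smul_of_nonneg_left hle p1.le
    rwa [smul_inv_smul₀ p1.ne'] at this

/-- Each `y i` is decomposed at its own parameter `t * a i ^ β`, so that the weights of the two
parts become `t^θ (aᵢ^r)^γ` and `t^{θ-1} aᵢ^r`. Stability of the hull and the triangle inequality in
`Y` then recombine them at parameter `t`. -/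
theorem kc_mem_interpBall (hθ : 0 < θ) {r : ℝ}
    (hr : r * ((1 - θ) * γ + θ) = 1) {n : ℕ} {a : Fin n → ℝ} (ha : ∀ i, 0 < a i)
    (hsum : ∑ i, a i ^ r ≤ 1) {y : Fin n → Y} (hy : ∀ i, (a i)⁻¹ • y i ∈ interpBall θ γ T) :
    kc y (fun t => ‖WithLp.toLp ∞ t‖) ∈ interpBall θ γ T := by
  intro t ht ε hε
  -- `β` solves both `1 + β θ = r γ` and `1 + β (θ - 1) = r`; the two are compatible exactly because
  -- of `hr`.
  set β := (r * γ - 1) / θ with hβ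
  have hβ1 : 1 + β * θ = r * γ := by rw [hβ]; field_simp; ring
  have hβ2 : 1 + β * (θ - 1) = r := by rw [hβ]; field_simp; linear_combination (-1 : ℝ) * hr
  choose w hw v hv h using fun i => hy i (t * a i ^ β)
    (mul_pos ht (Real.rpow_pos_of_pos (ha i) _)) ε hε
  obtain ⟨w', hw', hle⟩ := exists_hull_ge (fun i => Real.rpow_nonneg (ha i).le r) hsum hw
  have hw0 := hull_nonneg hw'
  have hsv : 0 ≤ ∑ i, a i ^ r • |v i| := Finset.sum_nonneg fun i _ =>
    smul_nonneg (Real.rpow_nonneg (ha i).le r) (abs_nonneg _)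
  refine ⟨w', hw', ∑ i, a i ^ r • |v i|, ?_, ?_⟩
  · calc ‖∑ i, a i ^ r • |v i|‖ ≤ ∑ i, ‖a i ^ r • |v i|‖ := norm_sum_le _ _
      _ ≤ ∑ i, a i ^ r * (1 + ε) := Finset.sum_le_sum fun i _ => by
        rw [norm_smul, norm_abs_eq_norm, Real.norm_of_nonneg (Real.rpow_nonneg (ha i).le r)]
        exact mul_le_mul_of_nonneg_left (hv i) (Real.rpow_nonneg (ha i).le r)
      _ ≤ 1 + ε := by
        rw [← Finset.sum_mul]
        exact mul_le_of_le_one_left (by positivity) hsum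
  · have h0 : 0 ≤ t ^ θ • w' + t ^ (θ - 1) • ∑ i, a i ^ r • |v i| :=
      add_nonneg (smul_nonneg (by positivity) hw0) (smul_nonneg (by positivity) hsv)
    rw [abs_of_nonneg (kc_lpNorm_nonneg le_top _)]
    refine kc_lpNorm_top_le _ h0 fun i => ?_
    have hi := smul_le_smul_of_nonneg_left (h i) (ha i).le
    rw [abs_smul_of_nonneg (inv_pos.2 (ha i)).le, smul_inv_smul₀ (ha i).ne', smul_add, smul_smul,
      smul_smul, Real.mul_rpow ht.le (Real.rpow_nonneg (ha i).le _),
      Real.mul_rpow ht.le (Real.rpow_nonneg (ha i).le _), ← Real.rpow_mul (ha i).le,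
      ← Real.rpow_mul (ha i).le] at hi
    have e1 : a i * (t ^ θ * a i ^ (β * θ)) = t ^ θ * (a i ^ r) ^ γ := by
      rw [← Real.rpow_mul (ha i).le, ← hβ1, Real.rpow_add (ha i), Real.rpow_one]; ring
    have e2 : a i * (t ^ (θ - 1) * a i ^ (β * (θ - 1))) = t ^ (θ - 1) * a i ^ r := by
      conv_rhs => rw [← hβ2, Real.rpow_add (ha i), Real.rpow_one]
      ring
    rw [e1, e2, mul_smul, mul_smul] at hi
    refine hi.trans (add_le_add (smul_le_smul_of_nonneg_left (hle i) (by positivity))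
      (smul_le_smul_of_nonneg_left ?_ (by positivity)))
    refine (smul_le_smul_of_nonneg_left (le_abs_self (v i)) (Real.rpow_nonneg (ha i).le r)).trans ?_
    exact Finset.single_le_sum (f := fun i => a i ^ r • |v i|)
      (fun i _ => smul_nonneg (Real.rpow_nonneg (ha i).le r) (abs_nonneg _)) (Finset.mem_univ i)

theorem isConvexLattice_of_interpBall {W : Type*} [BanachLattice W] {Φ : W →L[ℝ] Y}
    (hΦ : IsLatticeHom Φ)
    (hball : ∀ r : ℝ, 0 < r → ∀ w, ‖w‖ ≤ r ↔ r⁻¹ • Φ w ∈ interpBall θ γ T)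
    (hθ : 0 < θ) {r : ℝ≥0∞} (hr1 : 1 ≤ r) (hrtop : r ≠ ∞)
    (hr : r.toReal * ((1 - θ) * γ + θ) = 1) : IsConvexLattice r ∞ W := by
  refine ⟨1, le_rfl, fun n x => ?_⟩
  have h0 : 0 < r.toReal := ENNReal.toReal_pos (zero_lt_one.trans_le hr1).ne' hrtop
  have : Fact (1 ≤ r) := ⟨hr1⟩
  rw [one_mul]
  refine le_of_forall_gt_imp_ge_of_dense fun R hR => ?_
  have hR0 : 0 < R := (norm_nonneg _).trans_lt hR
  set R₀ := ‖WithLp.toLp r fun i => ‖x i‖‖ with hR₀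
  -- Adding `δ` to each norm makes the weights strictly positive, as negative powers require, and
  -- costs at most `n δ ≤ R - R₀`.
  set δ := (R - R₀) / (n + 1) with hδ
  have hδ0 : 0 < δ := div_pos (sub_pos.2 hR) (by positivity)
  have ha : ∀ i, 0 < (‖x i‖ + δ) / R := fun i => by positivity
  have hnorm : ‖WithLp.toLp r fun i => ‖x i‖ + δ‖ ≤ R := by
    have e : (WithLp.toLp r fun i => ‖x i‖ + δ) =
        (WithLp.toLp r fun i => ‖x i‖) + WithLp.toLp r fun _ => δ := rfl
    rw [e]
    have h1 := lpNorm_le_sum hr1 fun _ : Fin n => δ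
    simp only [abs_of_pos hδ0, Finset.sum_const, Finset.card_univ, Fintype.card_fin,
      nsmul_eq_mul] at h1
    have h2 : (n + 1) * δ = R - R₀ := by rw [hδ]; field_simp
    have := norm_add_le (WithLp.toLp r fun i => ‖x i‖) (WithLp.toLp r fun _ => δ)
    linarith
  have hsum : ∑ i, ((‖x i‖ + δ) / R) ^ r.toReal ≤ 1 := by
    rw [PiLp.norm_eq_sum h0] at hnorm
    have h1 := Real.rpow_le_rpow (Real.rpow_nonneg (Finset.sum_nonneg fun i _ => by positivity) _)
      hnorm h0.le
    rw [← Real.rpow_mul (Finset.sum_nonneg fun i _ => by positivity), one_div,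
      inv_mul_cancel₀ h0.ne', Real.rpow_one] at h1
    have e : ∀ i, ((‖x i‖ + δ) / R) ^ r.toReal = ‖‖x i‖ + δ‖ ^ r.toReal / R ^ r.toReal := fun i => by
      rw [Real.norm_of_nonneg (by positivity), Real.div_rpow (by positivity) hR0.le]
    simp_rw [e, ← Finset.sum_div]
    exact (div_le_one (by positivity)).2 h1
  have hmem := kc_mem_interpBall hθ hr ha hsum (y := fun i => R⁻¹ • Φ (x i)) fun i => by
    have h1 := (hball (‖x i‖ + δ) (by positivity) (x i)).1 (by linarith)
    rw [smul_smul]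
    convert h1 using 2
    field_simp
  rw [kc_smul_tuple (inv_pos.2 hR0).le _ (IsHom.lpNorm le_top),
    ← kc_map hΦ x (IsHom.lpNorm le_top), ← hball R hR0] at hmem
  rwa [latticeLpSum_eq_kc le_top]

end Atoms

/-! ### The concave functional on `X` induced by `T`. -/

theorem lpNorm_sigma {κ : Type*} [Fintype κ] {ι : κ → Type*} [∀ k, Fintype (ι k)] {q : ℝ≥0∞}
    (hq : 1 ≤ q) (hq' : q ≠ ∞) (t : (Σ k, ι k) → ℝ) :
    ‖WithLp.toLp q t‖ = ‖WithLp.toLp q fun k => ‖WithLp.toLp q fun i => t ⟨k, i⟩‖‖ := by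
  have h0 : 0 < q.toReal := ENNReal.toReal_pos (zero_lt_one.trans_le hq).ne' hq'
  simp only [PiLp.norm_eq_sum h0]
  congr 1
  rw [Fintype.sum_sigma]
  refine Finset.sum_congr rfl fun k _ => ?_
  have h1 : 0 ≤ ∑ i, ‖t ⟨k, i⟩‖ ^ q.toReal := Finset.sum_nonneg fun i _ => by positivity
  rw [Real.norm_of_nonneg (Real.rpow_nonneg h1 _), ← Real.rpow_mul h1, one_div,
    inv_mul_cancel₀ h0.ne', Real.rpow_one]

section Concave

variable {X : Type u} {E : Type v} [BanachLattice X] [NormedAddCommGroup E] [NormedSpace ℝ E]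

/-- The supremum of `(∑ᵢ ‖T xᵢ‖^q)^{1/q}` over the tuples with `(∑ᵢ |xᵢ|^{q₂})^{1/q₂} ≤ |b|`. -/
noncomputable def concaveGauge (q q₂ : ℝ≥0∞) (T : X →L[ℝ] E) (b : X) : ℝ :=
  sSup {s | ∃ (ι : Type) (_ : Fintype ι) (x : ι → X),
    kc x (fun t => ‖WithLp.toLp q₂ t‖) ≤ |b| ∧ s = ‖WithLp.toLp q fun i => ‖T (x i)‖‖}

variable {q q₂ : ℝ≥0∞} {T : X →L[ℝ] E} {K : ℝ}

/-- The quantitative form of `(q, q₂)`-concavity. -/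
def ConcaveBound (q q₂ : ℝ≥0∞) (T : X →L[ℝ] E) (K : ℝ) : Prop :=
  ∀ (n : ℕ) (x : Fin n → X), ‖WithLp.toLp q (fun i => ‖T (x i)‖)‖ ≤ K * ‖latticeLpSum q₂ x‖

theorem ConcaveBound.fintype (h : ConcaveBound q q₂ T K) (hq : 1 ≤ q) (hq₂ : 1 ≤ q₂)
    {ι : Type*} [Fintype ι] (x : ι → X) :
    ‖WithLp.toLp q fun i => ‖T (x i)‖‖ ≤ K * ‖kc x fun t => ‖WithLp.toLp q₂ t‖‖ := by
  let e := (Fintype.equivFin ι).symm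
  have h1 := h _ fun i => x (e i)
  rw [latticeLpSum_eq_kc hq₂, kc_reindex x e (IsHom.lpNorm hq₂),
    lpNorm_comp_equiv hq e fun i => ‖T (x i)‖] at h1
  simp_rw [lpNorm_comp_equiv hq₂ e] at h1
  exact h1

variable (h : ConcaveBound q q₂ T K) (hK : 0 ≤ K) (hq : 1 ≤ q) (hq₂ : 1 ≤ q₂)

include h hK hq hq₂ in
-- Concavity of `T` enters here: it makes the supremum defining `concaveGauge` finite and bounded by
-- a multiple of the norm.
theorem le_concaveGauge_bound {b : X} {ι : Type} [Fintype ι] {x : ι → X}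
    (hx : kc x (fun t => ‖WithLp.toLp q₂ t‖) ≤ |b|) :
    ‖WithLp.toLp q fun i => ‖T (x i)‖‖ ≤ K * ‖b‖ := by
  refine (h.fintype hq hq₂ x).trans (mul_le_mul_of_nonneg_left ?_ hK)
  refine norm_le_norm_of_abs_le_abs ?_
  rwa [abs_of_nonneg (kc_lpNorm_nonneg hq₂ x)]

include h hK hq hq₂ in
theorem le_concaveGauge {b : X} {ι : Type} [Fintype ι] {x : ι → X}
    (hx : kc x (fun t => ‖WithLp.toLp q₂ t‖) ≤ |b|) :
    ‖WithLp.toLp q fun i => ‖T (x i)‖‖ ≤ concaveGauge q q₂ T b := by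
  refine le_csSup ⟨K * ‖b‖, ?_⟩ ⟨ι, inferInstance, x, hx, rfl⟩
  rintro _ ⟨ι, _, x, hx, rfl⟩
  exact le_concaveGauge_bound h hK hq hq₂ hx

theorem concaveGauge_le (hq₂ : 1 ≤ q₂) {b : X} {s : ℝ}
    (hs : ∀ (ι : Type) [Fintype ι] (x : ι → X),
      kc x (fun t => ‖WithLp.toLp q₂ t‖) ≤ |b| → ‖WithLp.toLp q fun i => ‖T (x i)‖‖ ≤ s) :
    concaveGauge q q₂ T b ≤ s := by
  refine csSup_le ⟨_, Empty, inferInstance, Empty.elim, ?_, rfl⟩ ?_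
  · refine (kc_lpNorm_le_sum hq₂ _).trans ?_
    simp
  · rintro _ ⟨ι, _, x, hx, rfl⟩
    exact hs ι x hx

include h hK hq hq₂ in
theorem concaveGauge_le_norm (b : X) : concaveGauge q q₂ T b ≤ K * ‖b‖ :=
  concaveGauge_le hq₂ fun _ _ _ hx => le_concaveGauge_bound h hK hq hq₂ hx

include h hK hq hq₂ in
theorem concaveGauge_mono {b c : X} (hbc : |b| ≤ |c|) :
    concaveGauge q q₂ T b ≤ concaveGauge q q₂ T c :=
  concaveGauge_le hq₂ fun _ _ _ hx => le_concaveGauge h hK hq hq₂ (hx.trans hbc)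

include h hK hq hq₂ in
theorem norm_le_concaveGauge (x : X) : ‖T x‖ ≤ concaveGauge q q₂ T x := by
  have h1 := le_concaveGauge h hK hq hq₂ (b := x) (x := fun _ : Unit => x)
    ((kc_lpNorm_le_sum hq₂ _).trans (by simp))
  refine le_trans ?_ h1
  simpa using abs_le_lpNorm hq (fun _ : Unit => ‖T x‖) ()

include h hK hq hq₂ in
theorem concaveGauge_nonneg (b : X) : 0 ≤ concaveGauge q q₂ T b :=
  (norm_nonneg _).trans (norm_le_concaveGauge h hK hq hq₂ b)

theorem lpNorm_const_mul {ι : Type*} [Fintype ι] {q : ℝ≥0∞} (hq : 1 ≤ q) {c : ℝ} (hc : 0 ≤ c)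
    (t : ι → ℝ) : ‖WithLp.toLp q fun i => c * t i‖ = c * ‖WithLp.toLp q t‖ :=
  (IsHom.lpNorm hq).2 c hc t

include h hK hq hq₂ in
theorem concaveGauge_smul_le {c : ℝ} (hc : 0 ≤ c) (b : X) :
    concaveGauge q q₂ T (c • b) ≤ c * concaveGauge q q₂ T b := by
  rcases hc.eq_or_lt with rfl | hc0
  · simpa using concaveGauge_le_norm h hK hq hq₂ (0 : X)
  refine concaveGauge_le hq₂ fun ι _ x hx => ?_
  have h1 : kc (fun i => c⁻¹ • x i) (fun t => ‖WithLp.toLp q₂ t‖) ≤ |b| := by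
    rw [kc_smul_tuple (inv_pos.2 hc0).le x (IsHom.lpNorm hq₂)]
    rw [abs_smul_of_nonneg hc] at hx
    have := smul_le_smul_of_nonneg_left hx (inv_pos.2 hc0).le
    rwa [inv_smul_smul₀ hc0.ne'] at this
  have h2 := le_concaveGauge h hK hq hq₂ h1
  simp only [map_smul, norm_smul, norm_inv, Real.norm_of_nonneg hc] at h2
  rwa [lpNorm_const_mul hq (inv_pos.2 hc0).le, inv_mul_le_iff₀ hc0] at h2

theorem lpNorm_add_le {ι : Type*} [Fintype ι] {q : ℝ≥0∞} (hq : 1 ≤ q) (s t : ι → ℝ) :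
    ‖WithLp.toLp q fun i => s i + t i‖ ≤ ‖WithLp.toLp q s‖ + ‖WithLp.toLp q t‖ := by
  have : Fact (1 ≤ q) := ⟨hq⟩
  exact norm_add_le (WithLp.toLp q s) (WithLp.toLp q t)

/-- Riesz decomposition for `ℓ_q`-sums. -/
theorem exists_decomposition (hq₂ : 1 ≤ q₂) {b c : X} (hb : 0 ≤ b) (hc : 0 ≤ c) {ι : Type*}
    [Fintype ι] {x : ι → X} (hx : kc x (fun t => ‖WithLp.toLp q₂ t‖) ≤ b + c) :
    ∃ y z : ι → X, (∀ i, x i = y i + z i) ∧ kc y (fun t => ‖WithLp.toLp q₂ t‖) ≤ b ∧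
      kc z (fun t => ‖WithLp.toLp q₂ t‖) ≤ c := by
  let w : Bool ⊕ ι → X := Sum.elim (fun a => cond a b c) x
  -- The pieces are `(b / (b + c)) x` and `(c / (b + c)) x`. The denominator `m` equals `b + c` on
  -- the spectrum; off it, the supremum with the `ℓ_{q₂}`-norm keeps the quotients bounded by `m`,
  -- hence continuous where `m` vanishes.
  let m : (Bool ⊕ ι → ℝ) → ℝ := fun t =>
    (|t (.inl true)| + |t (.inl false)|) ⊔ ‖WithLp.toLp q₂ fun i => t (.inr i)‖
  have hN := IsHom.lpNorm (ι := ι) hq₂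
  have hNr : IsHom fun t : Bool ⊕ ι → ℝ => ‖WithLp.toLp q₂ fun i => t (.inr i)‖ :=
    hN.comp fun i => IsHom.coord _
  have hm : IsHom m := ((IsHom.coord _).abs.add (IsHom.coord _).abs).sup hNr
  have hm0 : ∀ t, 0 ≤ m t := fun t => le_sup_of_le_left (by positivity)
  have habs : ∀ (a : Bool) t, |t (.inl a)| ≤ m t := fun a t => by
    refine le_trans ?_ le_sup_left
    cases a
    · exact le_add_of_nonneg_left (abs_nonneg _)
    · exact le_add_of_nonneg_right (abs_nonneg _)
  have hratio : ∀ (a : Bool) t, |t (.inl a)| / m t ≤ 1 := fun a t =>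
    div_le_one_of_le₀ (habs a t) (hm0 t)
  have hf : ∀ (a : Bool) (i : ι),
      IsHom fun t : Bool ⊕ ι → ℝ => |t (.inl a)| / m t * t (.inr i) := fun a i => by
    refine IsHom.of_bound hm.1 (C := 1) (fun t => ?_) ?_ (fun c hc t => ?_) hm.map_zero
    · rw [abs_mul, abs_of_nonneg (div_nonneg (abs_nonneg _) (hm0 t)), one_mul]
      refine (mul_le_of_le_one_left (abs_nonneg _) (hratio a t)).trans ?_
      exact (abs_le_lpNorm hq₂ (fun i => t (.inr i)) i).trans le_sup_right
    · refine ContinuousOn.mul (ContinuousOn.div ?_ hm.1.continuousOn fun t ht => ht) ?_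
      · exact (continuous_apply _).abs.continuousOn
      · exact (continuous_apply _).continuousOn
    · rw [hm.2 c hc.le]
      simp only [Pi.smul_apply, smul_eq_mul, abs_mul, abs_of_pos hc]
      rw [mul_div_mul_left _ _ hc.ne']
      ring
  have hpos : ∀ (a : Bool), ∀ t ∈ spec w, 0 ≤ t (.inl a) := fun a t ht =>
    le_on_spec IsHom.zero (IsHom.coord _) (by
      rw [kc_zero, kc_coord]
      cases a
      · exact hc
      · exact hb) ht
  have hle : ∀ t ∈ spec w, ‖WithLp.toLp q₂ fun i => t (.inr i)‖ ≤
      t (.inl true) + t (.inl false) := fun t ht =>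
    le_on_spec hNr ((IsHom.coord _).add (IsHom.coord _)) (by
      rw [← kc_reindex w Sum.inr hN, kc_add w (IsHom.coord _) (IsHom.coord _), kc_coord, kc_coord]
      exact hx) ht
  have hmeq : ∀ t ∈ spec w, m t = t (.inl true) + t (.inl false) := fun t ht => by
    simp only [m]
    rw [abs_of_nonneg (hpos _ t ht), abs_of_nonneg (hpos _ t ht)]
    exact sup_eq_left.2 (hle t ht)
  have hbound : ∀ a : Bool, kc (fun i => kc w fun t => |t (.inl a)| / m t * t (.inr i))
      (fun t => ‖WithLp.toLp q₂ t‖) ≤ w (.inl a) := fun a => by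
    rw [kc_comp w (hf a) hN, ← kc_coord w (.inl a)]
    refine kc_le (hN.comp (hf a)) (IsHom.coord _) fun t ht => ?_
    rw [lpNorm_const_mul hq₂ (div_nonneg (abs_nonneg _) (hm0 t)), abs_of_nonneg (hpos a t ht)]
    rcases (hm0 t).eq_or_lt with h0 | h0
    · rw [← h0, div_zero, zero_mul]; exact hpos a t ht
    · rw [div_mul_eq_mul_div, div_le_iff₀ h0]
      exact mul_le_mul_of_nonneg_left le_sup_right (hpos a t ht)
  refine ⟨_, _, fun i => ?_, hbound true, hbound false⟩
  rw [← kc_add w (hf true i) (hf false i)]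
  change w (.inr i) = _
  rw [← kc_coord w (.inr i)]
  refine kc_congr (IsHom.coord _) ((hf true i).add (hf false i)) fun t ht => ?_
  rw [abs_of_nonneg (hpos _ t ht), abs_of_nonneg (hpos _ t ht), ← add_mul, ← add_div, ← hmeq t ht]
  rcases (hm0 t).eq_or_lt with h0 | h0
  · have := (abs_le_lpNorm hq₂ (fun i => t (.inr i)) i).trans ((hle t ht).trans_eq (hmeq t ht).symm)
    rw [← h0] at this ⊢
    simpa using this
  · rw [div_self h0.ne', one_mul]

include h hK hq hq₂ in
theorem concaveGauge_add_le {b c : X} (hb : 0 ≤ b) (hc : 0 ≤ c) :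
    concaveGauge q q₂ T (b + c) ≤ concaveGauge q q₂ T b + concaveGauge q q₂ T c := by
  refine concaveGauge_le hq₂ fun ι _ x hx => ?_
  rw [abs_of_nonneg (add_nonneg hb hc)] at hx
  obtain ⟨y, z, hyz, hy, hz⟩ := exists_decomposition hq₂ hb hc hx
  have h1 := le_concaveGauge h hK hq hq₂ (hy.trans (le_abs_self b))
  have h2 := le_concaveGauge h hK hq hq₂ (hz.trans (le_abs_self c))
  refine le_trans (lpNorm_mono hq fun i => ?_) ((lpNorm_add_le hq _ _).trans (add_le_add h1 h2))
  rw [abs_of_nonneg (norm_nonneg _), abs_of_nonneg (by positivity), hyz i, map_add]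
  exact norm_add_le _ _

include h hK hq hq₂ in
-- Nearly optimal tuples for the separate `b i` concatenate to a tuple admissible for `c`, since
-- iterated `ℓ`-sums with the same exponent are `ℓ`-sums. This replaces the constant of `T` by one.
theorem lpNorm_concaveGauge_le (hq' : q ≠ ∞) (hq₂' : q₂ ≠ ∞) {n : ℕ} {b : Fin n → X} {c : X}
    (hb : ∀ i, 0 ≤ b i) (hbc : kc b (fun t => ‖WithLp.toLp q₂ t‖) ≤ |c|) :
    ‖WithLp.toLp q fun i => concaveGauge q q₂ T (b i)‖ ≤ concaveGauge q q₂ T c := by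
  have hN := fun (ι : Type) [Fintype ι] => IsHom.lpNorm (ι := ι) hq₂
  have key : ∀ η > 0, ‖WithLp.toLp q fun i => concaveGauge q q₂ T (b i)‖ ≤
      concaveGauge q q₂ T c + n * η := fun η hη => by
    have hex : ∀ i, ∃ (ι : Type) (_ : Fintype ι) (x : ι → X),
        kc x (fun t => ‖WithLp.toLp q₂ t‖) ≤ b i ∧
          concaveGauge q q₂ T (b i) ≤ ‖WithLp.toLp q fun i => ‖T (x i)‖‖ + η := fun i => by
      by_contra! hcon
      have := concaveGauge_le (T := T) (q := q) hq₂ (b := b i)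
        (s := concaveGauge q q₂ T (b i) - η) fun ι _ x hx => by
          rw [abs_of_nonneg (hb i)] at hx
          linarith [hcon ι inferInstance x hx]
      linarith
    choose ι hι x hx hle using hex
    let z : (Σ i, ι i) → X := fun a => x a.1 a.2
    have hz : kc z (fun t => ‖WithLp.toLp q₂ t‖) ≤ |c| := by
      simp_rw [lpNorm_sigma hq₂ hq₂']
      have hin : ∀ i, IsHom fun t : (Σ i, ι i) → ℝ => ‖WithLp.toLp q₂ fun j => t ⟨i, j⟩‖ :=
        fun i => (hN (ι i)).comp fun j => IsHom.coord _
      rw [← kc_comp z hin (IsHom.lpNorm hq₂)]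
      refine (kc_lpNorm_mono hq₂ (fun i => ?_) (fun i => ?_)).trans hbc
      · rw [← kc_reindex z (fun j => (⟨i, j⟩ : Σ i, ι i)) (hN (ι i))]
        exact kc_lpNorm_nonneg hq₂ _
      · rw [← kc_reindex z (fun j => (⟨i, j⟩ : Σ i, ι i)) (hN (ι i))]
        exact hx i
    have h1 := le_concaveGauge h hK hq hq₂ hz
    rw [lpNorm_sigma hq hq'] at h1
    have h2 := lpNorm_add_le hq (fun i => ‖WithLp.toLp q fun j => ‖T (x i j)‖‖) fun _ => η
    have h3 := lpNorm_le_sum hq fun _ : Fin n => η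
    simp only [abs_of_pos hη, Finset.sum_const, Finset.card_univ, Fintype.card_fin,
      nsmul_eq_mul] at h3
    have : Fact (1 ≤ q) := ⟨hq⟩
    have h4 := lpNorm_mono hq (s := fun i => concaveGauge q q₂ T (b i))
      (t := fun i => ‖WithLp.toLp q fun j => ‖T (x i j)‖‖ + η) fun i => by
        rw [abs_of_nonneg (concaveGauge_nonneg h hK hq hq₂ _), abs_of_nonneg (by positivity)]
        exact hle i
    linarith
  refine le_of_forall_pos_le_add fun δ hδ => (key (δ / (n + 1)) (by positivity)).trans ?_
  have : n * (δ / (n + 1)) ≤ δ := by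
    rw [mul_div_assoc', div_le_iff₀ (by positivity)]; nlinarith
  linarith

end Concave

/-! ### Weighted geometric means and the Calderón product. -/

theorem young_rpow {θ : ℝ} (hθ : 0 < θ) (hθ₁ : θ < 1) {a b s : ℝ} (ha : 0 ≤ a) (hb : 0 ≤ b)
    (hs : 0 < s) : a ^ (1 - θ) * b ^ θ ≤ (1 - θ) * s ^ θ * a + θ * s ^ (θ - 1) * b := by
  -- Arithmetic-geometric mean for `s^θ a` and `s^{θ-1} b`: the powers of `s` cancel in the
  -- geometric mean.
  have h := Real.geom_mean_le_arith_mean2_weighted (sub_pos.2 hθ₁).le hθ.le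
    (mul_nonneg (Real.rpow_nonneg hs.le θ) ha) (mul_nonneg (Real.rpow_nonneg hs.le (θ - 1)) hb)
    (sub_add_cancel 1 θ)
  rw [Real.mul_rpow (by positivity) ha, Real.mul_rpow (by positivity) hb, ← Real.rpow_mul hs.le,
    ← Real.rpow_mul hs.le] at h
  have e : s ^ (θ * (1 - θ)) * s ^ ((θ - 1) * θ) = 1 := by
    rw [← Real.rpow_add hs]; ring_nf; exact Real.rpow_zero s
  calc a ^ (1 - θ) * b ^ θ
      = s ^ (θ * (1 - θ)) * a ^ (1 - θ) * (s ^ ((θ - 1) * θ) * b ^ θ) := by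
        linear_combination (-(a ^ (1 - θ) * b ^ θ)) * e
    _ ≤ _ := h.trans_eq (by ring)

/-- If `x` is bounded by all the weighted arithmetic means, then it is bounded by the geometric
mean. -/
theorem le_geom_mean {θ : ℝ} (hθ : 0 < θ) (hθ₁ : θ < 1) {x a b m : ℝ} (ham : a ≤ m) (hm : 0 ≤ m)
    (hb : 0 ≤ b) (hbm : m = 0 → b = 0)
    (h : ∀ s : ℝ, 0 < s → x ≤ (1 - θ) * s ^ θ * a + θ * s ^ (θ - 1) * b) :
    x ≤ m ^ (1 - θ) * b ^ θ := by
  have h1 : 0 < 1 - θ := sub_pos.2 hθ₁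
  rcases hb.eq_or_lt with rfl | hb
  · rw [Real.zero_rpow hθ.ne', mul_zero]
    have hc : Continuous fun s : ℝ => (1 - θ) * s ^ θ * a :=
      (continuous_const.mul (Real.continuous_rpow_const hθ.le)).mul continuous_const
    have ht : Filter.Tendsto (fun s : ℝ => (1 - θ) * s ^ θ * a) (nhdsWithin 0 (Set.Ioi 0))
        (nhds 0) := by
      simpa [Real.zero_rpow hθ.ne'] using (hc.tendsto 0).mono_left nhdsWithin_le_nhds
    exact ge_of_tendsto ht (eventually_mem_nhdsWithin.mono fun s hs => by simpa using h s hs)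
  · have hm0 : 0 < m := hm.lt_of_ne fun h => hb.ne' (hbm h.symm)
    -- With `m` in place of `a`, the parameter `s = b / m` gives equality in Young's inequality.
    refine (h (b / m) (by positivity)).trans ?_
    have e1 : (b / m) ^ θ * m = m ^ (1 - θ) * b ^ θ := by
      rw [Real.div_rpow hb.le hm, Real.rpow_sub hm0, Real.rpow_one]; field_simp
    have e2 : (b / m) ^ (θ - 1) * b = m ^ (1 - θ) * b ^ θ := by
      rw [Real.div_rpow hb.le hm, Real.rpow_sub hm0, Real.rpow_one, Real.rpow_sub hb,
        Real.rpow_one, Real.rpow_sub hm0, Real.rpow_one]; field_simp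
    have h2 : (1 - θ) * (b / m) ^ θ * a ≤ (1 - θ) * (b / m) ^ θ * m := by gcongr
    calc _ ≤ (1 - θ) * ((b / m) ^ θ * m) + θ * ((b / m) ^ (θ - 1) * b) := by linarith
      _ = _ := by rw [e1, e2]; ring

section Product

variable {X : Type u} [BanachLattice X]

/-- `|x| ≤ a^{1-θ} b^θ`, expressed through weighted arithmetic means. -/
def GeomBound (θ : ℝ) (a b x : X) : Prop :=
  ∀ t : ℝ, 0 < t → |x| ≤ ((1 - θ) * t ^ θ) • a + (θ * t ^ (θ - 1)) • b

/-- The numbers `c` such that `|x| ≤ a^{1-θ} b^θ` for some `a, b` with `‖a‖ ≤ c` and `ρ b ≤ c`. -/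
def geomSet (θ : ℝ) (ρ : X → ℝ) (x : X) : Set ℝ :=
  {c | 0 ≤ c ∧ ∃ a b : X, 0 ≤ a ∧ 0 ≤ b ∧ ‖a‖ ≤ c ∧ ρ b ≤ c ∧ GeomBound θ a b x}

/-- Functionals which behave like bounded lattice seminorms on the positive cone. -/
structure IsConeSeminorm (ρ : X → ℝ) (K : ℝ) : Prop where
  nonneg : ∀ b, 0 ≤ ρ b
  le_norm : ∀ b, ρ b ≤ K * ‖b‖
  add_le : ∀ b c, 0 ≤ b → 0 ≤ c → ρ (b + c) ≤ ρ b + ρ c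
  smul_le : ∀ c : ℝ, 0 ≤ c → ∀ b, ρ (c • b) ≤ c * ρ b

variable {θ : ℝ} {ρ : X → ℝ} {K : ℝ}

theorem bddBelow_geomSet (x : X) : BddBelow (geomSet θ ρ x) := ⟨0, fun _ h => h.1⟩

theorem mem_geomSet_norm (hρ : IsConeSeminorm ρ K) (hK : 0 ≤ K) (hθ : 0 < θ) (hθ₁ : θ < 1)
    (x : X) : (1 + K) * ‖x‖ ∈ geomSet θ ρ x := by
  have h0 := norm_nonneg x
  refine ⟨by positivity, |x|, |x|, abs_nonneg x, abs_nonneg x, ?_, ?_, fun t ht => ?_⟩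
  · rw [norm_abs_eq_norm]; nlinarith
  · refine (hρ.le_norm _).trans ?_
    rw [norm_abs_eq_norm]; nlinarith
  · rw [← add_smul]
    have := young_rpow hθ hθ₁ zero_le_one zero_le_one ht
    simp only [Real.one_rpow, mul_one] at this
    exact le_smul_of_one_le_left (abs_nonneg x) this

theorem zero_mem_geomSet (hρ : IsConeSeminorm ρ K) : (0 : ℝ) ∈ geomSet θ ρ (0 : X) := by
  refine ⟨le_rfl, 0, 0, le_rfl, le_rfl, by simp, ?_, fun t ht => by simp⟩
  simpa using hρ.le_norm 0

theorem add_mem_geomSet (hρ : IsConeSeminorm ρ K) {x y : X} {c d : ℝ} (hc : c ∈ geomSet θ ρ x)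
    (hd : d ∈ geomSet θ ρ y) : c + d ∈ geomSet θ ρ (x + y) := by
  obtain ⟨hc0, a, b, ha, hb, ha', hb', h⟩ := hc
  obtain ⟨hd0, a₂, b₂, ha₂, hb₂, ha₂', hb₂', h₂⟩ := hd
  refine ⟨add_nonneg hc0 hd0, a + a₂, b + b₂, add_nonneg ha ha₂, add_nonneg hb hb₂,
    (norm_add_le _ _).trans (add_le_add ha' ha₂'),
    (hρ.add_le _ _ hb hb₂).trans (add_le_add hb' hb₂'), fun t ht => ?_⟩
  refine (abs_add_le _ _).trans ((add_le_add (h t ht) (h₂ t ht)).trans (le_of_eq ?_))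
  module

theorem smul_mem_geomSet (hρ : IsConeSeminorm ρ K) {x : X} {c : ℝ} (r : ℝ)
    (hc : c ∈ geomSet θ ρ x) : |r| * c ∈ geomSet θ ρ (r • x) := by
  obtain ⟨hc0, a, b, ha, hb, ha', hb', h⟩ := hc
  have hr := abs_nonneg r
  refine ⟨by positivity, |r| • a, |r| • b, smul_nonneg hr ha, smul_nonneg hr hb, ?_,
    (hρ.smul_le _ hr b).trans (by gcongr), fun t ht => ?_⟩
  · rw [norm_smul, Real.norm_of_nonneg hr]; gcongr
  · refine (abs_smul_le_of_abs_le le_rfl x).trans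
      ((smul_le_smul_of_nonneg_left (h t ht) hr).trans (le_of_eq ?_))
    module

theorem geomSet_mono {x y : X} (hxy : |x| ≤ |y|) : geomSet θ ρ y ⊆ geomSet θ ρ x :=
  fun _ ⟨hc, a, b, ha, hb, ha', hb', h⟩ =>
    ⟨hc, a, b, ha, hb, ha', hb', fun t ht => hxy.trans (h t ht)⟩

theorem mem_geomSet_of_le {x : X} {c d : ℝ} (hc : c ∈ geomSet θ ρ x) (hcd : c ≤ d) :
    d ∈ geomSet θ ρ x := by
  obtain ⟨hc, a, b, ha, hb, ha', hb', h⟩ := hc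
  exact ⟨hc.trans hcd, a, b, ha, hb, ha'.trans hcd, hb'.trans hcd, h⟩

/-- The seminorm of the Calderón product of `X` and the space seminormed by `ρ`. -/
noncomputable def geomSeminorm (hρ : IsConeSeminorm ρ K) (hK : 0 ≤ K) (hθ : 0 < θ)
    (hθ₁ : θ < 1) : Seminorm ℝ X :=
  Seminorm.ofSMulLE (fun x => sInf (geomSet θ ρ x))
    (le_antisymm (csInf_le (bddBelow_geomSet _) (zero_mem_geomSet hρ))
      (Real.sInf_nonneg fun _ h => h.1))
    (fun x y => by
      rw [← csInf_add ⟨_, mem_geomSet_norm hρ hK hθ hθ₁ x⟩ (bddBelow_geomSet x)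
        ⟨_, mem_geomSet_norm hρ hK hθ hθ₁ y⟩ (bddBelow_geomSet y)]
      refine csInf_le_csInf (bddBelow_geomSet _)
        (Set.Nonempty.add ⟨_, mem_geomSet_norm hρ hK hθ hθ₁ x⟩
          ⟨_, mem_geomSet_norm hρ hK hθ hθ₁ y⟩) ?_
      rintro _ ⟨c, hc, d, hd, rfl⟩
      exact add_mem_geomSet hρ hc hd)
    (fun r x => by
      rw [Real.norm_eq_abs, ← smul_eq_mul, ← Real.sInf_smul_of_nonneg (abs_nonneg r)]
      refine csInf_le_csInf (bddBelow_geomSet _)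
        (Set.Nonempty.smul_set ⟨_, mem_geomSet_norm hρ hK hθ hθ₁ x⟩) ?_
      rintro _ ⟨c, hc, rfl⟩
      exact smul_mem_geomSet hρ r hc)

theorem geomSeminorm_mono (hρ : IsConeSeminorm ρ K) (hK : 0 ≤ K) (hθ : 0 < θ) (hθ₁ : θ < 1)
    {x y : X} (hxy : |x| ≤ |y|) : geomSeminorm hρ hK hθ hθ₁ x ≤ geomSeminorm hρ hK hθ hθ₁ y :=
  csInf_le_csInf (bddBelow_geomSet _) ⟨_, mem_geomSet_norm hρ hK hθ hθ₁ y⟩ (geomSet_mono hxy)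

theorem geomSeminorm_le (hρ : IsConeSeminorm ρ K) (hK : 0 ≤ K) (hθ : 0 < θ) (hθ₁ : θ < 1) {x : X}
    {c : ℝ} (hc : c ∈ geomSet θ ρ x) : geomSeminorm hρ hK hθ hθ₁ x ≤ c :=
  csInf_le (bddBelow_geomSet _) hc

theorem mem_geomSet_of_lt (hρ : IsConeSeminorm ρ K) (hK : 0 ≤ K) (hθ : 0 < θ) (hθ₁ : θ < 1) {x : X}
    {c : ℝ} (hc : geomSeminorm hρ hK hθ hθ₁ x < c) : c ∈ geomSet θ ρ x := by
  obtain ⟨d, hd, hdc⟩ := exists_lt_of_csInf_lt ⟨_, mem_geomSet_norm hρ hK hθ hθ₁ x⟩ hc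
  exact mem_geomSet_of_le hd hdc.le

/-- `GeomBound` is invariant under `(a, b) ↦ (λ^θ a, λ^{θ-1} b)`, by the substitution `t ↦ λ t`.
Taking `λ = ν / μ` balances the bounds `μ` and `ν`; then `ν` decreases to `ρ b`, which may be zero.
-/
theorem geomSeminorm_le_mul (hρ : IsConeSeminorm ρ K) (hK : 0 ≤ K) (hθ : 0 < θ) (hθ₁ : θ < 1)
    {a b x : X} (ha : 0 ≤ a) (hb : 0 ≤ b) (h : GeomBound θ a b x) {μ : ℝ} (hμ : 0 < μ)
    (haμ : ‖a‖ ≤ μ) : geomSeminorm hρ hK hθ hθ₁ x ≤ μ ^ (1 - θ) * ρ b ^ θ := by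
  have key : ∀ ν : ℝ, ρ b < ν → geomSeminorm hρ hK hθ hθ₁ x ≤ μ ^ (1 - θ) * ν ^ θ := fun ν hν => by
    have hν0 := (hρ.nonneg b).trans_lt hν
    have e1 : (ν / μ) ^ θ * μ = μ ^ (1 - θ) * ν ^ θ := by
      rw [Real.div_rpow hν0.le hμ.le, Real.rpow_sub hμ, Real.rpow_one]; field_simp
    have e2 : (ν / μ) ^ (θ - 1) * ν = μ ^ (1 - θ) * ν ^ θ := by
      rw [Real.div_rpow hν0.le hμ.le, Real.rpow_sub hμ, Real.rpow_one, Real.rpow_sub hν0,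
        Real.rpow_one, Real.rpow_sub hμ, Real.rpow_one]; field_simp
    have p1 : (0 : ℝ) ≤ (ν / μ) ^ θ := by positivity
    have p2 : (0 : ℝ) ≤ (ν / μ) ^ (θ - 1) := by positivity
    refine geomSeminorm_le hρ hK hθ hθ₁ ⟨by positivity, (ν / μ) ^ θ • a, (ν / μ) ^ (θ - 1) • b,
      smul_nonneg p1 ha, smul_nonneg p2 hb, ?_, ?_, fun t ht => ?_⟩
    · rw [norm_smul, Real.norm_of_nonneg p1, ← e1]; gcongr
    · rw [← e2]
      exact (hρ.smul_le _ p2 b).trans (by gcongr)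
    · refine (h (t * (ν / μ)) (by positivity)).trans (le_of_eq ?_)
      rw [Real.mul_rpow ht.le (by positivity), Real.mul_rpow ht.le (by positivity)]
      module
  have hc : Continuous fun ν : ℝ => μ ^ (1 - θ) * ν ^ θ :=
    continuous_const.mul (Real.continuous_rpow_const hθ.le)
  exact ge_of_tendsto ((hc.tendsto (ρ b)).mono_left (nhdsWithin_le_nhds (s := Set.Ioi (ρ b))))
    (eventually_mem_nhdsWithin.mono key)

/-- Factorization through weighted geometric means, compatible with `ℓ_q`-sums. -/
theorem exists_geomBound_tuple (hθ : 0 < θ) (hθ₁ : θ < 1) {q₂ qbar : ℝ≥0∞} (hq₂ : 1 ≤ q₂)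
    (hqbar : 1 ≤ qbar) {n : ℕ}
    (hpow : ∀ s : Fin n → ℝ, ‖WithLp.toLp q₂ fun i => |s i| ^ θ⁻¹‖ ≤ ‖WithLp.toLp qbar s‖ ^ θ⁻¹)
    {x : Fin n → X} {a b : X} (ha : 0 ≤ a) (hb : 0 ≤ b)
    (h : GeomBound θ a b (kc x fun t => ‖WithLp.toLp qbar t‖)) {ε : ℝ} (hε : 0 < ε) :
    ∃ y : Fin n → X, (∀ i, 0 ≤ y i) ∧ kc y (fun t => ‖WithLp.toLp q₂ t‖) ≤ b ∧
      ∀ i, GeomBound θ (a + ε • b) (y i) (x i) := by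
  have hθ' : 0 < θ⁻¹ := inv_pos.2 hθ
  let w : Bool ⊕ Fin n → X := Sum.elim (fun c => cond c a b) x
  -- Replacing `a` by `a + ε b` bounds `b` by a multiple of the denominator, which makes the
  -- negative power of `a` harmless.
  let m : (Bool ⊕ Fin n → ℝ) → ℝ := fun t => |t (.inl true)| + ε * |t (.inl false)|
  have hN := IsHom.lpNorm (ι := Fin n) hq₂
  have hNb := IsHom.lpNorm (ι := Fin n) hqbar
  have hNr : IsHom fun t : Bool ⊕ Fin n → ℝ => ‖WithLp.toLp qbar fun i => t (.inr i)‖ :=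
    hNb.comp fun i => IsHom.coord _
  have hm : IsHom m := (IsHom.coord _).abs.add ((IsHom.coord _).abs.const_mul ε)
  have hm0 : ∀ t, 0 ≤ m t := fun t => by positivity
  let C : ℝ := (ε⁻¹) ^ θ
  have hC : 0 < C := by positivity
  -- This is `m^{1-1/θ} |xᵢ|^{1/θ}`. The truncation at `C * m` gives continuity where `m` vanishes
  -- and is inactive on the spectrum, because there `|xᵢ| ≤ m^{1-θ} b^θ ≤ ε^{-θ} m`.
  let g : Fin n → (Bool ⊕ Fin n → ℝ) → ℝ := fun i t =>
    m t * (min |t (.inr i)| (C * m t) / m t) ^ θ⁻¹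
  have hmin0 : ∀ i t, 0 ≤ min |t (.inr i)| (C * m t) / m t := fun i t =>
    div_nonneg (le_min (abs_nonneg _) (mul_nonneg hC.le (hm0 t))) (hm0 t)
  have hg0 : ∀ i t, 0 ≤ g i t := fun i t => mul_nonneg (hm0 t) (Real.rpow_nonneg (hmin0 i t) _)
  have hg : ∀ i, IsHom (g i) := fun i => by
    refine IsHom.of_bound hm.1 (C := C ^ θ⁻¹) (fun t => ?_) ?_ (fun c hc t => ?_) hm.map_zero
    · rw [abs_of_nonneg (hg0 i t), mul_comm (C ^ θ⁻¹)]
      refine mul_le_mul_of_nonneg_left (Real.rpow_le_rpow (hmin0 i t) ?_ hθ'.le) (hm0 t)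
      exact div_le_of_le_mul₀ (hm0 t) hC.le (min_le_right _ _)
    · refine hm.1.continuousOn.mul (ContinuousOn.rpow_const (ContinuousOn.div ?_
        hm.1.continuousOn fun t ht => ht) fun t _ => Or.inr hθ'.le)
      exact ((continuous_apply _).abs.min (continuous_const.mul hm.1)).continuousOn
    · simp only [g]
      rw [hm.2 c hc.le]
      simp only [Pi.smul_apply, smul_eq_mul, abs_mul, abs_of_pos hc]
      rw [mul_left_comm C, ← mul_min_of_nonneg _ _ hc.le, mul_div_mul_left _ _ hc.ne']
      ring
  have hpos : ∀ (c : Bool), ∀ t ∈ spec w, 0 ≤ t (.inl c) := fun c t ht =>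
    le_on_spec IsHom.zero (IsHom.coord _) (by
      rw [kc_zero, kc_coord]
      cases c
      · exact hb
      · exact ha) ht
  have hmeq : ∀ t ∈ spec w, m t = t (.inl true) + ε * t (.inl false) := fun t ht => by
    simp only [m]
    rw [abs_of_nonneg (hpos _ t ht), abs_of_nonneg (hpos _ t ht)]
  have hgm : ∀ t ∈ spec w, ‖WithLp.toLp qbar fun i => t (.inr i)‖ ≤
      m t ^ (1 - θ) * t (.inl false) ^ θ := fun t ht => by
    have p1 := hpos true t ht
    have p2 := hpos false t ht
    have p3 := mul_nonneg hε.le p2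
    refine le_geom_mean hθ hθ₁ (a := t (.inl true)) ?_ (hm0 t) p2 (fun h0 => ?_) fun s hs => ?_
    · rw [hmeq t ht]; linarith
    · rw [hmeq t ht] at h0
      have : ε * t (.inl false) = 0 := by linarith
      exact (mul_eq_zero.1 this).resolve_left hε.ne'
    · refine le_on_spec hNr (((IsHom.coord _).const_mul _).add ((IsHom.coord _).const_mul _)) ?_ ht
      rw [← kc_reindex w Sum.inr hNb, kc_add w ((IsHom.coord _).const_mul _)
        ((IsHom.coord _).const_mul _), kc_const_mul w _ (IsHom.coord _),
        kc_const_mul w _ (IsHom.coord _), kc_coord, kc_coord]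
      exact (le_abs_self _).trans (h s hs)
  have hmin : ∀ i, ∀ t ∈ spec w, min |t (.inr i)| (C * m t) = |t (.inr i)| := fun i t ht => by
    refine min_eq_left ?_
    refine ((abs_le_lpNorm hqbar (fun i => t (.inr i)) i).trans (hgm t ht)).trans ?_
    rcases (hm0 t).eq_or_lt with h0 | h0
    · rw [← h0, Real.zero_rpow (sub_pos.2 hθ₁).ne', zero_mul, mul_zero]
    · have p1 := hpos true t ht
      have p2 := hpos false t ht
      have h1 : t (.inl false) ≤ ε⁻¹ * m t := by
        rw [hmeq t ht, le_inv_mul_iff₀ hε]; linarith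
      calc m t ^ (1 - θ) * t (.inl false) ^ θ ≤ m t ^ (1 - θ) * (ε⁻¹ * m t) ^ θ := by gcongr
        _ = C * (m t ^ (1 - θ) * m t ^ θ) := by
          rw [Real.mul_rpow (by positivity) h0.le]; ring
        _ = C * m t := by rw [← Real.rpow_add h0, sub_add_cancel, Real.rpow_one]
  have hgt : ∀ i, ∀ t ∈ spec w, g i t = m t * (|t (.inr i)| / m t) ^ θ⁻¹ :=
    fun i t ht => by simp only [g]; rw [hmin i t ht]
  have ht0 : ∀ i, ∀ t ∈ spec w, m t = 0 → t (.inr i) = 0 := fun i t ht h0 => by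
    have := (abs_le_lpNorm hqbar (fun i => t (.inr i)) i).trans (hgm t ht)
    rw [h0, Real.zero_rpow (sub_pos.2 hθ₁).ne', zero_mul] at this
    simpa using this
  refine ⟨fun i => kc w (g i), fun i => ?_, ?_, fun i s hs => ?_⟩
  · rw [← kc_zero w]
    exact kc_mono w IsHom.zero (hg i) (hg0 i)
  · rw [kc_comp w hg hN, show b = w (.inl false) from rfl, ← kc_coord w (.inl false)]
    refine kc_le (hN.comp hg) (IsHom.coord _) fun t ht => ?_
    rcases (hm0 t).eq_or_lt with h0 | h0
    · have : ∀ i, g i t = 0 := fun i => by simp only [g]; rw [← h0, zero_mul]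
      simp_rw [this]
      rw [show (‖WithLp.toLp q₂ fun _ : Fin n => (0 : ℝ)‖) = 0 from hN.map_zero]
      exact hpos false t ht
    · simp_rw [hgt _ t ht]
      rw [lpNorm_const_mul hq₂ h0.le]
      have e1 : ∀ i, |t (.inr i)| / m t = |(m t)⁻¹ * t (.inr i)| := fun i => by
        rw [abs_mul, abs_of_pos (inv_pos.2 h0)]; ring
      simp_rw [e1]
      have h1 := hpow fun i => (m t)⁻¹ * t (.inr i)
      rw [lpNorm_const_mul hqbar (inv_pos.2 h0).le fun i => t (.inr i)] at h1
      have : Fact (1 ≤ qbar) := ⟨hqbar⟩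
      have p2 := hpos false t ht
      have h2 : (m t)⁻¹ * ‖WithLp.toLp qbar fun i => t (.inr i)‖ ≤ (t (.inl false) / m t) ^ θ := by
        refine (mul_le_mul_of_nonneg_left (hgm t ht) (inv_pos.2 h0).le).trans (le_of_eq ?_)
        rw [Real.div_rpow p2 h0.le, Real.rpow_sub h0, Real.rpow_one]
        field_simp
      have h3 := h1.trans (Real.rpow_le_rpow (by positivity) h2 hθ'.le)
      rw [← Real.rpow_mul (by positivity), mul_inv_cancel₀ hθ.ne', Real.rpow_one] at h3
      refine (mul_le_mul_of_nonneg_left h3 h0.le).trans (le_of_eq ?_)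
      field_simp
  · have e1 : ((1 - θ) * s ^ θ) • (a + ε • b) + (θ * s ^ (θ - 1)) • kc w (g i) =
        kc w fun t => (1 - θ) * s ^ θ * (t (.inl true) + ε * t (.inl false)) +
          θ * s ^ (θ - 1) * g i t := by
      rw [kc_add w (((IsHom.coord _).add ((IsHom.coord _).const_mul ε)).const_mul _)
        ((hg i).const_mul _), kc_const_mul w _ (hg i),
        kc_const_mul w _ ((IsHom.coord _).add ((IsHom.coord _).const_mul ε)),
        kc_add w (IsHom.coord _) ((IsHom.coord _).const_mul ε), kc_const_mul w _ (IsHom.coord _),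
        kc_coord, kc_coord]
      rfl
    rw [e1, show x i = w (.inr i) from rfl, ← kc_coord w (.inr i), ← kc_abs w (IsHom.coord _)]
    refine kc_le (IsHom.coord _).abs
      ((((IsHom.coord _).add ((IsHom.coord _).const_mul ε)).const_mul _).add
        ((hg i).const_mul _)) fun t ht => ?_
    rw [← hmeq t ht]
    refine le_trans (le_of_eq ?_) (young_rpow hθ hθ₁ (hm0 t) (hg0 i t) hs)
    rcases (hm0 t).eq_or_lt with h0 | h0
    · rw [ht0 i t ht h0.symm, ← h0, Real.zero_rpow (sub_pos.2 hθ₁).ne', zero_mul, abs_zero]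
    · rw [hgt i t ht, Real.mul_rpow h0.le (by positivity), ← Real.rpow_mul (by positivity),
        inv_mul_cancel₀ hθ.ne', Real.rpow_one, ← mul_assoc, ← Real.rpow_add h0, sub_add_cancel,
        Real.rpow_one]
      field_simp

/-- A common factor `a` serves all `x i`, and the other factors `y i` have `ℓ_{q₂}`-sum below `b`.
Since `q = θ r`, the `ℓ_r`-norm of `ρ(yᵢ)^θ` is the `θ`-th power of an `ℓ_q`-norm, which `hsup`
bounds by `ρ b`. -/
theorem lpNorm_geomSeminorm_le (hρ : IsConeSeminorm ρ K) (hK : 0 ≤ K) (hθ : 0 < θ) (hθ₁ : θ < 1)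
    {q q₂ r qbar : ℝ≥0∞} (hq : 1 ≤ q) (hq' : q ≠ ∞) (hr : 1 ≤ r) (hr' : r ≠ ∞)
    (hqr : q.toReal = θ * r.toReal) (hq₂ : 1 ≤ q₂) (hqbar : 1 ≤ qbar) {n : ℕ}
    (hpow : ∀ s : Fin n → ℝ, ‖WithLp.toLp q₂ fun i => |s i| ^ θ⁻¹‖ ≤ ‖WithLp.toLp qbar s‖ ^ θ⁻¹)
    (hsup : ∀ (b : Fin n → X) (c : X), (∀ i, 0 ≤ b i) →
      kc b (fun t => ‖WithLp.toLp q₂ t‖) ≤ |c| → ‖WithLp.toLp q fun i => ρ (b i)‖ ≤ ρ c)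
    (x : Fin n → X) : ‖WithLp.toLp r fun i => geomSeminorm hρ hK hθ hθ₁ (x i)‖ ≤
      geomSeminorm hρ hK hθ hθ₁ (kc x fun t => ‖WithLp.toLp qbar t‖) := by
  have h0 : 0 < q.toReal := ENNReal.toReal_pos (zero_lt_one.trans_le hq).ne' hq'
  have h0r : 0 < r.toReal := ENNReal.toReal_pos (zero_lt_one.trans_le hr).ne' hr'
  refine le_csInf ⟨_, mem_geomSet_norm hρ hK hθ hθ₁ _⟩ ?_
  rintro c ⟨hc, a, b, ha, hb, hac, hbc, h⟩
  -- The term `ε ‖b‖` pays for passing from `a` to `a + ε b`; the extra `ε` keeps `μ` positive when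
  -- `c = 0`.
  have key : ∀ ε : ℝ, 0 < ε → ‖WithLp.toLp r fun i => geomSeminorm hρ hK hθ hθ₁ (x i)‖ ≤
      c + ε * (‖b‖ + 1) := fun ε hε => by
    obtain ⟨y, hy, hyb, hxy⟩ := exists_geomBound_tuple hθ hθ₁ hq₂ hqbar hpow ha hb h hε
    set μ := c + ε * (‖b‖ + 1) with hμ
    have hμ0 : 0 < μ := by positivity
    have hμa : ‖a + ε • b‖ ≤ μ := by
      refine (norm_add_le _ _).trans ?_
      rw [norm_smul, Real.norm_of_nonneg hε.le]
      linarith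
    have hN : ∀ i, geomSeminorm hρ hK hθ hθ₁ (x i) ≤ μ ^ (1 - θ) * ρ (y i) ^ θ := fun i =>
      geomSeminorm_le_mul hρ hK hθ hθ₁ (add_nonneg ha (smul_nonneg hε.le hb)) (hy i) (hxy i) hμ0 hμa
    have hs := hsup y b hy (hyb.trans (le_abs_self b))
    have hρ0 := fun i => hρ.nonneg (y i)
    have e : ‖WithLp.toLp r fun i => ρ (y i) ^ θ‖ = ‖WithLp.toLp q fun i => ρ (y i)‖ ^ θ := by
      rw [PiLp.norm_eq_sum h0, PiLp.norm_eq_sum h0r,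
        ← Real.rpow_mul (Finset.sum_nonneg fun i _ => by positivity)]
      have e1 : 1 / q.toReal * θ = 1 / r.toReal := by rw [hqr]; field_simp
      rw [e1]
      congr 1
      refine Finset.sum_congr rfl fun i _ => ?_
      simp only
      rw [Real.norm_of_nonneg (Real.rpow_nonneg (hρ0 i) θ), Real.norm_of_nonneg (hρ0 i),
        ← Real.rpow_mul (hρ0 i), hqr]
    have : Fact (1 ≤ q) := ⟨hq⟩
    calc ‖WithLp.toLp r fun i => geomSeminorm hρ hK hθ hθ₁ (x i)‖
        ≤ ‖WithLp.toLp r fun i => μ ^ (1 - θ) * ρ (y i) ^ θ‖ := lpNorm_mono hr fun i => by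
          rw [abs_of_nonneg (apply_nonneg _ _), abs_of_nonneg
            (mul_nonneg (Real.rpow_nonneg hμ0.le _) (Real.rpow_nonneg (hρ0 i) _))]
          exact hN i
      _ = μ ^ (1 - θ) * ‖WithLp.toLp q fun i => ρ (y i)‖ ^ θ := by
        rw [lpNorm_const_mul hr (by positivity), e]
      _ ≤ μ ^ (1 - θ) * μ ^ θ := by
        refine mul_le_mul_of_nonneg_left (Real.rpow_le_rpow (norm_nonneg _) ?_ hθ.le)
          (by positivity)
        have : 0 ≤ ε * (‖b‖ + 1) := by positivity
        linarith
      _ = μ := by rw [← Real.rpow_add hμ0, sub_add_cancel, Real.rpow_one]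
  refine le_of_forall_pos_le_add fun δ hδ => (key (δ / (‖b‖ + 1)) (by positivity)).trans ?_
  rw [div_mul_cancel₀ _ (by positivity : ‖b‖ + 1 ≠ 0)]

end Product

/-! ### Concavity of completions, and factorization through ideals. -/

theorem exists_add_of_abs_le_add {X : Type*} [BanachLattice X] {x a b : X} (ha : 0 ≤ a)
    (hb : 0 ≤ b) (h : |x| ≤ a + b) : ∃ y z, x = y + z ∧ |y| ≤ a ∧ |z| ≤ b := by
  have hx1 : x ≤ a + b := (le_abs_self x).trans h
  have hx2 : -x ≤ a + b := (neg_le_abs x).trans h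
  have haa : -a ≤ a := (neg_nonpos.2 ha).trans ha
  -- The first piece is the truncation of `x` to `[-a, a]`.
  refine ⟨(x ⊓ a) ⊔ -a, x - ((x ⊓ a) ⊔ -a), (add_sub_cancel _ _).symm, ?_, ?_⟩
  · refine sup_le (sup_le inf_le_right haa) ?_
    rw [neg_le]
    exact le_sup_right
  · refine sup_le ?_ ?_
    · rw [sub_le_comm]
      refine le_sup_of_le_left (le_inf (sub_le_self x hb) ?_)
      exact sub_le_iff_le_add.2 hx1
    · rw [neg_sub, sub_le_iff_le_add]
      refine sup_le (inf_le_left.trans (le_add_of_nonneg_left hb)) ?_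
      rw [neg_le_iff_add_nonneg]
      have := add_le_add_left hx2 x
      rw [neg_add_cancel] at this
      exact this.trans_eq (by abel)

theorem isClosed_concave {Z : Type*} [BanachLattice Z] {r qbar : ℝ≥0∞} (hr : 1 ≤ r)
    (hqbar : 1 ≤ qbar) (n : ℕ) : IsClosed {z : Fin n → Z |
      ‖WithLp.toLp r fun i => ‖z i‖‖ ≤ ‖kc z fun t => ‖WithLp.toLp qbar t‖‖} := by
  have : Fact (1 ≤ r) := ⟨hr⟩
  refine isClosed_le ?_ (continuous_kc_lpNorm hqbar).norm
  exact (IsHom.lpNorm (ι := Fin n) hr).1.comp (by fun_prop)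

theorem isConcaveLattice_of_denseRange {X Z : Type*} [BanachLattice X] [BanachLattice Z]
    {Ψ : X →L[ℝ] Z} (hΨ : IsClassD Ψ) {r qbar : ℝ≥0∞} (hr : 1 ≤ r) (hqbar : 1 ≤ qbar)
    (h : ∀ (n : ℕ) (x : Fin n → X), ‖WithLp.toLp r fun i => ‖Ψ (x i)‖‖ ≤
      ‖Ψ (kc x fun t => ‖WithLp.toLp qbar t‖)‖) : IsConcaveLattice r qbar Z := by
  refine ⟨1, le_rfl, fun n z => ?_⟩
  rw [one_mul, latticeLpSum_eq_kc hqbar]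
  have hd : DenseRange fun x : Fin n → X => fun i => Ψ (x i) :=
    DenseRange.piMap fun _ => hΨ.denseRange
  refine hd.induction_on (p := fun z : Fin n → Z => ‖WithLp.toLp r fun i => ‖z i‖‖ ≤
    ‖kc z fun t => ‖WithLp.toLp qbar t‖‖) z (isClosed_concave hr hqbar n) fun x => ?_
  rw [← kc_map hΨ.latticeHom x (IsHom.lpNorm hqbar)]
  exact h n x

theorem isConcaveLattice_top {X : Type*} [BanachLattice X] {qbar : ℝ≥0∞} (hqbar : 1 ≤ qbar) :
    IsConcaveLattice ∞ qbar X := by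
  refine ⟨1, le_rfl, fun n x => ?_⟩
  rw [one_mul, latticeLpSum_eq_kc hqbar, PiLp.norm_toLp, pi_norm_le_iff_of_nonneg (norm_nonneg _)]
  intro i
  rw [norm_norm]
  refine norm_le_norm_of_abs_le_abs ((abs_le_kc_lpNorm hqbar x i).trans (le_abs_self _))

/-- An operator mapping balls into multiples of a solid ball factors through the ideal. -/
theorem exists_factor {X Z W Y : Type*} [BanachLattice X] [BanachLattice Z] [BanachLattice W]
    [BanachLattice Y] {T : X →L[ℝ] Y} {Ψ : X →L[ℝ] Z} (hΨ : IsClassD Ψ) {Φ : W →L[ℝ] Y}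
    (hΦ : IsClassC Φ) {B : Set Y}
    (hball : ∀ r : ℝ, 0 < r → ∀ w, ‖w‖ ≤ r ↔ r⁻¹ • Φ w ∈ B)
    (hrange : ∀ r : ℝ, 0 < r → ∀ y, r⁻¹ • y ∈ B → ∃ w, Φ w = y)
    {C : ℝ} (hC : 0 < C) (hT : ∀ x (r : ℝ), ‖Ψ x‖ < r → (C * r)⁻¹ • T x ∈ B) :
    ∃ S : Z →L[ℝ] W, T = Φ ∘L S ∘L Ψ := by
  have hex : ∀ x, ∃ w, Φ w = T x := fun x =>
    hrange (C * (‖Ψ x‖ + 1)) (by positivity) _ (hT x _ (lt_add_one _))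
  choose S₀ hS₀ using hex
  let S₁ : X →ₗ[ℝ] W :=
    { toFun := S₀
      map_add' := fun x y => hΦ.injective (by simp [hS₀])
      map_smul' := fun c x => hΦ.injective (by simp [hS₀]) }
  have hS₁ : ∀ x, ‖S₁ x‖ ≤ C * ‖Ψ.toLinearMap x‖ := fun x => by
    refine le_of_forall_pos_le_add fun ε hε => ?_
    have hr : ‖Ψ x‖ < ‖Ψ x‖ + ε / C := by
      have : 0 < ε / C := by positivity
      linarith
    have h0 : 0 < C * (‖Ψ x‖ + ε / C) := by positivity
    have h1 := (hball _ h0 (S₁ x)).2 (by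
      rw [show Φ (S₁ x) = T x from hS₀ x]; exact hT x _ hr)
    refine h1.trans_eq ?_
    rw [mul_add, mul_div_cancel₀ _ hC.ne']
    rfl
  -- `S₁` is bounded by the norm of `Ψ x`, so it vanishes on the kernel of `Ψ` and extends from the
  -- dense range.
  refine ⟨S₁.extendOfNorm Ψ.toLinearMap, ?_⟩
  ext x
  have h1 := LinearMap.extendOfNorm_eq (f := S₁) (e := Ψ.toLinearMap) hΨ.denseRange ⟨C, hS₁⟩ x
  change T x = Φ (S₁.extendOfNorm Ψ.toLinearMap (Ψ.toLinearMap x))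
  rw [h1]
  exact (hS₀ x).symm

theorem lpNorm_rpow_eq {ι : Type*} [Fintype ι] {θ : ℝ} (hθ : 0 < θ) {q r : ℝ≥0∞} (hq : 1 ≤ q)
    (hq' : q ≠ ∞) (hr : 1 ≤ r) (hr' : r ≠ ∞) (hqr : q.toReal = θ * r.toReal) (s : ι → ℝ) :
    ‖WithLp.toLp q fun i => |s i| ^ θ⁻¹‖ = ‖WithLp.toLp r s‖ ^ θ⁻¹ := by
  have h0 : 0 < q.toReal := ENNReal.toReal_pos (zero_lt_one.trans_le hq).ne' hq'
  have h0r : 0 < r.toReal := ENNReal.toReal_pos (zero_lt_one.trans_le hr).ne' hr'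
  rw [PiLp.norm_eq_sum h0, PiLp.norm_eq_sum h0r,
    ← Real.rpow_mul (Finset.sum_nonneg fun i _ => by positivity)]
  have e1 : 1 / r.toReal * θ⁻¹ = 1 / q.toReal := by rw [hqr]; field_simp
  rw [e1]
  congr 1
  refine Finset.sum_congr rfl fun i _ => ?_
  simp only
  rw [Real.norm_of_nonneg (by positivity), ← Real.rpow_mul (abs_nonneg _), hqr,
    inv_mul_cancel_left₀ hθ.ne', Real.norm_eq_abs]

/-- Each `|sᵢ|` is at most the sum `S`, so `|sᵢ|^{1/θ} ≤ |sᵢ| S^{1/θ-1}`. This is why the second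
exponent may remain one under interpolation. -/
theorem lpNorm_one_rpow_le {ι : Type*} [Fintype ι] {θ : ℝ} (hθ : 0 < θ) (hθ₁ : θ < 1)
    (s : ι → ℝ) :
    ‖WithLp.toLp (1 : ℝ≥0∞) fun i => |s i| ^ θ⁻¹‖ ≤ ‖WithLp.toLp (1 : ℝ≥0∞) s‖ ^ θ⁻¹ := by
  have h1 : 0 ≤ θ⁻¹ - 1 := by
    have := (one_lt_inv₀ hθ).2 hθ₁
    linarith
  rw [PiLp.norm_eq_of_L1, PiLp.norm_eq_of_L1]
  simp only [Real.norm_eq_abs]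
  have hpow : ∀ a : ℝ, 0 ≤ a → a ^ θ⁻¹ = a * a ^ (θ⁻¹ - 1) := fun a ha => by
    rcases ha.eq_or_lt with rfl | ha
    · rw [zero_mul, Real.zero_rpow (inv_pos.2 hθ).ne']
    · rw [Real.rpow_sub ha, Real.rpow_one]; field_simp
  rw [hpow _ (Finset.sum_nonneg fun i _ => abs_nonneg _), Finset.sum_mul]
  refine Finset.sum_le_sum fun i _ => ?_
  rw [abs_of_nonneg (Real.rpow_nonneg (abs_nonneg _) _), hpow _ (abs_nonneg _)]
  refine mul_le_mul_of_nonneg_left (Real.rpow_le_rpow (abs_nonneg _) ?_ h1) (abs_nonneg _)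
  exact Finset.single_le_sum (f := fun i => |s i|) (fun i _ => abs_nonneg _) (Finset.mem_univ i)

/-! ### Joining the two interpolation spaces. -/

section Main

variable {X : Type u} {Y : Type v} [BanachLattice X] [BanachLattice Y] {T : X →L[ℝ] Y}

/-- At each `t`, split `x` along the two terms of its Young bound. The first piece is measured by
the norm of `X`, and its image is controlled by an atom; the second is measured by `ρ`, which
controls the norm of its image in `Y`. -/
theorem map_mem_interpBall_of_geomBound {θ γ : ℝ} (hθ : 0 < θ) (hθ₁ : θ < 1) {ρ : X → ℝ}
    (hmono : ∀ b c, |b| ≤ |c| → ρ b ≤ ρ c)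
    (hsmul : ∀ c : ℝ, 0 ≤ c → ∀ b, ρ (c • b) ≤ c * ρ b) (hT : ∀ x, ‖T x‖ ≤ ρ x) {x : X} {r : ℝ}
    (hr : 0 < r) (hx : r ∈ geomSet θ ρ x) : r⁻¹ • T x ∈ interpBall θ γ T := by
  obtain ⟨-, a, b, ha, hb, har, hbr, h⟩ := hx
  rw [← map_smul]
  refine map_mem_interpBall fun t ht => ?_
  have h1 : 0 ≤ 1 - θ := (sub_pos.2 hθ₁).le
  have hr' : 0 ≤ r⁻¹ := (inv_pos.2 hr).le
  have p1 : 0 ≤ r⁻¹ * ((1 - θ) * t ^ θ) := by positivity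
  have p2 : 0 ≤ r⁻¹ * (θ * t ^ (θ - 1)) := by positivity
  have h2 : |r⁻¹ • x| ≤ (r⁻¹ * ((1 - θ) * t ^ θ)) • a + (r⁻¹ * (θ * t ^ (θ - 1))) • b := by
    rw [abs_smul_of_nonneg hr', mul_smul, mul_smul r⁻¹, ← smul_add]
    exact smul_le_smul_of_nonneg_left (h t ht) hr'
  obtain ⟨y, z, hyz, hy, hz⟩ := exists_add_of_abs_le_add (smul_nonneg p1 ha) (smul_nonneg p2 hb) h2
  refine ⟨y, z, hyz, ?_, ?_⟩
  · refine (norm_le_norm_of_abs_le_abs (hy.trans (le_abs_self _))).trans ?_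
    rw [norm_smul, Real.norm_of_nonneg p1]
    calc _ ≤ r⁻¹ * ((1 - θ) * t ^ θ) * r := by gcongr
      _ = (1 - θ) * t ^ θ := by field_simp
      _ ≤ t ^ θ := mul_le_of_le_one_left (by positivity) (by linarith)
  · refine (hT z).trans ((hmono _ _ (hz.trans (le_abs_self _))).trans ((hsmul _ p2 b).trans ?_))
    calc _ ≤ r⁻¹ * (θ * t ^ (θ - 1)) * r := by gcongr
      _ = θ * t ^ (θ - 1) := by field_simp
      _ ≤ t ^ (θ - 1) := mul_le_of_le_one_left (by positivity) hθ₁.le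

/-- No splitting is needed: `t^θ ≥ 1` for `t ≥ 1` and `t^{θ-1} ≥ 1` for `t ≤ 1`, so one summand can
take everything. -/
theorem map_mem_interpBall_of_norm_lt {θ γ : ℝ} (hθ : 0 < θ) (hθ₁ : θ < 1) {x : X} {r : ℝ}
    (hx : ‖x‖ < r) : ((‖T‖ + 1) * r)⁻¹ • T x ∈ interpBall θ γ T := by
  have hr : 0 < r := (norm_nonneg x).trans_lt hx
  have hT := norm_nonneg T
  have hC : 0 < (‖T‖ + 1) * r := by positivity
  rw [← map_smul]
  refine map_mem_interpBall fun t ht => ?_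
  rcases le_total 1 t with h1 | h1
  · refine ⟨_, 0, (add_zero _).symm, ?_, by simp; positivity⟩
    refine le_trans ?_ (Real.one_le_rpow h1 hθ.le)
    rw [norm_smul, norm_inv, Real.norm_of_nonneg hC.le, inv_mul_le_iff₀ hC]
    nlinarith
  · refine ⟨0, _, (zero_add _).symm, by simp; positivity, ?_⟩
    refine le_trans ?_ (Real.one_le_rpow_of_pos_of_le_one_of_nonpos ht h1 (by linarith))
    rw [map_smul, norm_smul, norm_inv, Real.norm_of_nonneg hC.le, inv_mul_le_iff₀ hC]
    have := T.le_opNorm x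
    nlinarith [norm_nonneg x]

/-- The interpolation space between `X` and the concavification of `T`. -/
theorem exists_concave_factor {q q₂ qθ qbar : ℝ≥0∞} {K : ℝ} (h : ConcaveBound q q₂ T K)
    (hK : 0 ≤ K) (hq : 1 ≤ q) (hq' : q ≠ ∞) {θ γ : ℝ} (hθ : 0 < θ) (hθ₁ : θ < 1) (hr : 1 ≤ qθ)
    (hr' : qθ ≠ ∞) (hqr : q.toReal = θ * qθ.toReal)
    (hqbar : (q₂ = q ∧ qbar = qθ) ∨ (q₂ = 1 ∧ qbar = 1)) :
    ∃ (Z : Type u) (_ : BanachLattice Z) (Ψ : X →L[ℝ] Z), IsConcaveLattice qθ qbar Z ∧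
      IsClassD Ψ ∧ ∀ x (r : ℝ), ‖Ψ x‖ < r → r⁻¹ • T x ∈ interpBall θ γ T := by
  obtain ⟨hq₂, hq₂', hqb, hpow⟩ : 1 ≤ q₂ ∧ q₂ ≠ ∞ ∧ 1 ≤ qbar ∧ ∀ n, ∀ s : Fin n → ℝ,
      ‖WithLp.toLp q₂ fun i => |s i| ^ θ⁻¹‖ ≤ ‖WithLp.toLp qbar s‖ ^ θ⁻¹ := by
    rcases hqbar with ⟨rfl, rfl⟩ | ⟨rfl, rfl⟩
    · exact ⟨hq, hq', hr, fun n s => (lpNorm_rpow_eq hθ hq hq' hr hr' hqr s).le⟩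
    · exact ⟨le_rfl, ENNReal.one_ne_top, le_rfl, fun n s => lpNorm_one_rpow_le hθ hθ₁ s⟩
  have hρ : IsConeSeminorm (concaveGauge q q₂ T) K :=
    { nonneg := concaveGauge_nonneg h hK hq hq₂
      le_norm := concaveGauge_le_norm h hK hq hq₂
      add_le := fun b c hb hc => concaveGauge_add_le h hK hq hq₂ hb hc
      smul_le := fun c hc b => concaveGauge_smul_le h hK hq hq₂ hc b }
  obtain ⟨Z, hZ, Ψ, hΨ, hN⟩ := exists_completion (geomSeminorm hρ hK hθ hθ₁)
    (fun x y hxy => geomSeminorm_mono hρ hK hθ hθ₁ hxy)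
    (fun x => geomSeminorm_le hρ hK hθ hθ₁ (mem_geomSet_norm hρ hK hθ hθ₁ x))
  refine ⟨Z, hZ, Ψ, isConcaveLattice_of_denseRange hΨ hr hqb fun n x => ?_, hΨ,
    fun x r hx => ?_⟩
  · simp_rw [hN]
    exact lpNorm_geomSeminorm_le hρ hK hθ hθ₁ hq hq' hr hr' hqr hq₂ hqb (hpow n)
      (fun b c hb hbc => lpNorm_concaveGauge_le h hK hq hq₂ hq' hq₂' hb hbc) x
  · rw [hN] at hx
    exact map_mem_interpBall_of_geomBound hθ hθ₁
      (fun b c hbc => concaveGauge_mono h hK hq hq₂ hbc) hρ.smul_le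
      (norm_le_concaveGauge h hK hq hq₂) ((apply_nonneg _ x).trans_lt hx)
      (mem_geomSet_of_lt hρ hK hθ hθ₁ hx)

end Main

theorem mainTheorem9 {X : Type u} {Y : Type v} [BanachLattice X] [BanachLattice Y]
    (T : X →L[ℝ] Y) (p q q₂ : ℝ≥0∞) (hp : 1 ≤ p) (hq : 1 ≤ q)
    (hconv : IsConvexOperator p ∞ T) (hconc : IsConcaveOperator q q₂ T)
    (θ : ℝ) (hθ₀ : 0 < θ) (hθ₁ : θ < 1) (pθ qθ qbar : ℝ≥0∞)
    (hpθ : 1 / pθ = ENNReal.ofReal (1 - θ) / p + ENNReal.ofReal θ)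
    (hqθ : qθ = q / ENNReal.ofReal θ)
    (hqbar : (q₂ = q ∧ qbar = qθ) ∨ (q₂ = 1 ∧ qbar = 1)) :
    ∃ (Z : Type u) (_ : BanachLattice Z) (W : Type v) (_ : BanachLattice W)
      (Φ : W →L[ℝ] Y) (Ψ : X →L[ℝ] Z) (Tθ : Z →L[ℝ] W),
      IsConcaveLattice qθ qbar Z ∧ IsConvexLattice pθ ∞ W ∧
      IsClassC Φ ∧ IsClassD Ψ ∧ T = Φ ∘L Tθ ∘L Ψ := by
  obtain ⟨K, hK, hconv⟩ := hconv
  obtain ⟨L, hL, hconc⟩ := hconc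
  have hθ' : ENNReal.ofReal θ ≠ 0 := (ENNReal.ofReal_pos.2 hθ₀).ne'
  have h1θ : 0 < 1 - θ := sub_pos.2 hθ₁
  have hpinv : p⁻¹ ≤ 1 := ENNReal.inv_le_one.2 hp
  have hpinv' : p⁻¹ ≠ ∞ := (hpinv.trans_lt ENNReal.one_lt_top).ne
  rw [one_div, ENNReal.div_eq_inv_mul] at hpθ
  have hpθ1 : 1 ≤ pθ := by
    rw [← ENNReal.inv_le_one, hpθ]
    calc p⁻¹ * ENNReal.ofReal (1 - θ) + ENNReal.ofReal θ
        ≤ 1 * ENNReal.ofReal (1 - θ) + ENNReal.ofReal θ := by gcongr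
      _ = 1 := by rw [one_mul, ← ENNReal.ofReal_add h1θ.le hθ₀.le]; simp
  have hpθtop : pθ ≠ ∞ := by
    rintro rfl
    rw [ENNReal.inv_top] at hpθ
    exact hθ' (add_eq_zero.1 hpθ.symm).2
  have hpθr : pθ.toReal * ((1 - θ) * p⁻¹.toReal + θ) = 1 := by
    have h1 := congrArg ENNReal.toReal hpθ
    rw [ENNReal.toReal_add (ENNReal.mul_ne_top hpinv' ENNReal.ofReal_ne_top) ENNReal.ofReal_ne_top,
      ENNReal.toReal_mul, ENNReal.toReal_ofReal h1θ.le, ENNReal.toReal_ofReal hθ₀.le,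
      ENNReal.toReal_inv pθ] at h1
    have h0 : pθ.toReal ≠ 0 := (ENNReal.toReal_pos (zero_lt_one.trans_le hpθ1).ne' hpθtop).ne'
    rw [mul_comm (1 - θ), ← h1, mul_inv_cancel₀ h0]
  have hB : IsSolidBall (interpBall θ p⁻¹.toReal T) :=
    isSolidBall_interpBall fun w hw => norm_supAtoms_le hp (zero_le_one.trans hK) hconv hw
  obtain ⟨W, hW, Φ, hΦ, hball, hrange⟩ := hB.exists_classC
  have hWconv := isConvexLattice_of_interpBall hΦ.latticeHom hball hθ₀ hpθ1 hpθtop hpθr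
  -- For `q = ∞` also `q_θ = ∞`, and every Banach lattice is `(∞, q̄₂)`-concave, so `X` itself
  -- serves with the identity as `Ψ`.
  rcases eq_or_ne q ∞ with rfl | hq'
  · have hqθ' : qθ = ∞ := by rw [hqθ, ENNReal.top_div_of_ne_top ENNReal.ofReal_ne_top]
    have hqb : 1 ≤ qbar := by
      rcases hqbar with ⟨-, rfl⟩ | ⟨-, rfl⟩
      · rw [hqθ']; exact le_top
      · exact le_rfl
    have hid : IsClassD (ContinuousLinearMap.id ℝ X) :=
      ⟨fun x y => ⟨rfl, rfl⟩, Function.surjective_id.denseRange⟩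
    obtain ⟨S, hS⟩ := exists_factor hid hΦ hball hrange (C := ‖T‖ + 1) (by positivity)
      fun x r hx => map_mem_interpBall_of_norm_lt hθ₀ hθ₁ hx
    exact ⟨X, inferInstance, W, hW, Φ, _, S, hqθ' ▸ isConcaveLattice_top hqb, hWconv, hΦ, hid, hS⟩
  · have hqθ1 : 1 ≤ qθ := by
      rw [hqθ]
      refine hq.trans ?_
      rw [ENNReal.le_div_iff_mul_le (Or.inl hθ') (Or.inl ENNReal.ofReal_ne_top)]
      exact mul_le_of_le_one_right' (ENNReal.ofReal_le_one.2 hθ₁.le)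
    have hqθtop : qθ ≠ ∞ := by rw [hqθ]; exact ENNReal.div_ne_top hq' hθ'
    have hqr : q.toReal = θ * qθ.toReal := by
      rw [hqθ, ENNReal.toReal_div, ENNReal.toReal_ofReal hθ₀.le]; field_simp
    obtain ⟨Z, hZ, Ψ, hZconc, hΨ, hmem⟩ := exists_concave_factor (γ := p⁻¹.toReal) hconc
      (zero_le_one.trans hL) hq hq' hθ₀ hθ₁ hqθ1 hqθtop hqr hqbar
    obtain ⟨S, hS⟩ := exists_factor hΨ hΦ hball hrange one_pos fun x r hx => by
      rw [one_mul]; exact hmem x r hx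
    exact ⟨Z, hZ, W, hW, Φ, Ψ, S, hZconc, hWconv, hΦ, hΨ, hS⟩
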